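/- Let $\omega>0$, $\omega'=i\tau$ with $\tau>0$, let $\wp$ be the Weierstrass function with periods $2\omega,2\omega'$ and invariant $g_2$, and let $V_0(x)=6\wp(x+\omega')$, $x\in\mathbb R$, a potential of period $T=2\omega$. Put $e_2=\wp(\omega+\omega')$, $e_3=\wp(\omega')$, $E_1=3e_3$, $E_{1'}=3e_2$. A Bloch function with eigenvalue $a$ is a solution $u\not\equiv 0$ of $-u''+V_0u=au$ with $u(x+T)=\beta u(x)$ for some $\beta\in\mathbb C$. A real energy is allowed if it has a Bloch function with $|\beta|=1$, and forbidden otherwise. A pair $a_1\ne a_2$ of factorization constants gives the second-order displacement $d$ if there are Bloch functions $u_1,u_2$ with eigenvalues $a_1,a_2$ whose Wronskian $W=u_1u_2'-u_1'u_2$ has no zero on $\mathbb R$ and satisfies $V_0(x)-2(\log W)''(x)=V_0(x+d)$ for all $x\in\mathbb R$. A constant $a$ gives the confluent displacement $d$ (the limiting case $a_1=a_2=a$) if there are a Bloch function $u$ with eigenvalue $a$ and a zero-free $w$ with $w'=u^2$ such that $V_0(x)-2(\log w)''(x)=V_0(x+d)$ for all $x\in\mathbb R$. Then $e_2,e_3,g_2$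 are real, $g_2>0$, and: 1. $[E_1,E_{1'}]$ is the first finite forbidden band: $E_1<E_{1'}$; for some $E_0<E_1$ all energies below $E_0$ are forbidden and all those in $[E_0,E_1]$ are allowed; all energies in $(E_1,E_{1'})$ are forbidden; and all those in $[E_{1'},B']$ are allowed for some $B'>E_{1'}$. 2. If real $a_1\ne a_2$ give a real displacement, then $a_1,a_2\in[E_1,E_{1'}]$. 3. There is exactly one $d_{\min}\in(0,\omega]$ with $\wp(d_{\min})=\sqrt{g_2/3}$, and $d_{\min}<\omega=:d_{\max}$. The real displacements given by pairs of real constants $a_1\neq a_2$ are exactly the real $d$ with $d_{\min}<|d-2n\omega|\le d_{\max}$ for some $n\in\mathbb Z$; that is, up to sign and the period $2\omega$ they fill $(d_{\min},d_{\max}]$. 4. The value $d_{\max}=\omega$ is attained at $a_1=E_{1'}$, $a_2=E_1$. If real $a_1>a_2$ give the real displacement $d$, then $d\in\omega+2\omega\mathbb Z$ if and only if $a_1=E_{1'}$ and $a_2=E_1$. 5. The value $d_{\min}$ is attained at $a_1=a_2=-\sqrt{3g_2}/2\in(E_1,E_{1'})$ in the limit: for every $\varepsilon>0$ there is $\delta>0$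 such that whenever real $a_1\ne a_2$ give a real displacement $d$ with $|d-d_{\min}|<\delta$, both $|a_1+\sqrt{3g_2}/2|<\varepsilon$ and $|a_2+\sqrt{3g_2}/2|<\varepsilon$. Moreover a real $a$ gives the real confluent displacement $d$ if and only if $a=-\sqrt{3g_2}/2$ and $|d-2n\omega|=d_{\min}$ for some $n\in\mathbb Z$. -/

import Mathlib

open Set Complex

noncomputable section

/-- `u` is a nonzero Bloch eigenfunction of `-∂² + V` on the real line with eigenvalue `a`,
relative to the period `T`, with Bloch multiplier `β`:
`-u'' + V u = a u` and `u (x + T) = β u x`. -/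
def IsBlochFunction (V : ℝ → ℂ) (T : ℝ) (a β : ℂ) (u : ℝ → ℂ) : Prop :=
  ContDiff ℝ 2 u ∧ (∃ x, u x ≠ 0) ∧
    (∀ x, -iteratedDeriv 2 u x + V x * u x = a * u x) ∧
    ∀ x, u (x + T) = β * u x

/-- The real energy `E` belongs to a spectral (allowed) band of the `T`-periodic potential `V`:
some Bloch eigenfunction at `E` has a multiplier of modulus one. -/
def IsAllowedEnergy (V : ℝ → ℂ) (T E : ℝ) : Prop :=
  ∃ (β : ℂ) (u : ℝ → ℂ), ‖β‖ = 1 ∧ IsBlochFunction V T E β u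

/-- `[A, B]` is the first finite forbidden band of the `T`-periodic potential `V`: below `A` there
is exactly one allowed band `[E₀, A]`, preceded only by the infinite forbidden band `(-∞, E₀)`; no
energy strictly between `A` and `B` is allowed; and an allowed band starts at `B`. -/
def IsFirstFiniteForbiddenBand (V : ℝ → ℂ) (T A B : ℝ) : Prop :=
  A < B ∧
  (∃ E₀ < A, (∀ E < E₀, ¬ IsAllowedEnergy V T E) ∧ ∀ E ∈ Icc E₀ A, IsAllowedEnergy V T E) ∧
  (∀ E ∈ Ioo A B, ¬ IsAllowedEnergy V T E) ∧
  ∃ B' > B, ∀ E ∈ Icc B B', IsAllowedEnergy V T E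

/-- The Wronskian `u₁ u₂' - u₁' u₂`. -/
def wronskian (u₁ u₂ : ℝ → ℂ) (x : ℝ) : ℂ :=
  u₁ x * deriv u₂ x - deriv u₁ x * u₂ x

/-- The potential `V - 2 (log w)''`. -/
def darbouxPotential (V w : ℝ → ℂ) (x : ℝ) : ℂ :=
  V x - 2 * deriv (logDeriv w) x

/-- The second-order Darboux transformation of `V` with (distinct) factorization constants
`a₁`, `a₂` and suitable Bloch transformation functions `u₁`, `u₂` results in the displacement `d`:
the transformed potential `V₂ = V - 2 (log W(u₁, u₂))''` is `V (x + d)`.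
For `a₁ = a₂` the Wronskian is constant (possibly zero) and there is no transformation. -/
def IsDarbouxDisplacement (V : ℝ → ℂ) (T : ℝ) (a₁ a₂ : ℂ) (d : ℝ) : Prop :=
  a₁ ≠ a₂ ∧ ∃ (β₁ β₂ : ℂ) (u₁ u₂ : ℝ → ℂ),
    IsBlochFunction V T a₁ β₁ u₁ ∧ IsBlochFunction V T a₂ β₂ u₂ ∧
    (∀ x, wronskian u₁ u₂ x ≠ 0) ∧
    ∀ x, darbouxPotential V (wronskian u₁ u₂) x = V (x + d)

/-- The confluent second-order Darboux transformation of `V`, with both factorization constants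
equal to `a`, results in the displacement `d`. Since `W(u₁, u₂)' = (a₁ - a₂) u₁ u₂`, the limiting
form of `W / (a₁ - a₂)`, as `a₁, a₂ → a` and `u₁, u₂ → u`, is a function `w` with `w' = u²`. -/
def IsConfluentDarbouxDisplacement (V : ℝ → ℂ) (T : ℝ) (a : ℂ) (d : ℝ) : Prop :=
  ∃ (β : ℂ) (u w : ℝ → ℂ), IsBlochFunction V T a β u ∧
    (∀ x, HasDerivAt w (u x ^ 2) x) ∧ (∀ x, w x ≠ 0) ∧
    ∀ x, darbouxPotential V w x = V (x + d)

/-- The Lamé–Ince potential `6 ℘(x + ω')` for the period lattice `L` and `ω' = i τ`. -/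
def lamePotential (L : PeriodPair) (τ : ℝ) (x : ℝ) : ℂ :=
  6 * L.weierstrassP (x + τ * I)

end

/-! Write p(x) = ℘(x + ω'), P = ℘(d), P' = ℘'(d), σ = e₁² + e₂² + e₃² = g₂/2. The central object is
η = (p' − P') / (2(p − P)), for which η' = 2p + P − η² = p(x) − p(x + d) (`hasDerivAt_eta`,
`add_eq`).

Necessity. A displacement d means (log W)'' = 3η', so W'/W = k + 3η with k constant. The Wronskian
also satisfies a quadratic differential relation that contains the constants only through s = a₁ +
a₂ and D = (a₁ − a₂)². Substitution gives a polynomial in η with constant coefficients, and η takes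
infinitely many values, so k = 0, s = −3P and D = 9(2σ − 3P²) (`darboux_shift`). The confluent case
is the same relation with D = 0. Displacements by a period are excluded by `darboux_period`.

Sufficiency. The numbers m₁ = a₁/3, m₂ = a₂/3 and P are then the three roots of 4(X − e₁)(X − e₂)(X
− e₃) = P'². The one-gap equations φᵢ'' = (2p + mᵢ)φᵢ have Bloch solutions obeying first-order
equations with the common constant P' (`exists_lame_one`). With Φ' = ηΦ, the products Φφ₂ and Φφ₁
solve the two-gap equation at energies 3m₁ and 3m₂, and their Wronskian is a multiple of Φ³, whose
logarithmic derivative is 3η (`isDarbouxDisplacement`).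

Real constants. On (0, ω], ℘ decreases strictly from +∞ to e₁. Distinct real constants need D > 0,
that is P < √(g₂/3); D = 0 is the confluent limit; P = e₁ gives d = ω and the gap edges. That the
constants lie in the gap is a sign argument on a quadratic (`mem_gap`).

Bands. The product F of two Bloch solutions is a polynomial in p, and a first integral of it is the
spectral polynomial. Where that is negative the energy is allowed (`isAllowedEnergy_of_neg`); where
it is positive and the energy is below 3e₂, a reflection argument combined with Sturm comparison
forbids it (`not_isAllowedEnergy`). -/

open Filter Topology

noncomputable section

/-! ### Translation of ℘ by a half-period -/

namespace PeriodPair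

variable (L : PeriodPair)

lemma analyticAt_weierstrassP {z : ℂ} (hz : z ∉ L.lattice) : AnalyticAt ℂ L.weierstrassP z :=
  L.analyticOnNhd_weierstrassP z hz

lemma hasDerivAt_weierstrassP {z : ℂ} (hz : z ∉ L.lattice) :
    HasDerivAt L.weierstrassP (L.derivWeierstrassP z) z := by
  have h := (L.analyticAt_weierstrassP hz).differentiableAt.hasDerivAt
  rwa [L.deriv_weierstrassP] at h

lemma weierstrassP_add_of_mem (z : ℂ) {l : ℂ} (hl : l ∈ L.lattice) :
    L.weierstrassP (z + l) = L.weierstrassP z := L.weierstrassP_add_coe z ⟨l, hl⟩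

lemma derivWeierstrassP_add_of_mem (z : ℂ) {l : ℂ} (hl : l ∈ L.lattice) :
    L.derivWeierstrassP (z + l) = L.derivWeierstrassP z := L.derivWeierstrassP_add_coe z ⟨l, hl⟩

lemma isPreconnected_compl_lattice : IsPreconnected (L.lattice : Set ℂ)ᶜ :=
  ((Set.countable_coe_iff.mp (inferInstanceAs (Countable L.lattice))
    ).isConnected_compl_of_one_lt_rank (by simp)).isPreconnected

lemma weierstrassP_eq_except_zero (z : ℂ) :
    L.weierstrassP z = L.weierstrassPExcept 0 z + 1 / z ^ 2 := by
  have := L.weierstrassPExcept_add 0 z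
  simpa using this.symm

lemma eventually_notMem_lattice : ∀ᶠ z in 𝓝[≠] (0 : ℂ), z ∉ L.lattice := by
  have h := mem_nhdsWithin_of_mem_nhds (t := {0}ᶜ) (L.compl_lattice_sdiff_singleton_mem_nhds 0)
  filter_upwards [h, self_mem_nhdsWithin] with z hz h0 hl
  exact hz ⟨hl, h0⟩

lemma tendsto_weierstrassPExcept_zero : Tendsto (L.weierstrassPExcept 0) (𝓝 0) (𝓝 0) := by
  have := (L.analyticAt_weierstrassPExcept 0).continuousAt.tendsto
  simpa using this

/-- `℘` is not locally constant. -/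
lemma not_eventuallyEq_const_weierstrassP {w : ℂ} (hw : w ∉ L.lattice) (e : ℂ) :
    ¬ ∀ᶠ z in 𝓝 w, L.weierstrassP z = e := by
  intro h
  have heq : EqOn L.weierstrassP (fun _ => e) (L.lattice : Set ℂ)ᶜ :=
    L.analyticOnNhd_weierstrassP.eqOn_of_preconnected_of_eventuallyEq
      (fun _ _ => analyticAt_const) L.isPreconnected_compl_lattice hw h
  have h1 : Tendsto (fun z : ℂ => z ^ 2 * L.weierstrassPExcept 0 z + 1) (𝓝[≠] 0) (𝓝 (0 ^ 2 * 0 + 1)) :=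
    ((((continuous_pow 2).tendsto (0 : ℂ)).mul L.tendsto_weierstrassPExcept_zero).add_const 1).mono_left
      nhdsWithin_le_nhds
  have h2 : Tendsto (fun z : ℂ => z ^ 2 * e) (𝓝[≠] 0) (𝓝 (0 ^ 2 * e)) :=
    (((continuous_pow 2).tendsto (0 : ℂ)).mul_const e).mono_left nhdsWithin_le_nhds
  have h3 : Tendsto (fun z : ℂ => z ^ 2 * e) (𝓝[≠] 0) (𝓝 (0 ^ 2 * 0 + 1)) := by
    refine h1.congr' ?_
    filter_upwards [L.eventually_notMem_lattice, self_mem_nhdsWithin] with z hz h0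
    have h0 : z ≠ 0 := h0
    rw [← show L.weierstrassP z = e from heq hz, L.weierstrassP_eq_except_zero]
    field_simp
  have := tendsto_nhds_unique h2 h3
  norm_num at this

/-- Near a zero of order at least two, an analytic function is `z ^ 2` times an analytic one. -/
lemma _root_.AnalyticAt.exists_eq_sq_mul {f : ℂ → ℂ} (hf : AnalyticAt ℂ f 0) (h0 : f 0 = 0)
    (h1 : deriv f 0 = 0) : ∃ g : ℂ → ℂ, AnalyticAt ℂ g 0 ∧ ∀ z, f z = z ^ 2 * g z := by
  obtain ⟨p, hp⟩ := hf
  have ha : AnalyticAt ℂ (dslope f 0) 0 := ⟨_, hp.has_fpower_series_dslope_fslope⟩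
  obtain ⟨q, hq⟩ := ha
  refine ⟨dslope (dslope f 0) 0, ⟨_, hq.has_fpower_series_dslope_fslope⟩, fun z => ?_⟩
  have e1 := sub_smul_dslope f 0 z
  have e2 := sub_smul_dslope (dslope f 0) 0 z
  simp only [sub_zero, smul_eq_mul, h0, dslope_same, h1] at e1 e2
  rw [pow_two, mul_assoc, e2, e1]

/-- The two-sided translate of `℘ - ℘ w` by a half-period `w` is inverse to it up to a nonzero
constant. -/
theorem exists_halfPeriod_mul (w : ℂ) (hw : w ∉ L.lattice) (hw2 : 2 * w ∈ L.lattice) :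
    ∃ K : ℂ, K ≠ 0 ∧ ∀ z, z ∉ L.lattice → z + w ∉ L.lattice →
      (L.weierstrassP z - L.weierstrassP w) * (L.weierstrassP (z + w) - L.weierstrassP w) = K := by
  classical
  set e := L.weierstrassP w with he
  have hd : L.derivWeierstrassP w = 0 := by
    have h1 : L.derivWeierstrassP (-w + 2 * w) = L.derivWeierstrassP (-w) :=
      L.derivWeierstrassP_add_of_mem _ hw2
    rw [show -w + 2 * w = w by ring, L.derivWeierstrassP_neg] at h1
    exact CharZero.eq_neg_self_iff.mp h1
  have hshift : AnalyticAt ℂ (fun z => L.weierstrassP (z + w) - e) 0 := by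
    have h : AnalyticAt ℂ L.weierstrassP ((0 : ℂ) + w) := by
      rw [zero_add]; exact L.analyticAt_weierstrassP hw
    exact (h.comp_of_eq (f := fun z => z + w) (by fun_prop) rfl).sub analyticAt_const
  -- ℘'(w) = 0, so ℘(z + w) − e has a zero of order at least two at 0, enough to cancel the double
  -- pole of ℘(z).
  obtain ⟨g, hg, hfg⟩ := hshift.exists_eq_sq_mul (by simp [he]) (by
    have h : HasDerivAt L.weierstrassP (L.derivWeierstrassP w) ((0 : ℂ) + w) := by
      rw [zero_add]; exact L.hasDerivAt_weierstrassP hw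
    have h2 := (h.comp_add_const 0 w).sub_const e
    rw [h2.deriv, hd])
  set K := g 0 with hK
  -- The product with its removable singularities filled in. It has periods the lattice and w, so
  -- analyticity at 0 carries over to every exceptional point, and Liouville's theorem applies.
  let bad : ℂ → Prop := fun z => z ∈ L.lattice ∨ z + w ∈ L.lattice
  let h : ℂ → ℂ := fun z =>
    if bad z then K else (L.weierstrassP z - e) * (L.weierstrassP (z + w) - e)
  have hwl (l : ℂ) (hl : l ∈ L.lattice) (z : ℂ) : h (z + l) = h z := by
    have i1 : z + l ∈ L.lattice ↔ z ∈ L.lattice := L.lattice.add_mem_iff_left hl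
    have i2 : z + l + w ∈ L.lattice ↔ z + w ∈ L.lattice := by
      rw [add_right_comm]; exact L.lattice.add_mem_iff_left hl
    have i3 : L.weierstrassP (z + l + w) = L.weierstrassP (z + w) := by
      rw [add_right_comm]; exact L.weierstrassP_add_of_mem _ hl
    simp only [h, bad, i1, i2, i3, L.weierstrassP_add_of_mem z hl]
  have hww (z : ℂ) : h (z + w) = h z := by
    have j : z + w + w = z + 2 * w := by ring
    have i1 : z + w + w ∈ L.lattice ↔ z ∈ L.lattice := by
      rw [j]; exact L.lattice.add_mem_iff_left hw2
    have i3 : L.weierstrassP (z + w + w) = L.weierstrassP z := by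
      rw [j]; exact L.weierstrassP_add_of_mem _ hw2
    simp only [h, bad, i1, i3, or_comm (a := z + w ∈ L.lattice), mul_comm (L.weierstrassP (z + w) - e)]
  have hev : ∀ᶠ z in 𝓝[≠] (0 : ℂ), z ∉ L.lattice ∧ z + w ∉ L.lattice := by
    refine L.eventually_notMem_lattice.and (mem_nhdsWithin_of_mem_nhds ?_)
    have hc : ContinuousAt (fun z : ℂ => z + w) 0 := by fun_prop
    exact hc.preimage_mem_nhds (by
      simpa using L.isClosed_lattice.isOpen_compl.mem_nhds hw)
  have hnear : h =ᶠ[𝓝 0] fun z => (1 + z ^ 2 * (L.weierstrassPExcept 0 z - e)) * g z := by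
    rw [eventually_nhdsWithin_iff] at hev
    filter_upwards [hev] with z hz
    by_cases h0 : z = 0
    · subst h0; simp [h, bad, hK]
    · obtain ⟨a, b⟩ := hz h0
      simp only [h, bad, a, b, or_self, if_false, hfg, L.weierstrassP_eq_except_zero z]
      field_simp
      ring
  have han0 : AnalyticAt ℂ h 0 := by
    refine AnalyticAt.congr ?_ hnear.symm
    have := L.analyticAt_weierstrassPExcept 0
    fun_prop
  have htrans (c : ℂ) (hc : ∀ z, h (z + c) = h z) : AnalyticAt ℂ h c := by
    have h1 : AnalyticAt ℂ (fun z => h (z - c)) c :=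
      AnalyticAt.comp_of_eq (g := h) (f := fun z => z - c) han0 (by fun_prop) (by simp)
    refine h1.congr (Eventually.of_forall fun z => ?_)
    have := hc (z - c)
    rw [sub_add_cancel] at this
    exact this.symm
  have hdiff : Differentiable ℂ h := by
    intro z
    by_cases hz : z ∈ L.lattice
    · exact (htrans z (hwl z hz)).differentiableAt
    by_cases hz2 : z + w ∈ L.lattice
    · refine (htrans z fun y => ?_).differentiableAt
      have : y + (z + w) = y + z + w := by ring
      rw [← hww (y + z), ← this, hwl _ hz2]
    · have h1 : AnalyticAt ℂ (fun z => (L.weierstrassP z - e) * (L.weierstrassP (z + w) - e)) z := by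
        have := L.analyticAt_weierstrassP hz
        have h2 : AnalyticAt ℂ (fun z => L.weierstrassP (z + w)) z :=
          (L.analyticAt_weierstrassP hz2).comp_of_eq (f := fun z => z + w) (by fun_prop) rfl
        fun_prop
      refine (h1.congr ?_).differentiableAt
      have o1 := L.isClosed_lattice.isOpen_compl.mem_nhds hz
      have o2 : ContinuousAt (fun z : ℂ => z + w) z := by fun_prop
      filter_upwards [o1, o2.preimage_mem_nhds (L.isClosed_lattice.isOpen_compl.mem_nhds hz2)]
        with y hy1 hy2
      have hy1 : y ∉ L.lattice := hy1
      have hy2 : y + w ∉ L.lattice := hy2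
      simp [h, bad, hy1, hy2]
  have hconst (z : ℂ) : h z = K := by
    have hb := (IsZLattice.isCompact_range_of_periodic L.lattice h hdiff.continuous
      fun z l hl => hwl l hl z).isBounded
    rw [hdiff.apply_eq_apply_of_bounded hb z 0]
    simp [h, bad]
  refine ⟨K, fun hK0 => ?_, fun z hz1 hz2 => by simpa [h, bad, hz1, hz2] using hconst z⟩
  apply L.not_eventuallyEq_const_weierstrassP hw e
  have h1 : Tendsto (fun z : ℂ => 1 + z ^ 2 * (L.weierstrassPExcept 0 z - e)) (𝓝 0)
      (𝓝 (1 + 0 ^ 2 * (0 - e))) :=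
    (((continuous_pow 2).tendsto (0 : ℂ)).mul
      (L.tendsto_weierstrassPExcept_zero.sub_const e)).const_add 1
  have h2 : ∀ᶠ z in 𝓝 (0 : ℂ), L.weierstrassP (z + w) = e := by
    filter_upwards [h1.eventually_ne (show (1 + 0 ^ 2 * (0 - e) : ℂ) ≠ 0 by norm_num), hnear]
      with z hz hn
    rw [hconst, hK0, eq_comm, mul_eq_zero] at hn
    have := hfg z
    rw [hn.resolve_left hz, mul_zero, sub_eq_zero] at this
    exact this
  have h3 : Tendsto (fun z : ℂ => z - w) (𝓝 w) (𝓝 0) := by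
    have : ContinuousAt (fun z : ℂ => z - w) w := by fun_prop
    simpa [ContinuousAt] using this
  filter_upwards [h3.eventually h2] with z hz
  simpa using hz

end PeriodPair

/-- A real function `p` with derivative `p'` that behaves like `x ↦ ℘ (x + ω')` for a rectangular
period lattice with real period `2 ω` and half-period values `e₁ > e₂ > e₃`. -/
structure IsLameProfile (ω e₁ e₂ e₃ : ℝ) (p p' : ℝ → ℝ) : Prop where
  pos : 0 < ω
  sum : e₁ + e₂ + e₃ = 0
  lt₃₂ : e₃ < e₂
  lt₂₁ : e₂ < e₁
  hasDerivAt : ∀ x, HasDerivAt p (p' x) x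
  hasDerivAt' : ∀ x, HasDerivAt p' (6 * p x ^ 2 - (e₁ ^ 2 + e₂ ^ 2 + e₃ ^ 2)) x
  sq : ∀ x, p' x ^ 2 = 4 * (p x - e₁) * (p x - e₂) * (p x - e₃)
  periodic : ∀ x, p (x + 2 * ω) = p x
  periodic' : ∀ x, p' (x + 2 * ω) = p' x
  even : ∀ x, p (-x) = p x
  zero : p 0 = e₃
  half : p ω = e₂
  le_e₂ : ∀ x, p x ≤ e₂
  e₃_le : ∀ x, e₃ ≤ p x
  e₃_lt : ∀ x ∈ Ioo 0 (2 * ω), e₃ < p x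

/-- The period lattice is rectangular, with periods `2 ω` and `2 i τ`. -/
structure PeriodPair.IsRectangular (L : PeriodPair) (ω τ : ℝ) : Prop where
  hω : 0 < ω
  hτ : 0 < τ
  h₁ : L.ω₁ = 2 * (ω : ℂ)
  h₂ : L.ω₂ = 2 * ((τ : ℂ) * I)

/-! ### Half-period values and reality on a rectangular lattice -/

namespace PeriodPair

/-- The three half-period values of `℘` are the roots of the cubic. -/
lemma halfPeriod_cubic (L : PeriodPair) {w : ℂ} (hw : w ∉ L.lattice) (hw2 : 2 * w ∈ L.lattice) :
    4 * L.weierstrassP w ^ 3 - L.g₂ * L.weierstrassP w - L.g₃ = 0 := by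
  have hd : L.derivWeierstrassP w = 0 := by
    have h1 : L.derivWeierstrassP (-w + 2 * w) = L.derivWeierstrassP (-w) :=
      L.derivWeierstrassP_add_of_mem _ hw2
    rw [show -w + 2 * w = w by ring, L.derivWeierstrassP_neg] at h1
    exact CharZero.eq_neg_self_iff.mp h1
  rw [← L.derivWeierstrassP_sq w hw, hd, zero_pow two_ne_zero]

/-- Off the lattice, a vanishing factor would contradict the nonzero constant of
`exists_halfPeriod_mul`. The inequalities between half-period values rest on this: a continuous real
branch of ℘ that omits such a value stays on one side of it. -/
lemma add_mem_lattice_of_weierstrassP_eq (L : PeriodPair) {w z : ℂ} (hw : w ∉ L.lattice)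
    (hw2 : 2 * w ∈ L.lattice) (hz : z ∉ L.lattice) (h : L.weierstrassP z = L.weierstrassP w) :
    z + w ∈ L.lattice := by
  by_contra hzw
  obtain ⟨K, hK, hmul⟩ := L.exists_halfPeriod_mul w hw hw2
  apply hK
  rw [← hmul z hz hzw, h, sub_self, zero_mul]

/-- Differentiating ℘'² = 4℘³ − g₂℘ − g₃ gives the claim multiplied by ℘'. The zeros of ℘' are
isolated, as otherwise ℘ would be constant, so the factor cancels by continuity. -/
lemma hasDerivAt_derivWeierstrassP (L : PeriodPair) {z : ℂ} (hz : z ∉ L.lattice) :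
    HasDerivAt L.derivWeierstrassP (6 * L.weierstrassP z ^ 2 - L.g₂ / 2) z := by
  have hopen := L.isClosed_lattice.isOpen_compl
  have hA : AnalyticOnNhd ℂ L.derivWeierstrassP (L.lattice : Set ℂ)ᶜ :=
    L.analyticOnNhd_derivWeierstrassP
  have hB : AnalyticOnNhd ℂ (fun z => 2 * deriv L.derivWeierstrassP z - 12 * L.weierstrassP z ^ 2
      + L.g₂) (L.lattice : Set ℂ)ᶜ := by
    intro y hy
    have h1 := (hA y hy).deriv
    have h2 := L.analyticAt_weierstrassP hy
    fun_prop
  have hmul : ∀ y ∈ (L.lattice : Set ℂ)ᶜ, L.derivWeierstrassP y *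
      (2 * deriv L.derivWeierstrassP y - 12 * L.weierstrassP y ^ 2 + L.g₂) = 0 := by
    intro y hy
    have d1 := (hA y hy).differentiableAt.hasDerivAt
    have d2 := L.hasDerivAt_weierstrassP hy
    have d3 := (d1.pow 2).congr_of_eventuallyEq
      (f₁ := fun y => 4 * L.weierstrassP y ^ 3 - L.g₂ * L.weierstrassP y - L.g₃) (by
        filter_upwards [hopen.mem_nhds hy] with x hx
        exact (L.derivWeierstrassP_sq x hx).symm)
    have d4 := (((d2.pow 3).const_mul 4).sub (d2.const_mul L.g₂)).sub_const L.g₃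
    have := d3.unique d4
    simp only [Nat.cast_ofNat, Nat.add_one_sub_one, pow_one] at this
    linear_combination this
  have key : 2 * deriv L.derivWeierstrassP z - 12 * L.weierstrassP z ^ 2 + L.g₂ = 0 := by
    rcases (hA z hz).eventually_eq_zero_or_eventually_ne_zero with h | h
    · exfalso
      have heq : EqOn L.derivWeierstrassP (fun _ => 0) (L.lattice : Set ℂ)ᶜ :=
        hA.eqOn_of_preconnected_of_eventuallyEq (fun _ _ => analyticAt_const)
          L.isPreconnected_compl_lattice hz h
      refine L.not_eventuallyEq_const_weierstrassP hz (L.weierstrassP z) ?_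
      filter_upwards [hopen.mem_nhds hz] with y hy
      exact hopen.is_const_of_deriv_eq_zero L.isPreconnected_compl_lattice
        L.differentiableOn_weierstrassP
        (fun x hx => by rw [L.deriv_weierstrassP]; exact heq hx) hy hz
    · have hz0 : (fun z => 2 * deriv L.derivWeierstrassP z - 12 * L.weierstrassP z ^ 2
          + L.g₂) =ᶠ[𝓝[≠] z] fun _ => 0 := by
        filter_upwards [h, mem_nhdsWithin_of_mem_nhds (hopen.mem_nhds hz)] with y hy hy2
        exact (mul_eq_zero.mp (hmul y hy2)).resolve_left hy
      have ht := ((hB z hz).continuousAt.tendsto.mono_left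
        (nhdsWithin_le_nhds (s := {z}ᶜ))).congr' hz0
      exact tendsto_nhds_unique ht tendsto_const_nhds
  have := (hA z hz).differentiableAt.hasDerivAt
  have e : 6 * L.weierstrassP z ^ 2 - L.g₂ / 2 = deriv L.derivWeierstrassP z := by
    linear_combination -key / 2
  rwa [e]

namespace IsRectangular

variable {L : PeriodPair} {ω τ : ℝ}

lemma mem_lattice_iff (h : L.IsRectangular ω τ) (z : ℂ) :
    z ∈ L.lattice ↔ (∃ m : ℤ, z.re = 2 * m * ω) ∧ ∃ n : ℤ, z.im = 2 * n * τ := by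
  rw [PeriodPair.mem_lattice, h.h₁, h.h₂]
  constructor
  · rintro ⟨m, n, rfl⟩
    exact ⟨⟨m, by simp; ring⟩, ⟨n, by simp; ring⟩⟩
  · rintro ⟨⟨m, hm⟩, ⟨n, hn⟩⟩
    exact ⟨m, n, by apply Complex.ext <;> simp [hm, hn] <;> ring⟩

lemma int_not_odd {c : ℝ} (hc : 0 < c) (n : ℤ) : c ≠ 2 * n * c := by
  intro e
  have : (1 : ℝ) = 2 * n := by
    apply mul_right_cancel₀ hc.ne'; linarith
  norm_cast at this
  omega

lemma notMem_of_im (h : L.IsRectangular ω τ) {z : ℂ} (hz : z.im = τ) : z ∉ L.lattice := by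
  rw [h.mem_lattice_iff, hz]
  rintro ⟨-, n, hn⟩
  exact int_not_odd h.hτ n hn

lemma notMem_of_re (h : L.IsRectangular ω τ) {z : ℂ} (hz : z.re = ω) : z ∉ L.lattice := by
  rw [h.mem_lattice_iff, hz]
  rintro ⟨⟨n, hn⟩, -⟩
  exact int_not_odd h.hω n hn

lemma not_int_of_Ioo {c x : ℝ} (hx : x ∈ Ioo 0 (2 * c)) (n : ℤ) : x ≠ 2 * n * c := by
  rintro rfl
  obtain ⟨h1, h2⟩ := hx
  have hc : 0 < c := by linarith
  have h1' : (0 : ℝ) < n := by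
    by_contra hn
    push Not at hn
    nlinarith
  have h2' : (n : ℝ) < 1 := by nlinarith
  norm_cast at h1' h2'
  omega

lemma notMem_of_re_Ioo (h : L.IsRectangular ω τ) {z : ℂ} (hz : z.re ∈ Ioo 0 (2 * ω)) :
    z ∉ L.lattice := by
  rw [h.mem_lattice_iff]
  rintro ⟨⟨n, hn⟩, -⟩
  exact not_int_of_Ioo hz n hn

lemma notMem_of_im_Ioo (h : L.IsRectangular ω τ) {z : ℂ} (hz : z.im ∈ Ioo 0 (2 * τ)) :
    z ∉ L.lattice := by
  rw [h.mem_lattice_iff]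
  rintro ⟨-, ⟨n, hn⟩⟩
  exact not_int_of_Ioo hz n hn

/-- Complex conjugation on the period lattice. -/
def conjEquiv (h : L.IsRectangular ω τ) : L.lattice ≃ L.lattice where
  toFun l := ⟨(starRingEnd ℂ) l, by
    obtain ⟨⟨m, hm⟩, ⟨n, hn⟩⟩ := (h.mem_lattice_iff _).mp l.2
    exact (h.mem_lattice_iff _).mpr ⟨⟨m, by simpa using hm⟩, ⟨-n, by simp [hn]⟩⟩⟩
  invFun l := ⟨(starRingEnd ℂ) l, by
    obtain ⟨⟨m, hm⟩, ⟨n, hn⟩⟩ := (h.mem_lattice_iff _).mp l.2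
    exact (h.mem_lattice_iff _).mpr ⟨⟨m, by simpa using hm⟩, ⟨-n, by simp [hn]⟩⟩⟩
  left_inv l := by simp
  right_inv l := by simp

lemma weierstrassP_conj (h : L.IsRectangular ω τ) (z : ℂ) :
    L.weierstrassP ((starRingEnd ℂ) z) = (starRingEnd ℂ) (L.weierstrassP z) := by
  rw [weierstrassP, weierstrassP, conj_tsum, ← h.conjEquiv.tsum_eq]
  simp [conjEquiv]

lemma derivWeierstrassP_conj (h : L.IsRectangular ω τ) (z : ℂ) :
    L.derivWeierstrassP ((starRingEnd ℂ) z) = (starRingEnd ℂ) (L.derivWeierstrassP z) := by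
  rw [derivWeierstrassP, derivWeierstrassP, map_neg, conj_tsum, ← h.conjEquiv.tsum_eq]
  simp [conjEquiv, map_ofNat]

lemma two_ω_mem (h : L.IsRectangular ω τ) : (2 * ω : ℂ) ∈ L.lattice := by
  rw [← h.h₁]; exact L.ω₁_mem_lattice

lemma two_τ_mem (h : L.IsRectangular ω τ) : 2 * ((τ : ℂ) * I) ∈ L.lattice := by
  rw [← h.h₂]; exact L.ω₂_mem_lattice

lemma two_ωτ_mem (h : L.IsRectangular ω τ) : 2 * ((ω : ℂ) + (τ : ℂ) * I) ∈ L.lattice := by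
  rw [mul_add]; exact L.lattice.add_mem h.two_ω_mem h.two_τ_mem

lemma ofReal_re_weierstrassP (h : L.IsRectangular ω τ) (x : ℝ) :
    (((L.weierstrassP x).re : ℝ) : ℂ) = L.weierstrassP x := by
  rw [← Complex.conj_eq_iff_re, ← h.weierstrassP_conj, Complex.conj_ofReal]

lemma ofReal_re_derivWeierstrassP (h : L.IsRectangular ω τ) (x : ℝ) :
    (((L.derivWeierstrassP x).re : ℝ) : ℂ) = L.derivWeierstrassP x := by
  rw [← Complex.conj_eq_iff_re, ← h.derivWeierstrassP_conj, Complex.conj_ofReal]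

/-- Conjugation moves x + iτ by the period 2iτ. -/
lemma ofReal_re_weierstrassP_add (h : L.IsRectangular ω τ) (x : ℝ) :
    (((L.weierstrassP (x + τ * I)).re : ℝ) : ℂ) = L.weierstrassP (x + τ * I) := by
  rw [← Complex.conj_eq_iff_re, ← h.weierstrassP_conj]
  have : (starRingEnd ℂ) ((x : ℂ) + τ * I) + 2 * ((τ : ℂ) * I) = x + τ * I := by
    simp; ring
  have e := L.weierstrassP_add_of_mem ((starRingEnd ℂ) ((x : ℂ) + τ * I)) h.two_τ_mem
  rw [← e, this]

lemma ofReal_re_derivWeierstrassP_add (h : L.IsRectangular ω τ) (x : ℝ) :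
    (((L.derivWeierstrassP (x + τ * I)).re : ℝ) : ℂ) = L.derivWeierstrassP (x + τ * I) := by
  rw [← Complex.conj_eq_iff_re, ← h.derivWeierstrassP_conj]
  have : (starRingEnd ℂ) ((x : ℂ) + τ * I) + 2 * ((τ : ℂ) * I) = x + τ * I := by
    simp; ring
  have e := L.derivWeierstrassP_add_of_mem ((starRingEnd ℂ) ((x : ℂ) + τ * I)) h.two_τ_mem
  rw [← e, this]

lemma ofReal_re_weierstrassP_imag (h : L.IsRectangular ω τ) (y : ℝ) :
    (((L.weierstrassP (y * I)).re : ℝ) : ℂ) = L.weierstrassP (y * I) := by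
  rw [← Complex.conj_eq_iff_re, ← h.weierstrassP_conj]
  have : (starRingEnd ℂ) ((y : ℂ) * I) = -(y * I) := by simp
  rw [this, L.weierstrassP_neg]

end IsRectangular

lemma weierstrassP_ne_of_notMem (L : PeriodPair) {w z : ℂ} (hw : w ∉ L.lattice)
    (hw2 : 2 * w ∈ L.lattice) (hz : z ∉ L.lattice) (hzw : z + w ∉ L.lattice) :
    L.weierstrassP z ≠ L.weierstrassP w :=
  fun e => hzw (L.add_mem_lattice_of_weierstrassP_eq hw hw2 hz e)

end PeriodPair

/-! ### Order and monotonicity of the real branches of ℘ -/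

namespace PeriodPair

/-- `℘` on the real line, for a rectangular lattice. -/
def realP (L : PeriodPair) (x : ℝ) : ℝ := (L.weierstrassP x).re

/-- `℘'` on the real line, for a rectangular lattice. -/
def realP' (L : PeriodPair) (x : ℝ) : ℝ := (L.derivWeierstrassP x).re

/-- `℘ (x + i τ)` for real `x`. -/
def shiftP (L : PeriodPair) (τ x : ℝ) : ℝ := (L.weierstrassP (x + τ * I)).re

/-- `℘' (x + i τ)` for real `x`. -/
def shiftP' (L : PeriodPair) (τ x : ℝ) : ℝ := (L.derivWeierstrassP (x + τ * I)).re

lemma tendsto_realP (L : PeriodPair) : Tendsto L.realP (𝓝[>] 0) atTop := by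
  have h1 : Tendsto (fun x : ℝ => (L.weierstrassPExcept 0 x).re) (𝓝[>] 0) (𝓝 0) := by
    have hc : Tendsto (fun x : ℝ => (x : ℂ)) (𝓝[>] 0) (𝓝 0) :=
      (Complex.continuous_ofReal.tendsto' 0 0 (by simp)).mono_left nhdsWithin_le_nhds
    exact (Complex.continuous_re.tendsto 0).comp (L.tendsto_weierstrassPExcept_zero.comp hc)
  have h2 : Tendsto (fun x : ℝ => (x⁻¹) ^ 2) (𝓝[>] 0) atTop :=
    (tendsto_pow_atTop two_ne_zero).comp tendsto_inv_nhdsGT_zero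
  refine (h1.add_atTop h2).congr fun x => ?_
  rw [realP, L.weierstrassP_eq_except_zero, add_re]
  congr 1
  rw [← ofReal_pow, ← ofReal_one, ← ofReal_div, ofReal_re]
  simp

lemma tendsto_re_weierstrassP_imag (L : PeriodPair) :
    Tendsto (fun y : ℝ => (L.weierstrassP (y * I)).re) (𝓝[>] 0) atBot := by
  have h1 : Tendsto (fun y : ℝ => (L.weierstrassPExcept 0 (y * I)).re) (𝓝[>] 0) (𝓝 0) := by
    have hc : Tendsto (fun x : ℝ => (x : ℂ) * I) (𝓝[>] 0) (𝓝 0) :=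
      ((by fun_prop : Continuous fun x : ℝ => (x : ℂ) * I).tendsto' 0 0 (by simp)).mono_left
        nhdsWithin_le_nhds
    exact (Complex.continuous_re.tendsto 0).comp (L.tendsto_weierstrassPExcept_zero.comp hc)
  have h2 : Tendsto (fun x : ℝ => -(x⁻¹) ^ 2) (𝓝[>] 0) atBot :=
    tendsto_neg_atTop_atBot.comp ((tendsto_pow_atTop two_ne_zero).comp tendsto_inv_nhdsGT_zero)
  refine (h1.add_atBot h2).congr fun x => ?_
  rw [L.weierstrassP_eq_except_zero, add_re]
  congr 1
  rw [mul_pow, I_sq, mul_neg_one, ← ofReal_pow, ← ofReal_one, ← ofReal_neg, ← ofReal_div, ofReal_re]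
  simp [div_neg]

namespace IsRectangular

variable {L : PeriodPair} {ω τ : ℝ}

lemma ofReal_realP (h : L.IsRectangular ω τ) (x : ℝ) : (L.realP x : ℂ) = L.weierstrassP x :=
  h.ofReal_re_weierstrassP x

lemma ofReal_realP' (h : L.IsRectangular ω τ) (x : ℝ) :
    (L.realP' x : ℂ) = L.derivWeierstrassP x := h.ofReal_re_derivWeierstrassP x

lemma ofReal_shiftP (h : L.IsRectangular ω τ) (x : ℝ) :
    (L.shiftP τ x : ℂ) = L.weierstrassP (x + τ * I) := h.ofReal_re_weierstrassP_add x

lemma ofReal_shiftP' (h : L.IsRectangular ω τ) (x : ℝ) :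
    (L.shiftP' τ x : ℂ) = L.derivWeierstrassP (x + τ * I) := h.ofReal_re_derivWeierstrassP_add x

lemma real_mem_lattice_iff (h : L.IsRectangular ω τ) (x : ℝ) :
    (x : ℂ) ∈ L.lattice ↔ ∃ m : ℤ, x = 2 * m * ω := by
  rw [h.mem_lattice_iff]
  simp only [ofReal_re, ofReal_im, and_iff_left_iff_imp]
  exact fun _ => ⟨0, by simp⟩

lemma ω_notMem (h : L.IsRectangular ω τ) : (ω : ℂ) ∉ L.lattice := h.notMem_of_re (by simp)

lemma τ_notMem (h : L.IsRectangular ω τ) (x : ℝ) : (x : ℂ) + τ * I ∉ L.lattice :=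
  h.notMem_of_im (by simp)

lemma τ_notMem' (h : L.IsRectangular ω τ) : (τ : ℂ) * I ∉ L.lattice := h.notMem_of_im (by simp)

lemma two_τ_mem_zero (h : L.IsRectangular ω τ) : 2 * (((0 : ℝ) : ℂ) + (τ : ℂ) * I) ∈ L.lattice := by
  simpa using h.two_τ_mem

/-- The half-period values are the roots of `4 X³ - g₂ X - g₃`. -/
lemma vieta (h : L.IsRectangular ω τ) :
    L.realP ω + L.shiftP τ ω + L.shiftP τ 0 = 0 ∧
    L.g₂ = ((2 * (L.realP ω ^ 2 + L.shiftP τ ω ^ 2 + L.shiftP τ 0 ^ 2) : ℝ) : ℂ) ∧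
    L.g₃ = ((4 * L.realP ω * L.shiftP τ ω * L.shiftP τ 0 : ℝ) : ℂ) := by
  have c1 := L.halfPeriod_cubic h.ω_notMem h.two_ω_mem
  have c2 := L.halfPeriod_cubic (h.τ_notMem ω) h.two_ωτ_mem
  have c3 := L.halfPeriod_cubic (h.τ_notMem 0) h.two_τ_mem_zero
  have n12 := L.weierstrassP_ne_of_notMem (h.τ_notMem ω) h.two_ωτ_mem h.ω_notMem
    (h.notMem_of_im (by simp))
  have n13 := L.weierstrassP_ne_of_notMem (h.τ_notMem 0) h.two_τ_mem_zero h.ω_notMem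
    (h.notMem_of_im (by simp))
  have n23 := L.weierstrassP_ne_of_notMem (h.τ_notMem 0) h.two_τ_mem_zero (h.τ_notMem ω)
    (h.notMem_of_re (by simp))
  rw [← h.ofReal_realP, ← h.ofReal_shiftP] at n12
  rw [← h.ofReal_realP, ← h.ofReal_shiftP] at n13
  rw [← h.ofReal_shiftP, ← h.ofReal_shiftP] at n23
  rw [← h.ofReal_realP] at c1
  rw [← h.ofReal_shiftP] at c2 c3
  generalize L.realP ω = a at *
  generalize L.shiftP τ ω = b at *
  generalize L.shiftP τ 0 = c at *
  have s12 : (4 : ℂ) * (a ^ 2 + a * b + b ^ 2) - L.g₂ = 0 := by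
    apply mul_left_cancel₀ (sub_ne_zero.mpr n12); linear_combination c1 - c2
  have s13 : (4 : ℂ) * (a ^ 2 + a * c + c ^ 2) - L.g₂ = 0 := by
    apply mul_left_cancel₀ (sub_ne_zero.mpr n13); linear_combination c1 - c3
  have s : (a : ℂ) + b + c = 0 := by
    apply mul_left_cancel₀ (sub_ne_zero.mpr n23); linear_combination (s12 - s13) / 4
  refine ⟨by exact_mod_cast s, ?_, ?_⟩
  · push_cast
    linear_combination -s12 + (2 * a + 2 * b - 2 * c) * s
  · push_cast
    linear_combination -c1 + (a : ℂ) * s12 - (4 * a * b) * s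

lemma cubic_factor (h : L.IsRectangular ω τ) (y : ℝ) :
    (4 * (y : ℂ) ^ 3 - L.g₂ * y - L.g₃) =
      ((4 * (y - L.realP ω) * (y - L.shiftP τ ω) * (y - L.shiftP τ 0) : ℝ) : ℂ) := by
  obtain ⟨s, e2, e3⟩ := h.vieta
  have hs : (L.realP ω : ℂ) + L.shiftP τ ω + L.shiftP τ 0 = 0 := by exact_mod_cast s
  rw [e2, e3]
  push_cast
  linear_combination (4 * (y : ℂ) ^ 2 - 2 * y * (L.realP ω + L.shiftP τ ω + L.shiftP τ 0)) * hs

lemma realP'_sq (h : L.IsRectangular ω τ) {x : ℝ} (hx : (x : ℂ) ∉ L.lattice) :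
    L.realP' x ^ 2 =
      4 * (L.realP x - L.realP ω) * (L.realP x - L.shiftP τ ω) * (L.realP x - L.shiftP τ 0) := by
  have := L.derivWeierstrassP_sq x hx
  rw [← h.ofReal_realP, ← h.ofReal_realP', h.cubic_factor] at this
  exact_mod_cast this

lemma shiftP'_sq (h : L.IsRectangular ω τ) (x : ℝ) :
    L.shiftP' τ x ^ 2 =
      4 * (L.shiftP τ x - L.realP ω) * (L.shiftP τ x - L.shiftP τ ω) *
        (L.shiftP τ x - L.shiftP τ 0) := by
  have := L.derivWeierstrassP_sq _ (h.τ_notMem x)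
  rw [← h.ofReal_shiftP, ← h.ofReal_shiftP', h.cubic_factor] at this
  exact_mod_cast this

lemma hasDerivAt_realP {x : ℝ} (hx : (x : ℂ) ∉ L.lattice) :
    HasDerivAt L.realP (L.realP' x) x := (L.hasDerivAt_weierstrassP hx).real_of_complex

lemma hasDerivAt_shiftP (h : L.IsRectangular ω τ) (x : ℝ) :
    HasDerivAt (L.shiftP τ) (L.shiftP' τ x) x :=
  ((L.hasDerivAt_weierstrassP (h.τ_notMem x)).comp_add_const _ _).real_of_complex

lemma hasDerivAt_shiftP' (h : L.IsRectangular ω τ) (x : ℝ) :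
    HasDerivAt (L.shiftP' τ) (6 * L.shiftP τ x ^ 2 -
      (L.realP ω ^ 2 + L.shiftP τ ω ^ 2 + L.shiftP τ 0 ^ 2)) x := by
  have := ((L.hasDerivAt_derivWeierstrassP (h.τ_notMem x)).comp_add_const _ _).real_of_complex
  refine this.congr_deriv (Eq.symm ?_)
  rw [← h.ofReal_shiftP, h.vieta.2.1, ← ofReal_re (6 * L.shiftP τ x ^ 2 - _)]
  congr 1
  push_cast
  ring

lemma continuousOn_realP (h : L.IsRectangular ω τ) : ContinuousOn L.realP (Ioo 0 (2 * ω)) :=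
  fun _ hx => (hasDerivAt_realP
    (h.notMem_of_re_Ioo (by simpa using hx))).continuousAt.continuousWithinAt

lemma continuousOn_imag (h : L.IsRectangular ω τ) :
    ContinuousOn (fun y : ℝ => (L.weierstrassP (y * I)).re) (Ioo 0 (2 * τ)) := by
  intro y hy
  have h1 : ContinuousAt L.weierstrassP (y * I) :=
    (L.analyticAt_weierstrassP (h.notMem_of_im_Ioo (by simpa using hy))).continuousAt
  have h2 : ContinuousAt (fun y : ℝ => L.weierstrassP (y * I)) y :=
    ContinuousAt.comp (g := L.weierstrassP) (f := fun y : ℝ => (y : ℂ) * I) h1 (by fun_prop)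
  exact (Complex.continuous_re.continuousAt.comp h2).continuousWithinAt

/-- A continuous function on `(0, b)` that tends to `∞` at `0` and omits the value `c` exceeds
`c`. -/
lemma _root_.lt_of_tendsto_atTop_of_forall_ne {f : ℝ → ℝ} {b c : ℝ}
    (hf : ContinuousOn f (Ioo 0 b)) (ht : Tendsto f (𝓝[>] 0) atTop)
    (hne : ∀ x ∈ Ioo 0 b, f x ≠ c) {x : ℝ} (hx : x ∈ Ioo 0 b) : c < f x := by
  by_contra hlt
  push Not at hlt
  obtain ⟨y, hy1, hy2⟩ := ((ht.eventually_gt_atTop c).and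
    (Ioo_mem_nhdsGT hx.1)).exists
  obtain ⟨z, hz, hz2⟩ := isPreconnected_Ioo.intermediate_value hx
    ⟨hy2.1, hy2.2.trans hx.2⟩ hf ⟨hlt, hy1.le⟩
  exact hne z hz hz2

lemma shiftP_ω_lt (h : L.IsRectangular ω τ) {x : ℝ} (hx : x ∈ Ioo 0 (2 * ω)) :
    L.shiftP τ ω < L.realP x := by
  refine lt_of_tendsto_atTop_of_forall_ne h.continuousOn_realP L.tendsto_realP (fun y hy e => ?_) hx
  refine L.weierstrassP_ne_of_notMem (h.τ_notMem ω) h.two_ωτ_mem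
    (h.notMem_of_re_Ioo (by simpa using hy)) (h.notMem_of_im (z := y + (ω + τ * I)) (by simp)) ?_
  rw [← h.ofReal_realP, ← h.ofReal_shiftP, e]

lemma shiftP_zero_lt_realP (h : L.IsRectangular ω τ) {x : ℝ} (hx : x ∈ Ioo 0 (2 * ω)) :
    L.shiftP τ 0 < L.realP x := by
  refine lt_of_tendsto_atTop_of_forall_ne h.continuousOn_realP L.tendsto_realP (fun y hy e => ?_) hx
  refine L.weierstrassP_ne_of_notMem (h.τ_notMem 0) h.two_τ_mem_zero
    (h.notMem_of_re_Ioo (by simpa using hy)) (h.notMem_of_im (z := y + (_ + τ * I)) (by simp)) ?_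
  rw [← h.ofReal_realP, ← h.ofReal_shiftP, e]

lemma ω_mem_Ioo (h : L.IsRectangular ω τ) : ω ∈ Ioo 0 (2 * ω) :=
  ⟨h.hω, by linarith [h.hω]⟩

lemma realP_ω_lt (h : L.IsRectangular ω τ) {x : ℝ} (hx : x ∈ Ioo 0 ω) :
    L.realP ω < L.realP x := by
  have hsub : Ioo 0 ω ⊆ Ioo 0 (2 * ω) := Ioo_subset_Ioo_right (by linarith [h.hω])
  refine lt_of_tendsto_atTop_of_forall_ne (h.continuousOn_realP.mono hsub)
    L.tendsto_realP (fun y hy e => ?_) hx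
  refine L.weierstrassP_ne_of_notMem h.ω_notMem h.two_ω_mem
    (h.notMem_of_re_Ioo (by simpa using hsub hy))
    (h.notMem_of_re_Ioo (z := y + ω) ?_) ?_
  · simp only [add_re, ofReal_re]
    exact ⟨by linarith [hy.1, h.hω], by linarith [hy.2]⟩
  · rw [← h.ofReal_realP, ← h.ofReal_realP, e]

/-- On the imaginary axis ℘ is real, tends to −∞ at 0 and never equals e₂, because iy + ω + iτ has
real part ω. So it stays below e₂ up to y = τ, where its value is e₃. -/
lemma shiftP_zero_lt (h : L.IsRectangular ω τ) : L.shiftP τ 0 < L.shiftP τ ω := by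
  have key := lt_of_tendsto_atTop_of_forall_ne (f := fun y : ℝ => -(L.weierstrassP (y * I)).re)
    (b := 2 * τ) (c := -L.shiftP τ ω) (x := τ) h.continuousOn_imag.neg
    (tendsto_neg_atBot_atTop.comp L.tendsto_re_weierstrassP_imag) (fun y hy e => by
      refine L.weierstrassP_ne_of_notMem (h.τ_notMem ω) h.two_ωτ_mem
        (h.notMem_of_im_Ioo (z := y * I) (by simpa using hy))
        (h.notMem_of_re (z := y * I + (ω + τ * I)) (by simp)) ?_
      rw [← h.ofReal_re_weierstrassP_imag, ← h.ofReal_shiftP, neg_inj.mp e])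
    ⟨h.hτ, by linarith [h.hτ]⟩
  simpa [shiftP] using key

lemma shiftP_ne_realP_ω (h : L.IsRectangular ω τ) (x : ℝ) : L.shiftP τ x ≠ L.realP ω := by
  intro e
  refine L.weierstrassP_ne_of_notMem h.ω_notMem h.two_ω_mem (h.τ_notMem x)
    (h.notMem_of_im (z := x + τ * I + ω) (by simp)) ?_
  rw [← h.ofReal_realP, ← h.ofReal_shiftP, e]

lemma continuous_shiftP (h : L.IsRectangular ω τ) : Continuous (L.shiftP τ) :=
  continuous_iff_continuousAt.mpr fun x => (h.hasDerivAt_shiftP x).continuousAt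

lemma shiftP_lt_realP_ω (h : L.IsRectangular ω τ) (x : ℝ) : L.shiftP τ x < L.realP ω := by
  by_contra hlt
  push Not at hlt
  obtain ⟨z, -, hz⟩ := isPreconnected_univ.intermediate_value (mem_univ 0) (mem_univ x)
    h.continuous_shiftP.continuousOn ⟨(h.shiftP_zero_lt_realP h.ω_mem_Ioo).le, hlt⟩
  exact h.shiftP_ne_realP_ω z hz

/-- In the cubic the factor p − e₁ is negative, so p'² ≥ 0 forces (p − e₂)(p − e₃) ≤ 0. -/
lemma shiftP_mem_Icc (h : L.IsRectangular ω τ) (x : ℝ) :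
    L.shiftP τ x ∈ Icc (L.shiftP τ 0) (L.shiftP τ ω) := by
  have h1 := h.shiftP'_sq x
  have h2 := h.shiftP_lt_realP_ω x
  have h3 := h.shiftP_zero_lt
  have h4 : (L.shiftP τ x - L.shiftP τ ω) * (L.shiftP τ x - L.shiftP τ 0) ≤ 0 := by
    by_contra hc
    push Not at hc
    nlinarith [sq_nonneg (L.shiftP' τ x), mul_pos (sub_pos.mpr h2) hc]
  constructor <;> by_contra hc <;> push Not at hc <;> nlinarith

theorem isLameProfile (h : L.IsRectangular ω τ) :
    IsLameProfile ω (L.realP ω) (L.shiftP τ ω) (L.shiftP τ 0) (L.shiftP τ) (L.shiftP' τ) where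
  pos := h.hω
  sum := h.vieta.1
  lt₃₂ := h.shiftP_zero_lt
  lt₂₁ := h.shiftP_ω_lt h.ω_mem_Ioo
  hasDerivAt := h.hasDerivAt_shiftP
  hasDerivAt' := h.hasDerivAt_shiftP'
  sq := h.shiftP'_sq
  periodic x := by
    rw [shiftP, shiftP, ← L.weierstrassP_add_of_mem ((x : ℂ) + τ * I) h.two_ω_mem]
    push_cast; ring_nf
  periodic' x := by
    rw [shiftP', shiftP', ← L.derivWeierstrassP_add_of_mem ((x : ℂ) + τ * I) h.two_ω_mem]
    push_cast; ring_nf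
  even x := by
    rw [shiftP, shiftP, ← L.weierstrassP_neg ((x : ℂ) + τ * I),
      ← L.weierstrassP_add_of_mem (-((x : ℂ) + τ * I)) h.two_τ_mem]
    push_cast; ring_nf
  zero := rfl
  half := rfl
  le_e₂ x := (h.shiftP_mem_Icc x).2
  e₃_le x := (h.shiftP_mem_Icc x).1
  e₃_lt x hx := by
    refine lt_of_le_of_ne (h.shiftP_mem_Icc x).1 fun e => ?_
    refine L.weierstrassP_ne_of_notMem (h.τ_notMem 0) h.two_τ_mem_zero (h.τ_notMem x)
      (h.notMem_of_re_Ioo (z := x + τ * I + (((0 : ℝ) : ℂ) + τ * I)) (by simpa using hx)) ?_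
    rw [← h.ofReal_shiftP, ← h.ofReal_shiftP, e]

/-- By the cubic, ℘' has no zero on (0, ω) and hence one sign there; a positive sign would
contradict `realP_ω_lt`. -/
lemma strictAntiOn_realP (h : L.IsRectangular ω τ) : StrictAntiOn L.realP (Ioc 0 ω) := by
  have hsub : Ioc 0 ω ⊆ Ioo 0 (2 * ω) := fun x hx => ⟨hx.1, by linarith [hx.2, h.hω]⟩
  have hn (x : ℝ) (hx : x ∈ Ioc 0 ω) : (x : ℂ) ∉ L.lattice :=
    h.notMem_of_re_Ioo (by simpa using hsub hx)
  have hne (x : ℝ) (hx : x ∈ Ioo 0 ω) : L.realP' x ≠ 0 := by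
    have h1 := h.realP'_sq (hn x (Ioo_subset_Ioc_self hx))
    have h2 := h.realP_ω_lt hx
    have h3 := h.shiftP_ω_lt (hsub (Ioo_subset_Ioc_self hx))
    have h4 := h.shiftP_zero_lt_realP (hsub (Ioo_subset_Ioc_self hx))
    intro h0
    rw [h0] at h1
    have := mul_pos (mul_pos (sub_pos.mpr h2) (sub_pos.mpr h3)) (sub_pos.mpr h4)
    nlinarith
  have hcont : ContinuousOn L.realP (Ioc 0 ω) := h.continuousOn_realP.mono hsub
  have hcont' : ContinuousOn L.realP' (Ioo 0 ω) := fun x hx =>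
    (L.hasDerivAt_derivWeierstrassP (hn x (Ioo_subset_Ioc_self
      hx))).real_of_complex.continuousAt.continuousWithinAt
  have hneg (x : ℝ) (hx : x ∈ Ioo 0 ω) : L.realP' x < 0 := by
    by_contra hc
    push Not at hc
    have hpos (y : ℝ) (hy : y ∈ Ioo 0 ω) : 0 < L.realP' y := by
      by_contra hc2
      push Not at hc2
      obtain ⟨z, hz, hz0⟩ := isPreconnected_Ioo.intermediate_value hy hx hcont' ⟨hc2, hc⟩
      exact hne z hz hz0
    have hmono : StrictMonoOn L.realP (Ioc 0 ω) := by
      refine strictMonoOn_of_deriv_pos (convex_Ioc 0 ω) hcont fun y hy => ?_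
      rw [interior_Ioc] at hy
      rw [(hasDerivAt_realP (hn y (Ioo_subset_Ioc_self hy))).deriv]
      exact hpos y hy
    exact (hmono (Ioo_subset_Ioc_self hx) ⟨h.hω, le_rfl⟩ hx.2).not_gt (h.realP_ω_lt hx)
  refine strictAntiOn_of_deriv_neg (convex_Ioc 0 ω) hcont fun y hy => ?_
  rw [interior_Ioc] at hy
  rw [(hasDerivAt_realP (hn y (Ioo_subset_Ioc_self hy))).deriv]
  exact hneg y hy

/-- Translation by the half-period `i τ`. -/
lemma shiftP_sub_mul (h : L.IsRectangular ω τ) {x : ℝ} (hx : (x : ℂ) ∉ L.lattice) :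
    (L.shiftP τ x - L.shiftP τ 0) * (L.realP x - L.shiftP τ 0) =
      (L.shiftP τ ω - L.shiftP τ 0) * (L.realP ω - L.shiftP τ 0) := by
  obtain ⟨K, -, hK⟩ := L.exists_halfPeriod_mul _ h.τ_notMem' h.two_τ_mem
  have e0 : L.weierstrassP (τ * I) = (L.shiftP τ 0 : ℂ) := by rw [h.ofReal_shiftP]; simp
  have h1 := hK x hx (h.τ_notMem x)
  have h2 := hK ω h.ω_notMem (h.τ_notMem ω)
  rw [← h2, e0, ← h.ofReal_shiftP, ← h.ofReal_shiftP, ← h.ofReal_realP, ← h.ofReal_realP] at h1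
  have h3 : (L.realP x - L.shiftP τ 0) * (L.shiftP τ x - L.shiftP τ 0) =
      (L.realP ω - L.shiftP τ 0) * (L.shiftP τ ω - L.shiftP τ 0) := by exact_mod_cast h1
  linarith

lemma shiftP'_mul (h : L.IsRectangular ω τ) {x : ℝ} (hx : (x : ℂ) ∉ L.lattice) :
    L.shiftP' τ x * (L.realP x - L.shiftP τ 0) + (L.shiftP τ x - L.shiftP τ 0) * L.realP' x = 0 := by
  have h1 := ((h.hasDerivAt_shiftP x).sub_const (L.shiftP τ 0)).mul
    ((hasDerivAt_realP hx).sub_const (L.shiftP τ 0))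
  refine h1.unique ((hasDerivAt_const x ((L.shiftP τ ω - L.shiftP τ 0) *
    (L.realP ω - L.shiftP τ 0))).congr_of_eventuallyEq ?_)
  have ho : IsOpen ((fun x : ℝ => (x : ℂ)) ⁻¹' (L.lattice : Set ℂ)ᶜ) :=
    L.isClosed_lattice.isOpen_compl.preimage Complex.continuous_ofReal
  filter_upwards [ho.mem_nhds hx] with y hy
  exact h.shiftP_sub_mul hy

lemma realP_abs_sub (h : L.IsRectangular ω τ) (d : ℝ) (n : ℤ) :
    L.realP |d - 2 * n * ω| = L.realP d := by
  have h1 : L.realP (d - 2 * n * ω) = L.realP d := by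
    have hm : ((-(2 * n * ω) : ℝ) : ℂ) ∈ L.lattice :=
      (h.real_mem_lattice_iff _).mpr ⟨-n, by push_cast; ring⟩
    rw [realP, realP, ← L.weierstrassP_add_of_mem d hm]
    push_cast; ring_nf
  rw [← h1]
  rcases abs_choice (d - 2 * n * ω) with e | e <;> rw [e]
  rw [realP, realP, ofReal_neg, L.weierstrassP_neg]

lemma exists_abs_sub_le (hω : 0 < ω) (d : ℝ) : ∃ n : ℤ, |d - 2 * n * ω| ≤ ω := by
  refine ⟨round (d / (2 * ω)), ?_⟩
  have := abs_sub_round (d / (2 * ω))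
  have e : d - 2 * round (d / (2 * ω)) * ω = (d / (2 * ω) - round (d / (2 * ω))) * (2 * ω) := by
    field_simp
  rw [e, abs_mul, abs_of_pos (by positivity : (0 : ℝ) < 2 * ω)]
  nlinarith

/-- Every real `d` outside the period lattice is congruent, up to sign, to a point of `(0, ω]`. -/
lemma exists_abs_sub_mem_Ioc (h : L.IsRectangular ω τ) {d : ℝ} (hd : (d : ℂ) ∉ L.lattice) :
    ∃ n : ℤ, |d - 2 * n * ω| ∈ Ioc 0 ω := by
  obtain ⟨n, hn⟩ := exists_abs_sub_le h.hω d
  refine ⟨n, abs_pos.mpr fun e => hd ?_, hn⟩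
  exact (h.real_mem_lattice_iff d).mpr ⟨n, by linarith⟩

lemma notMem_of_abs_sub_mem_Ioc (h : L.IsRectangular ω τ) {d : ℝ} {n : ℤ}
    (hn : |d - 2 * n * ω| ∈ Ioc 0 ω) : (d : ℂ) ∉ L.lattice := by
  rw [h.real_mem_lattice_iff]
  rintro ⟨m, rfl⟩
  have e : 2 * (m : ℝ) * ω - 2 * n * ω = 2 * ((m - n : ℤ) : ℝ) * ω := by push_cast; ring
  rw [e, abs_mul, abs_mul, abs_of_pos h.hω, abs_two] at hn
  have h1 : (0 : ℝ) < |((m - n : ℤ) : ℝ)| := by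
    by_contra hc
    have := hn.1
    nlinarith [h.hω]
  have h2 : |((m - n : ℤ) : ℝ)| ≤ 1 / 2 := by
    by_contra hc
    have := hn.2
    nlinarith [h.hω]
  rw [← Int.cast_abs] at h1 h2
  have h3 : 0 < |m - n| := by exact_mod_cast h1
  have h4 : (1 : ℝ) ≤ (|m - n| : ℤ) := by exact_mod_cast h3
  linarith

lemma realP_ω_le (h : L.IsRectangular ω τ) {d : ℝ} (hd : (d : ℂ) ∉ L.lattice) :
    L.realP ω ≤ L.realP d := by
  obtain ⟨n, hn⟩ := h.exists_abs_sub_mem_Ioc hd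
  rw [← h.realP_abs_sub d n]
  exact h.strictAntiOn_realP.antitoneOn hn ⟨h.hω, le_rfl⟩ hn.2

end IsRectangular
end PeriodPair

/-- The data `P = ℘ d`, `P' = ℘' d` of a real translation `d` outside the period lattice, relative
to the profile `p x = ℘ (x + ω')`. -/
structure IsLameShift (e₁ e₂ e₃ : ℝ) (p p' : ℝ → ℝ) (d P P' : ℝ) : Prop where
  le : e₁ ≤ P
  sq : P' ^ 2 = 4 * (P - e₁) * (P - e₂) * (P - e₃)
  val : (p d - e₃) * (P - e₃) = (e₂ - e₃) * (e₁ - e₃)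
  deriv : p' d * (P - e₃) + (p d - e₃) * P' = 0

/-- The function `½ (p' - P') / (p - P)`, which is `ζ (x + d) - ζ x - ζ d` in classical terms. -/
def lameEta (p p' : ℝ → ℝ) (P P' x : ℝ) : ℝ := (p' x - P') / (2 * (p x - P))

/-- A solution of `D'' = c D` with vanishing initial data vanishes. -/
lemma eq_zero_of_hasDerivAt_linear {D D' c : ℝ → ℝ} (hD : ∀ x, HasDerivAt D (D' x) x)
    (hD' : ∀ x, HasDerivAt D' (c x * D x) x) (hc : Continuous c) {x₀ : ℝ} (h0 : D x₀ = 0)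
    (h0' : D' x₀ = 0) (x : ℝ) : D x = 0 := by
  set R := max |x| |x₀| + 1 with hR
  obtain ⟨M, hM⟩ := (isCompact_Icc (a := -R) (b := R)).exists_bound_of_continuousOn hc.continuousOn
  have hx : x ∈ Ioo (-R) R := by grind
  have hx₀ : x₀ ∈ Ioo (-R) R := by grind
  have hM0 : 0 ≤ M := (norm_nonneg _).trans (hM x (Ioo_subset_Icc_self hx))
  -- First-order system for (D, D'); in the sup norm its Lipschitz constant is max 1 M on an
  -- interval containing both points.
  have key := ODE_solution_unique_of_mem_Ioo (v := fun t (z : ℝ × ℝ) => (z.2, c t * z.1))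
    (s := fun _ => univ) (K := (max 1 M).toNNReal) (f := fun t => (D t, D' t))
    (g := fun _ => (0, 0)) (a := -R) (b := R) (t₀ := x₀) (fun t ht => ?_) hx₀
    (fun t _ => ⟨(hD t).prodMk (hD' t), mem_univ _⟩)
    (fun t _ => ⟨(hasDerivAt_const t ((0 : ℝ), (0 : ℝ))).congr_deriv (by ext <;> simp), mem_univ _⟩)
    (by simp [h0, h0'])
  · simpa using congrArg Prod.fst (key hx)
  · refine (LipschitzWith.of_dist_le_mul fun y z => ?_).lipschitzOnWith
    have hK : (0 : ℝ) ≤ max 1 M := by positivity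
    simp only [Prod.dist_eq, Real.dist_eq, Real.coe_toNNReal _ hK]
    have hct := hM t (Ioo_subset_Icc_self ht)
    rw [Real.norm_eq_abs] at hct
    rw [← mul_sub, abs_mul]
    have a1 : |y.1 - z.1| ≤ max |y.1 - z.1| |y.2 - z.2| := le_max_left _ _
    have a2 : |y.2 - z.2| ≤ max |y.1 - z.1| |y.2 - z.2| := le_max_right _ _
    have a3 : 0 ≤ max |y.1 - z.1| |y.2 - z.2| := (abs_nonneg _).trans a1
    refine max_le ?_ ?_
    · nlinarith [le_max_left 1 M]
    · exact mul_le_mul (hct.trans (le_max_right _ _)) a1 (abs_nonneg _) hK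

/-- Square roots `S₁, S₂, S₃` of `e₁ - p`, `e₂ - p`, `p - e₃`, analogous to `dn`, `cn`, `sn`. -/
structure IsLameRoots (ω e₁ e₂ e₃ : ℝ) (p S₁ S₂ S₃ : ℝ → ℝ) (ε : ℝ) : Prop where
  pos : ∀ x, 0 < S₁ x
  sq₁ : ∀ x, S₁ x ^ 2 = e₁ - p x
  sq₂ : ∀ x, S₂ x ^ 2 = e₂ - p x
  sq₃ : ∀ x, S₃ x ^ 2 = p x - e₃
  hasDerivAt₁ : ∀ x, HasDerivAt S₁ (-(S₂ x * S₃ x)) x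
  hasDerivAt₂ : ∀ x, HasDerivAt S₂ (-(S₁ x * S₃ x)) x
  hasDerivAt₃ : ∀ x, HasDerivAt S₃ (S₁ x * S₂ x) x
  sign : ε ^ 2 = 1
  periodic₁ : ∀ x, S₁ (x + 2 * ω) = S₁ x
  periodic₂ : ∀ x, S₂ (x + 2 * ω) = ε * S₂ x
  periodic₃ : ∀ x, S₃ (x + 2 * ω) = ε * S₃ x

/-! ### Addition theorem and smooth square roots -/

namespace IsLameProfile

variable {ω e₁ e₂ e₃ : ℝ} {p p' : ℝ → ℝ}

lemma continuous (hp : IsLameProfile ω e₁ e₂ e₃ p p') : Continuous p :=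
  continuous_iff_continuousAt.mpr fun x => (hp.hasDerivAt x).continuousAt

lemma continuous' (hp : IsLameProfile ω e₁ e₂ e₃ p p') : Continuous p' :=
  continuous_iff_continuousAt.mpr fun x => (hp.hasDerivAt' x).continuousAt

lemma e₃_eq (hp : IsLameProfile ω e₁ e₂ e₃ p p') : e₃ = -e₁ - e₂ := by linarith [hp.sum]

lemma deriv_zero (hp : IsLameProfile ω e₁ e₂ e₃ p p') : p' 0 = 0 := by
  have := hp.sq 0
  rw [hp.zero, sub_self, mul_zero] at this
  exact pow_eq_zero_iff two_ne_zero |>.mp this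

/-- `p'` is a differential-algebraic expression in the profile; the cubic in reduced form. -/
lemma sq_reduced (hp : IsLameProfile ω e₁ e₂ e₃ p p') (x : ℝ) :
    p' x ^ 2 = 4 * p x ^ 3 - 2 * (e₁ ^ 2 + e₂ ^ 2 + e₃ ^ 2) * p x - 4 * (e₁ * e₂ * e₃) := by
  rw [hp.sq, hp.e₃_eq]; ring

lemma sub_ne_zero (hp : IsLameProfile ω e₁ e₂ e₃ p p') {P : ℝ} (hP : e₁ ≤ P) (x : ℝ) :
    p x - P ≠ 0 := by
  have := hp.le_e₂ x
  have := hp.lt₂₁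
  intro h
  linarith

/-- This Riccati equation says that a function Φ with Φ' = ηΦ satisfies Φ'' = (2p + P)Φ. -/
lemma hasDerivAt_eta (hp : IsLameProfile ω e₁ e₂ e₃ p p') {P P' : ℝ} (hP : e₁ ≤ P)
    (hP' : P' ^ 2 = 4 * (P - e₁) * (P - e₂) * (P - e₃)) (x : ℝ) :
    HasDerivAt (lameEta p p' P P') (2 * p x + P - lameEta p p' P P' x ^ 2) x := by
  have hne := hp.sub_ne_zero hP x
  have h := ((hp.hasDerivAt' x).sub_const P').div (((hp.hasDerivAt x).sub_const P).const_mul 2)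
    (mul_ne_zero two_ne_zero hne)
  refine h.congr_deriv ?_
  rw [lameEta]
  field_simp
  have h1 := hp.sq_reduced x
  have h2 : P' ^ 2 = 4 * P ^ 3 - 2 * (e₁ ^ 2 + e₂ ^ 2 + e₃ ^ 2) * P - 4 * (e₁ * e₂ * e₃) := by
    rw [hP', hp.e₃_eq]; ring
  linear_combination h2 - h1

lemma deriv_eq_eta (hp : IsLameProfile ω e₁ e₂ e₃ p p') {P : ℝ} (P' : ℝ) (hP : e₁ ≤ P) (x : ℝ) :
    p' x = P' + 2 * lameEta p p' P P' x * (p x - P) := by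
  have hne := hp.sub_ne_zero hP x
  rw [lameEta]
  field_simp
  ring

/-- The chord equation: `(p, p')`, `(P, P')` and the third intersection point. -/
lemma eta_chord (hp : IsLameProfile ω e₁ e₂ e₃ p p') {P P' : ℝ} (hP : e₁ ≤ P)
    (hP' : P' ^ 2 = 4 * (P - e₁) * (P - e₂) * (P - e₃)) (x : ℝ) :
    2 * P' * lameEta p p' P P' x + 2 * lameEta p p' P P' x ^ 2 * (p x - P) =
      2 * (p x ^ 2 + p x * P + P ^ 2) - (e₁ ^ 2 + e₂ ^ 2 + e₃ ^ 2) := by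
  have hne := hp.sub_ne_zero hP x
  apply mul_left_cancel₀ hne
  have h0 := hp.deriv_eq_eta P' hP x
  have h1 := hp.sq_reduced x
  have h2 : P' ^ 2 = 4 * P ^ 3 - 2 * (e₁ ^ 2 + e₂ ^ 2 + e₃ ^ 2) * P - 4 * (e₁ * e₂ * e₃) := by
    rw [hP', hp.e₃_eq]; ring
  linear_combination (h1 - h2 - (p' x + P' + 2 * lameEta p p' P P' x * (p x - P)) * h0) / 2

/-- The addition theorem. -/
theorem add_eq (hp : IsLameProfile ω e₁ e₂ e₃ p p') {d P P' : ℝ}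
    (hd : IsLameShift e₁ e₂ e₃ p p' d P P') (x : ℝ) :
    p (x + d) = -p x - P + lameEta p p' P P' x ^ 2 := by
  set η := lameEta p p' P P' with hη
  have dη := hp.hasDerivAt_eta hd.le hd.sq
  rw [← hη] at dη
  have chord := hp.eta_chord hd.le hd.sq
  rw [← hη] at chord
  have dp := hp.deriv_eq_eta P' hd.le
  rw [← hη] at dp
  have hcη : Continuous η := continuous_iff_continuousAt.mpr fun x => (dη x).continuousAt
  -- By the Riccati and chord equations, q satisfies the equation q'' = 6q² − σ of p itself.
  set q : ℝ → ℝ := fun x => -p x - P + η x ^ 2 with hq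
  have dq (x : ℝ) : HasDerivAt q (-P' - 2 * η x * (q x - P)) x := by
    have := ((hp.hasDerivAt x).neg.sub_const P).add ((dη x).pow 2)
    refine this.congr_deriv ?_
    simp only [hq, Nat.cast_ofNat, Nat.add_one_sub_one, pow_one]
    linear_combination -dp x
  have dq' (x : ℝ) : HasDerivAt (fun x => -P' - 2 * η x * (q x - P))
      (6 * q x ^ 2 - (e₁ ^ 2 + e₂ ^ 2 + e₃ ^ 2)) x := by
    have := (((dη x).const_mul 2).mul ((dq x).sub_const P)).const_sub (-P')
    refine this.congr_deriv ?_
    simp only [hq]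
    linear_combination chord x
  have hcq : Continuous q := continuous_iff_continuousAt.mpr fun x => (dq x).continuousAt
  have hP3 : P - e₃ ≠ 0 := by
    have := hd.le
    have := hp.lt₂₁
    have := hp.lt₃₂
    intro h
    linarith
  have η0 : η 0 * (2 * (e₃ - P)) = -P' := by
    have := dp 0
    rw [hp.deriv_zero, hp.zero] at this
    linear_combination -this
  have hq0 : p d = q 0 := by
    apply mul_right_cancel₀ hP3
    have hv := hd.val
    simp only [hq, hp.zero]
    have : η 0 ^ 2 * (P - e₃) = (P - e₁) * (P - e₂) := by
      apply mul_right_cancel₀ hP3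
      linear_combination (hd.sq + (η 0 * (2 * (e₃ - P)) - P') * η0) / 4
    rw [add_mul, this]
    linear_combination hv + (P - e₃) * hp.sum
  -- The difference of two solutions of y'' = 6y² − σ solves a linear equation. The data at 0 agree
  -- by the half-period translation formulas recorded in `IsLameShift`.
  have key := eq_zero_of_hasDerivAt_linear (D := fun x => p (x + d) - q x)
    (D' := fun x => p' (x + d) - (-P' - 2 * η x * (q x - P)))
    (c := fun x => 6 * (p (x + d) + q x)) (x₀ := 0)
    (fun x => ((hp.hasDerivAt (x + d)).comp_add_const x d).sub (dq x))
    (fun x => (((hp.hasDerivAt' (x + d)).comp_add_const x d).sub (dq' x)).congr_deriv (by ring))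
    (by have := hp.continuous; fun_prop) (by simp [hq0]) (by
      rw [zero_add, ← hq0]
      apply mul_right_cancel₀ hP3
      have hv := hd.val
      have hd' := hd.deriv
      have : η 0 * (P - e₃) = P' / 2 := by linear_combination -η0 / 2
      rw [zero_mul]
      linear_combination hd' + 2 * (p d - P) * this) x
  exact sub_eq_zero.mp key

/-- Existence of smooth square roots of `e₁ - p`, `e₂ - p` and `p - e₃`. -/
theorem exists_roots (hp : IsLameProfile ω e₁ e₂ e₃ p p') :
    ∃ S₁ S₂ S₃ ε, IsLameRoots ω e₁ e₂ e₃ p S₁ S₂ S₃ ε := by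
  have hlt (x : ℝ) : 0 < e₁ - p x := by linarith [hp.le_e₂ x, hp.lt₂₁]
  have h32 : 0 < e₂ - e₃ := sub_pos.mpr hp.lt₃₂
  set S : ℝ → ℝ := fun x => √(e₁ - p x) with hS
  have Spos (x : ℝ) : 0 < S x := Real.sqrt_pos.mpr (hlt x)
  have Ssq (x : ℝ) : S x ^ 2 = e₁ - p x := Real.sq_sqrt (hlt x).le
  have dS (x : ℝ) : HasDerivAt S (-p' x / (2 * S x)) x :=
    ((hp.hasDerivAt x).const_sub e₁).sqrt (hlt x).ne'
  have cS : Continuous S := continuous_iff_continuousAt.mpr fun x => (dS x).continuousAt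
  -- θ plays the role of the Jacobi amplitude: p − e₃ = (e₂ − e₃) sin² θ. Its sine and cosine give
  -- roots that change sign smoothly at their zeros.
  set θ : ℝ → ℝ := fun x => ∫ t in (0 : ℝ)..x, S t with hθ
  have dθ (x : ℝ) : HasDerivAt θ (S x) x := cS.integral_hasStrictDerivAt 0 x |>.hasDerivAt
  have θ0 : θ 0 = 0 := by simp [hθ]
  set A : ℝ → ℝ := fun x => (e₂ + e₃ - 2 * p x) / (e₂ - e₃) with hA
  set B : ℝ → ℝ := fun x => p' x / (S x * (e₂ - e₃)) with hB
  have dA (x : ℝ) : HasDerivAt A (-2 * S x * B x) x := by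
    have := (((hp.hasDerivAt x).const_mul 2).const_sub (e₂ + e₃)).div_const (e₂ - e₃)
    refine this.congr_deriv ?_
    have := (Spos x).ne'
    simp only [hB]
    field_simp
  have dB (x : ℝ) : HasDerivAt B (2 * S x * A x) x := by
    have hs := (Spos x).ne'
    have := (hp.hasDerivAt' x).div ((dS x).mul_const (e₂ - e₃)) (mul_ne_zero hs h32.ne')
    refine this.congr_deriv ?_
    simp only [hA]
    have h1 := Ssq x
    have h2 := hp.sq x
    have h3 := hp.e₃_eq
    field_simp
    rw [h2, show S x ^ 4 = (S x ^ 2) ^ 2 by ring, h1, h3]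
    ring
  have dc (x : ℝ) := ((dθ x).const_mul 2).cos
  have ds (x : ℝ) := ((dθ x).const_mul 2).sin
  have A0 : A 0 = 1 := by simp only [hA, hp.zero]; field_simp; ring
  have B0 : B 0 = 0 := by simp [hB, hp.deriv_zero]
  -- The vector (A, B) rotates with angular velocity 2S = (2θ)'. Turned back by the angle 2θ it is
  -- constant.
  have E1 (x : ℝ) : A x * Real.cos (2 * θ x) + B x * Real.sin (2 * θ x) = 1 := by
    have hd (x : ℝ) : HasDerivAt
        (fun x => A x * Real.cos (2 * θ x) + B x * Real.sin (2 * θ x)) 0 x :=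
      (((dA x).mul (dc x)).add ((dB x).mul (ds x))).congr_deriv (by ring)
    have := is_const_of_deriv_eq_zero (fun x => (hd x).differentiableAt) (fun x => (hd x).deriv) x 0
    rw [this, θ0, A0, B0]; simp
  have E2 (x : ℝ) : A x * Real.sin (2 * θ x) - B x * Real.cos (2 * θ x) = 0 := by
    have hd (x : ℝ) : HasDerivAt
        (fun x => A x * Real.sin (2 * θ x) - B x * Real.cos (2 * θ x)) 0 x :=
      (((dA x).mul (ds x)).sub ((dB x).mul (dc x))).congr_deriv (by ring)
    have := is_const_of_deriv_eq_zero (fun x => (hd x).differentiableAt) (fun x => (hd x).deriv) x 0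
    rw [this, θ0, A0, B0]; simp
  have hAc (x : ℝ) : A x = Real.cos (2 * θ x) := by
    linear_combination Real.cos (2 * θ x) * E1 x + Real.sin (2 * θ x) * E2 x
      - A x * Real.sin_sq_add_cos_sq (2 * θ x)
  have hBs (x : ℝ) : B x = Real.sin (2 * θ x) := by
    linear_combination Real.sin (2 * θ x) * E1 x - Real.cos (2 * θ x) * E2 x
      - B x * Real.sin_sq_add_cos_sq (2 * θ x)
  set r := √(e₂ - e₃) with hr
  have rsq : r ^ 2 = e₂ - e₃ := Real.sq_sqrt h32.le
  have Sper (x : ℝ) : S (x + 2 * ω) = S x := by simp only [hS, hp.periodic]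
  have θper (x : ℝ) : θ (x + 2 * ω) = θ x + θ (2 * ω) := by
    have hd (x : ℝ) : HasDerivAt (fun x => θ (x + 2 * ω) - θ x) 0 x := by
      have := ((dθ (x + 2 * ω)).comp_add_const x _).sub (dθ x)
      rwa [Sper, sub_self] at this
    have := is_const_of_deriv_eq_zero (fun x => (hd x).differentiableAt) (fun x => (hd x).deriv) x 0
    simp only [zero_add, θ0] at this
    linarith
  have hAp (x : ℝ) : 2 * p x = e₂ + e₃ - A x * (e₂ - e₃) := by
    simp only [hA]; field_simp; ring
  -- Periodicity of p controls the doubled angle only, so the multiplier cos θ(2ω) of the roots is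
  -- known only to be ±1.
  have hcT : Real.cos (2 * θ (2 * ω)) = 1 := by
    rw [← hAc, ← A0]
    simp only [hA]
    rw [← hp.periodic 0, zero_add]
  have hsT : Real.sin (θ (2 * ω)) = 0 := by
    rw [Real.cos_two_mul] at hcT
    have := Real.sin_sq_add_cos_sq (θ (2 * ω))
    exact pow_eq_zero_iff two_ne_zero |>.mp (by linarith)
  refine ⟨S, fun x => r * Real.cos (θ x), fun x => r * Real.sin (θ x), Real.cos (θ (2 * ω)),
    Spos, Ssq, fun x => ?_, fun x => ?_, fun x => ?_, fun x => ?_, fun x => ?_, ?_, Sper,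
    fun x => ?_, fun x => ?_⟩
  · have := hAp x
    rw [hAc, Real.cos_two_mul] at this
    rw [mul_pow, rsq]
    linarith
  · have := hAp x
    rw [hAc, Real.cos_two_mul] at this
    rw [mul_pow, rsq, Real.sin_sq]
    linarith
  · refine (dS x).congr_deriv ?_
    have h1 := hBs x
    rw [Real.sin_two_mul] at h1
    have h2 : p' x = B x * (S x * (e₂ - e₃)) := by
      have := (Spos x).ne'
      simp only [hB]; field_simp
    rw [h2, h1, ← rsq]
    have := (Spos x).ne'
    field_simp
  · exact ((dθ x).cos.const_mul r).congr_deriv (by ring)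
  · exact ((dθ x).sin.const_mul r).congr_deriv (by ring)
  · linarith [Real.cos_sq' (θ (2 * ω)), Real.sin_sq_add_cos_sq (θ (2 * ω)), hsT ▸ zero_pow two_ne_zero (M₀ := ℝ)]
  · rw [θper, Real.cos_add, hsT]; ring
  · rw [θper, Real.sin_add, hsT]; ring

end IsLameProfile

/-! ### Necessary conditions on the factorization constants -/

lemma eq_zero_of_infinite_cubic {S : Set ℂ} (hS : S.Infinite) {c₀ c₁ c₂ c₃ : ℂ}
    (h : ∀ z ∈ S, c₃ * z ^ 3 + c₂ * z ^ 2 + c₁ * z + c₀ = 0) :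
    c₀ = 0 ∧ c₁ = 0 ∧ c₂ = 0 ∧ c₃ = 0 := by
  set f : Polynomial ℂ := .C c₃ * .X ^ 3 + .C c₂ * .X ^ 2 + .C c₁ * .X + .C c₀ with hf
  have h0 : f = 0 := by
    refine Polynomial.eq_zero_of_infinite_isRoot f (hS.mono fun z hz => ?_)
    simpa [hf] using h z hz
  refine ⟨?_, ?_, ?_, ?_⟩
  · simpa [hf, Polynomial.coeff_X, Polynomial.coeff_C, Polynomial.coeff_X_pow] using
      congrArg (Polynomial.coeff · 0) h0
  · simpa [hf, Polynomial.coeff_X, Polynomial.coeff_C, Polynomial.coeff_X_pow] using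
      congrArg (Polynomial.coeff · 1) h0
  · simpa [hf, Polynomial.coeff_X, Polynomial.coeff_C, Polynomial.coeff_X_pow] using
      congrArg (Polynomial.coeff · 2) h0
  · simpa [hf, Polynomial.coeff_X, Polynomial.coeff_C, Polynomial.coeff_X_pow] using
      congrArg (Polynomial.coeff · 3) h0

namespace IsBlochFunction

variable {V : ℝ → ℂ} {T : ℝ} {a β : ℂ} {u : ℝ → ℂ}

lemma hasDerivAt (h : IsBlochFunction V T a β u) (x : ℝ) : HasDerivAt u (deriv u x) x :=
  (h.1.differentiable (by norm_num) x).hasDerivAt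

lemma hasDerivAt_deriv (h : IsBlochFunction V T a β u) (x : ℝ) :
    HasDerivAt (deriv u) ((V x - a) * u x) x := by
  have h1 : Differentiable ℝ (deriv u) :=
    ((contDiff_succ_iff_deriv (n := 1)).mp h.1).2.2.differentiable one_ne_zero
  refine (h1 x).hasDerivAt.congr_deriv ?_
  have := h.2.2.1 x
  rw [iteratedDeriv_succ, iteratedDeriv_one] at this
  linear_combination -this

lemma of_hasDerivAt {u' : ℝ → ℂ} (hV : Continuous V) (h1 : ∀ x, HasDerivAt u (u' x) x)
    (h2 : ∀ x, HasDerivAt u' ((V x - a) * u x) x) (h0 : ∃ x, u x ≠ 0)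
    (hT : ∀ x, u (x + T) = β * u x) : IsBlochFunction V T a β u := by
  have e1 : deriv u = u' := funext fun x => (h1 x).deriv
  have e2 : deriv u' = fun x => (V x - a) * u x := funext fun x => (h2 x).deriv
  have hu : Continuous u := continuous_iff_continuousAt.mpr fun x => (h1 x).continuousAt
  refine ⟨?_, h0, fun x => ?_, hT⟩
  · rw [show (2 : WithTop ℕ∞) = 1 + 1 by norm_num, contDiff_succ_iff_deriv]
    refine ⟨fun x => (h1 x).differentiableAt, by simp, ?_⟩
    rw [e1, contDiff_one_iff_deriv, e2]
    exact ⟨fun x => (h2 x).differentiableAt, by fun_prop⟩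
  · rw [iteratedDeriv_succ, iteratedDeriv_one, e1, e2]
    ring

end IsBlochFunction

/-- The third-order equation satisfied by `W`, expressed through its logarithmic derivative. -/
lemma logDeriv_identity {W g g₁ g₂ V Y₁ Y₂ : ℝ → ℂ} {s D : ℂ}
    (hW : ∀ x, HasDerivAt W (g x) x) (hg : ∀ x, HasDerivAt g (g₁ x) x)
    (hg₁ : ∀ x, HasDerivAt g₁ (g₂ x) x) (W0 : ∀ x, W x ≠ 0)
    (hrel : ∀ x, 2 * g x * g₂ x = 2 * (2 * V x - s) * g x ^ 2 + g₁ x ^ 2 - D * W x ^ 2)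
    (hY₁ : ∀ x, deriv (logDeriv W) x = Y₁ x) (hY₂ : ∀ x, HasDerivAt Y₁ (Y₂ x) x) :
    (∀ x, HasDerivAt (logDeriv W) (Y₁ x) x) ∧ (∀ x, g x = logDeriv W x * W x) ∧
    ∀ x, 2 * logDeriv W x * (Y₂ x + 3 * logDeriv W x * Y₁ x + logDeriv W x ^ 3) =
      2 * (2 * V x - s) * logDeriv W x ^ 2 + (Y₁ x + logDeriv W x ^ 2) ^ 2 - D := by
  have hy : logDeriv W = fun x => g x / W x := funext fun x => by
    rw [logDeriv_apply, (hW x).deriv]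
  have dy (x : ℝ) : HasDerivAt (logDeriv W) (Y₁ x) x := by
    have h1 : DifferentiableAt ℝ (logDeriv W) x := by
      rw [hy]; exact ((hg x).div (hW x) (W0 x)).differentiableAt
    rw [← hY₁]; exact h1.hasDerivAt
  set y := logDeriv W
  have eg (x : ℝ) : g x = y x * W x := by
    have := W0 x
    rw [hy]; field_simp
  have eg₁ (x : ℝ) : g₁ x = (Y₁ x + y x ^ 2) * W x := by
    have h1 := ((dy x).mul (hW x)).congr_of_eventuallyEq (f₁ := g) (.of_forall eg)
    rw [(hg x).unique h1, eg]; ring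
  have eg₂ (x : ℝ) : g₂ x = (Y₂ x + 3 * y x * Y₁ x + y x ^ 3) * W x := by
    have h1 := (((hY₂ x).add ((dy x).pow 2)).mul (hW x)).congr_of_eventuallyEq (f₁ := g₁)
      (.of_forall eg₁)
    rw [(hg₁ x).unique h1, eg]
    simp only [Pi.add_apply, Pi.pow_apply, Nat.cast_ofNat, Nat.add_one_sub_one, pow_one]
    ring
  refine ⟨dy, eg, fun x => ?_⟩
  apply mul_right_cancel₀ (pow_ne_zero 2 (W0 x))
  have := hrel x
  rw [eg, eg₁, eg₂] at this
  linear_combination this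

namespace IsLameProfile

variable {ω e₁ e₂ e₃ : ℝ} {p p' : ℝ → ℝ}

/-- If η were constant, the Riccati equation would make p constant, against p(0) = e₃ < e₂ = p(ω).
So the range contains an interval. -/
lemma infinite_range_eta (hp : IsLameProfile ω e₁ e₂ e₃ p p') {P P' : ℝ} (hP : e₁ ≤ P)
    (hP' : P' ^ 2 = 4 * (P - e₁) * (P - e₂) * (P - e₃)) :
    (range (lameEta p p' P P')).Infinite := by
  have dη := hp.hasDerivAt_eta hP hP'
  set η := lameEta p p' P P'
  have hc : Continuous η := continuous_iff_continuousAt.mpr fun x => (dη x).continuousAt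
  obtain ⟨a, b, hab⟩ : ∃ a b, η a < η b := by
    by_contra hcon
    push Not at hcon
    have hconst (x : ℝ) : η x = η 0 := le_antisymm (hcon 0 x) (hcon x 0)
    have hz (x : ℝ) : 2 * p x + P - η 0 ^ 2 = 0 := by
      rw [← hconst x]
      exact (dη x).unique ((hasDerivAt_const x (η 0)).congr_of_eventuallyEq (.of_forall hconst))
    have h0 := hz 0
    have h1 := hz ω
    rw [hp.zero] at h0
    rw [hp.half] at h1
    linarith [hp.lt₃₂]
  refine (Icc_infinite hab).mono ?_
  have := isPreconnected_univ.intermediate_value (mem_univ a) (mem_univ b) hc.continuousOn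
  rwa [image_univ] at this

/-- A Darboux displacement by `d` outside the period lattice forces the sum `s` of the
factorization constants and the square `D` of their difference. -/
theorem darboux_shift (hp : IsLameProfile ω e₁ e₂ e₃ p p') {d P P' : ℝ}
    (hd : IsLameShift e₁ e₂ e₃ p p' d P P') {W g g₁ g₂ V : ℝ → ℂ} {s D : ℂ}
    (hV : ∀ x, V x = 6 * (p x : ℂ))
    (hW : ∀ x, HasDerivAt W (g x) x) (hg : ∀ x, HasDerivAt g (g₁ x) x)
    (hg₁ : ∀ x, HasDerivAt g₁ (g₂ x) x) (W0 : ∀ x, W x ≠ 0)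
    (hrel : ∀ x, 2 * g x * g₂ x = 2 * (2 * V x - s) * g x ^ 2 + g₁ x ^ 2 - D * W x ^ 2)
    (hdar : ∀ x, darbouxPotential V W x = V (x + d)) :
    s = -3 * P ∧ D = 9 * (2 * (e₁ ^ 2 + e₂ ^ 2 + e₃ ^ 2) - 3 * P ^ 2) := by
  have dη := hp.hasDerivAt_eta hd.le hd.sq
  have hinf := hp.infinite_range_eta hd.le hd.sq
  have hadd := hp.add_eq hd
  have chord := hp.eta_chord hd.le hd.sq
  have dp := hp.deriv_eq_eta P' hd.le
  set η := lameEta p p' P P'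
  obtain ⟨dy, -, hid⟩ := logDeriv_identity (V := V) (s := s) (D := D)
    (Y₁ := fun x => ((3 * (2 * p x + P - η x ^ 2) : ℝ) : ℂ))
    (Y₂ := fun x => ((3 * (2 * p' x - 2 * η x * (2 * p x + P - η x ^ 2)) : ℝ) : ℂ))
    hW hg hg₁ W0 hrel (fun x => by
      have := hdar x
      rw [darbouxPotential, hV, hV, hadd] at this
      push_cast at this ⊢
      linear_combination -this / 2) (fun x => by
      refine HasDerivAt.ofReal_comp ?_
      refine (((((hp.hasDerivAt x).const_mul 2).add_const P).sub
        ((dη x).pow 2)).const_mul 3).congr_deriv ?_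
      simp)
  set y := logDeriv W
  -- By the addition theorem, y' = 3(p(x) − p(x + d)) = 3η'.
  obtain ⟨k, hk⟩ : ∃ k : ℂ, ∀ x, y x = k + 3 * η x := by
    refine ⟨y 0 - 3 * η 0, fun x => ?_⟩
    have hd (x : ℝ) : HasDerivAt (fun x => y x - 3 * (η x : ℂ)) 0 x := by
      refine ((dy x).sub (((dη x).ofReal_comp).const_mul 3)).congr_deriv ?_
      push_cast; ring
    have := is_const_of_deriv_eq_zero (fun x => (hd x).differentiableAt) (fun x => (hd x).deriv) x 0
    linear_combination this
  -- The chord equation and the formula for p' in terms of η remove every occurrence of p and p';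
  -- what remains is a cubic in η with coefficients independent of x. Its leading coefficient gives
  -- k = 0.
  have hpoly : ∀ z ∈ ofReal '' range η, (48 * k) * z ^ 3 + (54 * P + 18 * s + 42 * k ^ 2) * z ^ 2 +
      (36 * P * k + 12 * k ^ 3 + 12 * s * k) * z +
      (12 * k * P' + 12 * k ^ 2 * P + k ^ 4 + 27 * P ^ 2 + 2 * s * k ^ 2 + D
        - 18 * (e₁ ^ 2 + e₂ ^ 2 + e₃ ^ 2)) = 0 := by
    rintro _ ⟨_, ⟨x, rfl⟩, rfl⟩
    have h1 := hid x
    have h2 : (2 * P' * η x + 2 * η x ^ 2 * (p x - P) : ℂ) =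
      2 * (p x ^ 2 + p x * P + P ^ 2) - (e₁ ^ 2 + e₂ ^ 2 + e₃ ^ 2) := by exact_mod_cast chord x
    have h3 : (p' x : ℂ) = P' + 2 * η x * (p x - P) := by exact_mod_cast dp x
    rw [hk, hV] at h1
    push_cast at h1
    rw [h3] at h1
    linear_combination h1 - 18 * h2
  obtain ⟨c0, -, c2, c3⟩ := eq_zero_of_infinite_cubic (hinf.image ofReal_injective.injOn) hpoly
  have hk0 : k = 0 := by simpa using c3
  subst hk0
  exact ⟨by linear_combination c2 / 18, by linear_combination c0⟩

/-- Displacement by a period would force a trivial transformation. -/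
theorem darboux_period (hp : IsLameProfile ω e₁ e₂ e₃ p p') {d : ℝ}
    (hd : ∀ x, p (x + d) = p x) {W g g₁ g₂ V : ℝ → ℂ} {s D : ℂ}
    (hV : ∀ x, V x = 6 * (p x : ℂ))
    (hW : ∀ x, HasDerivAt W (g x) x) (hg : ∀ x, HasDerivAt g (g₁ x) x)
    (hg₁ : ∀ x, HasDerivAt g₁ (g₂ x) x) (W0 : ∀ x, W x ≠ 0)
    (hrel : ∀ x, 2 * g x * g₂ x = 2 * (2 * V x - s) * g x ^ 2 + g₁ x ^ 2 - D * W x ^ 2)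
    (hdar : ∀ x, darbouxPotential V W x = V (x + d)) :
    D = 0 ∧ ∀ x, g x = 0 := by
  obtain ⟨dy, eg, hid⟩ := logDeriv_identity (V := V) (s := s) (D := D)
    (Y₁ := fun _ => 0) (Y₂ := fun _ => 0) hW hg hg₁ W0 hrel (fun x => by
      have := hdar x
      rw [darbouxPotential, hV, hV, hd] at this
      linear_combination -this / 2) (fun x => hasDerivAt_const x 0)
  have hc (x : ℝ) := is_const_of_deriv_eq_zero (fun x => (dy x).differentiableAt)
    (fun x => (dy x).deriv) x 0
  have h0 := hid 0
  have h1 := hid ω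
  rw [hc ω] at h1
  rw [hV, hp.zero] at h0
  rw [hV, hp.half] at h1
  have hne : (e₂ : ℂ) - e₃ ≠ 0 := _root_.sub_ne_zero.mpr (by exact_mod_cast hp.lt₃₂.ne')
  -- The logarithmic derivative is constant, so the identities at 0 and ω differ only in the term
  -- containing V.
  have hy0 : logDeriv W 0 = 0 := by
    have : ((e₂ : ℂ) - e₃) * logDeriv W 0 ^ 2 = 0 := by linear_combination (h0 - h1) / 24
    exact pow_eq_zero_iff two_ne_zero |>.mp ((mul_eq_zero.mp this).resolve_left hne)
  rw [hy0] at h0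
  exact ⟨by linear_combination h0, fun x => by rw [eg, hc, hy0, zero_mul]⟩

end IsLameProfile

section Apply

variable {V : ℝ → ℂ} {T : ℝ} {a₁ a₂ β₁ β₂ : ℂ} {u₁ u₂ : ℝ → ℂ}

lemma IsBlochFunction.hasDerivAt_wronskian (h₁ : IsBlochFunction V T a₁ β₁ u₁)
    (h₂ : IsBlochFunction V T a₂ β₂ u₂) (x : ℝ) :
    HasDerivAt (wronskian u₁ u₂) ((a₁ - a₂) * (u₁ x * u₂ x)) x :=
  (((h₁.hasDerivAt x).mul (h₂.hasDerivAt_deriv x)).sub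
    ((h₁.hasDerivAt_deriv x).mul (h₂.hasDerivAt x))).congr_deriv (by ring)

variable {ω e₁ e₂ e₃ : ℝ} {p p' : ℝ → ℝ}

/-- The relation required by `darboux_shift` follows from uᵢ'' = (V − aᵢ)uᵢ and ((u₁u₂)')² − W² =
4u₁u₂u₁'u₂'. -/
theorem IsDarbouxDisplacement.sum_and_diff (hp : IsLameProfile ω e₁ e₂ e₃ p p')
    (hV : ∀ x, V x = 6 * (p x : ℂ)) {d P P' : ℝ} (hd : IsLameShift e₁ e₂ e₃ p p' d P P')
    (h : IsDarbouxDisplacement V T a₁ a₂ d) :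
    a₁ + a₂ = -3 * P ∧ (a₁ - a₂) ^ 2 = 9 * (2 * (e₁ ^ 2 + e₂ ^ 2 + e₃ ^ 2) - 3 * P ^ 2) := by
  obtain ⟨-, β₁, β₂, u₁, u₂, h₁, h₂, W0, hdar⟩ := h
  refine hp.darboux_shift hd hV (h₁.hasDerivAt_wronskian h₂)
    (fun x => ((h₁.hasDerivAt x).mul (h₂.hasDerivAt x)).const_mul (a₁ - a₂))
    (fun x => ((((h₁.hasDerivAt_deriv x).mul (h₂.hasDerivAt x)).add
      ((h₁.hasDerivAt x).mul (h₂.hasDerivAt_deriv x))).const_mul (a₁ - a₂))) W0 (fun x => ?_) hdar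
  rw [wronskian]; ring

theorem IsDarbouxDisplacement.not_period (hp : IsLameProfile ω e₁ e₂ e₃ p p')
    (hV : ∀ x, V x = 6 * (p x : ℂ)) {d : ℝ} (hd : ∀ x, p (x + d) = p x) :
    ¬ IsDarbouxDisplacement V T a₁ a₂ d := by
  rintro ⟨hne, β₁, β₂, u₁, u₂, h₁, h₂, W0, hdar⟩
  have := (hp.darboux_period (s := a₁ + a₂) (D := (a₁ - a₂) ^ 2) hd hV (h₁.hasDerivAt_wronskian h₂)
    (fun x => ((h₁.hasDerivAt x).mul (h₂.hasDerivAt x)).const_mul (a₁ - a₂))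
    (fun x => ((((h₁.hasDerivAt_deriv x).mul (h₂.hasDerivAt x)).add
      ((h₁.hasDerivAt x).mul (h₂.hasDerivAt_deriv x))).const_mul (a₁ - a₂))) W0 (fun x => by
        rw [wronskian]; ring) hdar).1
  exact hne (sub_eq_zero.mp (pow_eq_zero_iff two_ne_zero |>.mp this))

/-- A function w with w' = u² satisfies the same relation with s = 2a and D = 0; w itself drops out
of it. -/
theorem IsConfluentDarbouxDisplacement.sum_and_diff (hp : IsLameProfile ω e₁ e₂ e₃ p p')
    (hV : ∀ x, V x = 6 * (p x : ℂ)) {d P P' : ℝ} (hd : IsLameShift e₁ e₂ e₃ p p' d P P')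
    (h : IsConfluentDarbouxDisplacement V T a₁ d) :
    2 * a₁ = -3 * P ∧ (0 : ℂ) = 9 * (2 * (e₁ ^ 2 + e₂ ^ 2 + e₃ ^ 2) - 3 * P ^ 2) := by
  obtain ⟨β, u, w, h₁, hw, w0, hdar⟩ := h
  refine hp.darboux_shift hd hV hw (fun x => (h₁.hasDerivAt x).pow 2)
    (fun x => (((h₁.hasDerivAt x).pow 1).const_mul 2 |>.mul (h₁.hasDerivAt_deriv x))) w0
    (fun x => ?_) hdar
  simp
  ring

theorem IsConfluentDarbouxDisplacement.not_period (hp : IsLameProfile ω e₁ e₂ e₃ p p')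
    (hV : ∀ x, V x = 6 * (p x : ℂ)) {d : ℝ} (hd : ∀ x, p (x + d) = p x) :
    ¬ IsConfluentDarbouxDisplacement V T a₁ d := by
  rintro ⟨β, u, w, h₁, hw, w0, hdar⟩
  have := (hp.darboux_period (s := 2 * a₁) (D := 0) hd hV hw (fun x => (h₁.hasDerivAt x).pow 2)
    (fun x => (((h₁.hasDerivAt x).pow 1).const_mul 2 |>.mul (h₁.hasDerivAt_deriv x))) w0
    (fun x => by simp; ring) hdar).2
  obtain ⟨x, hx⟩ := h₁.2.1
  exact hx (pow_eq_zero_iff two_ne_zero |>.mp (this x))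

end Apply

/-! ### Construction of the transformation functions -/

lemma exists_primitive_of_periodic {E : Type*} [NormedAddCommGroup E] [NormedSpace ℝ E]
    [CompleteSpace E] {f : ℝ → E} (hf : Continuous f) {T : ℝ} (hT : ∀ x, f (x + T) = f x) :
    ∃ (F : ℝ → E) (c : E), F 0 = 0 ∧ (∀ x, HasDerivAt F (f x) x) ∧ ∀ x, F (x + T) = F x + c := by
  have dF (x : ℝ) : HasDerivAt (fun x => ∫ t in (0 : ℝ)..x, f t) (f x) x :=
    (hf.integral_hasStrictDerivAt 0 x).hasDerivAt
  set F : ℝ → E := fun x => ∫ t in (0 : ℝ)..x, f t with hF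
  have F0 : F 0 = 0 := by simp [hF]
  refine ⟨F, F T, F0, dF, fun x => ?_⟩
  have hd (x : ℝ) : HasDerivAt (fun x => F (x + T) - F x) 0 x := by
    have := ((dF (x + T)).comp_add_const x T).sub (dF x)
    rwa [hT, sub_self] at this
  have := is_const_of_deriv_eq_zero (fun x => (hd x).differentiableAt) (fun x => (hd x).deriv) x 0
  simp only [zero_add, F0, sub_zero] at this
  rw [← this]; abel

namespace IsLameProfile

variable {ω e₁ e₂ e₃ : ℝ} {p p' : ℝ → ℝ}

/-- On an open set where p = m, both p' and p'' vanish, which would make m a double root of a cubic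
with distinct roots. -/
lemma dense_ne (hp : IsLameProfile ω e₁ e₂ e₃ p p') (m : ℝ) : Dense {x | p x ≠ m} := by
  intro x
  rw [mem_closure_iff_frequently]
  intro hcon
  simp only [mem_ofPred_eq, not_not] at hcon
  have h1 : ∀ᶠ y in 𝓝 x, p' y = 0 := by
    filter_upwards [hcon.eventually_nhds] with y hy
    exact (hp.hasDerivAt y).unique ((hasDerivAt_const y m).congr_of_eventuallyEq hy)
  have h2 := (hp.hasDerivAt' x).unique ((hasDerivAt_const x 0).congr_of_eventuallyEq h1)
  have h3 := hp.sq x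
  rw [h1.self_of_nhds] at h3
  have h4 : (p x - e₁) * (p x - e₂) * (p x - e₃) = 0 := by linarith
  have i1 : e₁ - e₂ ≠ 0 := by linarith [hp.lt₂₁]
  have i2 : e₂ - e₃ ≠ 0 := by linarith [hp.lt₃₂]
  have i3 : e₁ - e₃ ≠ 0 := by linarith [hp.lt₃₂, hp.lt₂₁]
  have hs := hp.e₃_eq
  rcases mul_eq_zero.mp h4 with h4 | h4
  · rcases mul_eq_zero.mp h4 with h4 | h4
    · refine mul_ne_zero i1 i3 ?_
      rw [sub_eq_zero.mp h4, hs] at h2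
      rw [hs]; linear_combination h2 / 2
    · refine mul_ne_zero i1 i2 ?_
      rw [sub_eq_zero.mp h4, hs] at h2
      rw [hs]; linear_combination -h2 / 2
  · refine mul_ne_zero i3 i2 ?_
    rw [sub_eq_zero.mp h4, hs] at h2
    rw [hs]; linear_combination h2 / 2

/-- The first-order equations below degenerate where p = m; this lets the factor p − m be cancelled
across such points. -/
lemma eq_of_forall_mul_sub (hp : IsLameProfile ω e₁ e₂ e₃ p p') {m : ℝ} {f g : ℝ → ℝ}
    (hf : Continuous f) (hg : Continuous g) (h : ∀ x, (p x - m) * f x = (p x - m) * g x) (x : ℝ) :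
    f x = g x := by
  refine congrFun (hf.ext_on (hp.dense_ne m) hg fun y hy => ?_) x
  exact mul_left_cancel₀ (_root_.sub_ne_zero.mpr hy) (h y)

/-- Bloch solutions of the equation `φ'' = (2 p + m) φ` in its finite forbidden band. -/
theorem exists_lame_one (hp : IsLameProfile ω e₁ e₂ e₃ p p') {m c : ℝ} (hm₃ : e₃ ≤ m)
    (hm₂ : m ≤ e₂) (hc : c ^ 2 = 4 * (m - e₁) * (m - e₂) * (m - e₃)) :
    ∃ (φ φ' : ℝ → ℝ) (μ : ℝ), (∀ x, HasDerivAt φ (φ' x) x) ∧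
      (∀ x, HasDerivAt φ' ((2 * p x + m) * φ x) x) ∧
      (∀ x, (p x - m) * φ' x = (p' x + c) / 2 * φ x) ∧
      (∀ x, p x ≠ m → φ x ≠ 0) ∧ ∀ x, φ (x + 2 * ω) = μ * φ x := by
  obtain ⟨S₁, S₂, S₃, ε, hS⟩ := hp.exists_roots
  have h21 := hp.lt₂₁
  have h32 := hp.lt₃₂
  -- The desired φ has logarithmic derivative (p' + c) / (2(p − m)), singular where p = m. These α,
  -- β make αS₃ + βS₁S₂ absorb the singularity; the sign in c = −2αβ makes it vanish where p' = c
  -- rather than where p' = −c.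
  obtain ⟨α, β, hα, hβ, hαβ⟩ : ∃ α β : ℝ, α ^ 2 = (e₁ - m) * (e₂ - m) ∧ β ^ 2 = m - e₃ ∧
      c = -2 * (α * β) := by
    have a0 : 0 ≤ (e₁ - m) * (e₂ - m) := mul_nonneg (by linarith) (by linarith)
    have b0 : 0 ≤ m - e₃ := by linarith
    have hsq : c ^ 2 = (2 * (√((e₁ - m) * (e₂ - m)) * √(m - e₃))) ^ 2 := by
      rw [mul_pow, mul_pow, Real.sq_sqrt a0, Real.sq_sqrt b0, hc]; ring
    rcases sq_eq_sq_iff_eq_or_eq_neg.mp hsq with h | h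
    · exact ⟨-√((e₁ - m) * (e₂ - m)), √(m - e₃), by rw [neg_sq, Real.sq_sqrt a0],
        Real.sq_sqrt b0, by linarith⟩
    · exact ⟨√((e₁ - m) * (e₂ - m)), √(m - e₃), Real.sq_sqrt a0, Real.sq_sqrt b0, by linarith⟩
  have hp' (x : ℝ) : p' x = 2 * (S₁ x * S₂ x * S₃ x) := by
    have h1 := ((hS.hasDerivAt₃ x).pow 2).congr_of_eventuallyEq (f₁ := fun x => p x - e₃)
      (.of_forall fun x => (hS.sq₃ x).symm)
    rw [((hp.hasDerivAt x).sub_const e₃).unique h1]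
    simp; ring
  set X : ℝ → ℝ := fun x => α * S₃ x + β * (S₁ x * S₂ x) with hX
  set X' : ℝ → ℝ := fun x => α * (S₁ x * S₂ x) - β * (S₃ x * (e₁ + e₂ - 2 * p x)) with hX'
  set X'' : ℝ → ℝ := fun x => -α * (S₃ x * (e₁ + e₂ - 2 * p x)) -
    β * (S₁ x * S₂ x * (e₁ + e₂ - 2 * p x) - 2 * S₃ x * p' x) with hX''
  have dX (x : ℝ) : HasDerivAt X (X' x) x := by
    refine (((hS.hasDerivAt₃ x).const_mul α).add
      (((hS.hasDerivAt₁ x).mul (hS.hasDerivAt₂ x)).const_mul β)).congr_deriv ?_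
    simp only [hX']
    linear_combination -β * S₃ x * (hS.sq₁ x + hS.sq₂ x)
  have dX' (x : ℝ) : HasDerivAt X' (X'' x) x := by
    refine ((((hS.hasDerivAt₁ x).mul (hS.hasDerivAt₂ x)).const_mul α).sub
      (((hS.hasDerivAt₃ x).mul
        (((hp.hasDerivAt x).const_mul 2).const_sub (e₁ + e₂))).const_mul β)).congr_deriv ?_
    simp only [hX'']
    linear_combination -α * S₃ x * (hS.sq₁ x + hS.sq₂ x)
  -- Multiplying X by αS₃ − βS₁S₂ gives (p − m)N. Since e₃ ≤ m ≤ e₂, N is positive and may be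
  -- divided by.
  set N : ℝ → ℝ := fun x => (e₁ - e₃) * (e₂ - e₃) - (m - e₃) * (p x - e₃) with hN
  have Npos (x : ℝ) : 0 < N x := by
    have h1 := hp.le_e₂ x
    have h2 := hp.e₃_le x
    simp only [hN]
    nlinarith [mul_nonneg (sub_nonneg.mpr hm₃) (sub_nonneg.mpr h1),
      mul_nonneg (sub_nonneg.mpr hm₂) (sub_pos.mpr h32).le, mul_pos (sub_pos.mpr h21) (sub_pos.mpr h32)]
  have dN (x : ℝ) : HasDerivAt N (-((m - e₃) * p' x)) x :=
    (((hp.hasDerivAt x).sub_const e₃).const_mul (m - e₃)).const_sub _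
  -- What is left of (p' + c) / (2(p − m)) once X'/X is subtracted, written without poles.
  set γ : ℝ → ℝ := fun x => ((m - e₃) / 2 * p' x - α * β * (p x - e₃)) / N x with hγ
  set γ' : ℝ → ℝ := fun x => (((m - e₃) / 2 * (6 * p x ^ 2 - (e₁ ^ 2 + e₂ ^ 2 + e₃ ^ 2))
    - α * β * p' x) * N x - ((m - e₃) / 2 * p' x - α * β * (p x - e₃)) * (-((m - e₃) * p' x)))
      / N x ^ 2 with hγ'
  have dγ (x : ℝ) : HasDerivAt γ (γ' x) x :=
    (((hp.hasDerivAt' x).const_mul ((m - e₃) / 2)).sub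
      (((hp.hasDerivAt x).sub_const e₃).const_mul (α * β))).div (dN x) (Npos x).ne'
  have cp := hp.continuous
  have cp' := hp.continuous'
  have cN : Continuous N := by fun_prop
  have cγ : Continuous γ := continuous_iff_continuousAt.mpr fun x => (dγ x).continuousAt
  have cγ' : Continuous γ' := by
    have hn (x : ℝ) : N x ^ 2 ≠ 0 := pow_ne_zero 2 (Npos x).ne'
    exact Continuous.div (by fun_prop) (by fun_prop) hn
  have cX : Continuous X := continuous_iff_continuousAt.mpr fun x => (dX x).continuousAt
  have cX' : Continuous X' := continuous_iff_continuousAt.mpr fun x => (dX' x).continuousAt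
  have c₁ : Continuous S₁ := continuous_iff_continuousAt.mpr fun x => (hS.hasDerivAt₁ x).continuousAt
  have c₂ : Continuous S₂ := continuous_iff_continuousAt.mpr fun x => (hS.hasDerivAt₂ x).continuousAt
  have c₃ : Continuous S₃ := continuous_iff_continuousAt.mpr fun x => (hS.hasDerivAt₃ x).continuousAt
  have cX'' : Continuous X'' := by fun_prop
  obtain ⟨G, κ, -, dG, Gper⟩ := exists_primitive_of_periodic cγ (T := 2 * ω) fun x => by
    simp only [hγ, hN, hp.periodic, hp.periodic']
  have cG : Continuous G := continuous_iff_continuousAt.mpr fun x => (dG x).continuousAt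
  have dE (x : ℝ) := (dG x).exp
  set φ : ℝ → ℝ := fun x => X x * Real.exp (G x) with hφ
  set φ' : ℝ → ℝ := fun x => (X' x + γ x * X x) * Real.exp (G x) with hφ'
  set φ'' : ℝ → ℝ := fun x => (X'' x + γ' x * X x + γ x * X' x + γ x * (X' x + γ x * X x)) *
    Real.exp (G x) with hφ''
  have dφ (x : ℝ) : HasDerivAt φ (φ' x) x := ((dX x).mul (dE x)).congr_deriv (by
    simp only [hφ']; ring)
  have dφ' (x : ℝ) : HasDerivAt φ' (φ'' x) x :=
    (((dX' x).add ((dγ x).mul (dX x))).mul (dE x)).congr_deriv (by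
      simp only [hφ'', Pi.add_apply, Pi.mul_apply]; ring)
  have cφ : Continuous φ := by fun_prop
  have cφ'' : Continuous φ'' := by fun_prop
  have hXX (x : ℝ) : X x * (α * S₃ x - β * (S₁ x * S₂ x)) = (p x - m) * N x := by
    simp only [hX, hN]
    have : (α * S₃ x + β * (S₁ x * S₂ x)) * (α * S₃ x - β * (S₁ x * S₂ x)) =
      α ^ 2 * S₃ x ^ 2 - β ^ 2 * (S₁ x ^ 2 * S₂ x ^ 2) := by ring
    rw [this, hα, hβ, hS.sq₁, hS.sq₂, hS.sq₃]; ring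
  have hXX' (x : ℝ) : (α * S₃ x - β * (S₁ x * S₂ x)) * X' x +
      (p x - m) * ((m - e₃) / 2 * p' x - α * β * (p x - e₃)) = (p' x + c) / 2 * N x := by
    simp only [hX', hN]
    have : (α * S₃ x - β * (S₁ x * S₂ x)) *
        (α * (S₁ x * S₂ x) - β * (S₃ x * (e₁ + e₂ - 2 * p x))) =
        (α ^ 2 + β ^ 2 * (e₁ + e₂ - 2 * p x)) * (2 * (S₁ x * S₂ x * S₃ x)) / 2 -
        α * β * (S₃ x ^ 2 * (e₁ + e₂ - 2 * p x) + S₁ x ^ 2 * S₂ x ^ 2) := by ring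
    rw [this, ← hp', hα, hβ, hS.sq₁, hS.sq₂, hS.sq₃, hαβ]; ring
  have hfirst (x : ℝ) : (p x - m) * φ' x = (p' x + c) / 2 * φ x := by
    simp only [hφ', hφ]
    rw [← mul_assoc, ← mul_assoc]
    congr 1
    have hn := (Npos x).ne'
    have e : γ x * N x = (m - e₃) / 2 * p' x - α * β * (p x - e₃) := by
      simp only [hγ]; field_simp
    apply mul_right_cancel₀ hn
    linear_combination X x * hXX' x - X' x * hXX x + (p x - m) * X x * e
  refine ⟨φ, φ', ε * Real.exp κ, dφ, fun x => ?_, hfirst, fun x hx => ?_, fun x => ?_⟩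
  · refine (dφ' x).congr_deriv ?_
    -- Differentiating the first-order equation and eliminating φ' yields the second-order equation
    -- times (p − m)²; the two factors are cancelled one at a time.
    refine hp.eq_of_forall_mul_sub (m := m) (f := φ'') (g := fun x => (2 * p x + m) * φ x)
      cφ'' (by fun_prop) (fun x => ?_) x
    refine hp.eq_of_forall_mul_sub (m := m) (f := fun x => (p x - m) * φ'' x)
      (g := fun x => (p x - m) * ((2 * p x + m) * φ x)) (by fun_prop) (by fun_prop) (fun x => ?_) x
    have h1 := (((hp.hasDerivAt x).sub_const m).mul (dφ' x)).unique
      (((((hp.hasDerivAt' x).add_const c).div_const 2).mul (dφ x)).congr_of_eventuallyEq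
        (.of_forall hfirst))
    have h2 := hfirst x
    have h3 := hp.sq x
    have hs := hp.e₃_eq
    have h4 : (p' x + c) / 2 * ((c - p' x) / 2) =
        -(p x - m) * (p x ^ 2 + p x * m + m ^ 2 - (e₁ ^ 2 + e₂ ^ 2 + e₃ ^ 2) / 2) := by
      rw [hs] at h3 hc ⊢
      linear_combination (hc - h3) / 4
    linear_combination (p x - m) * h1 + (c - p' x) / 2 * h2 + φ x * h4
  · have h1 := hXX x
    have h2 : X x ≠ 0 := by
      intro h0
      rw [h0, zero_mul] at h1
      exact mul_ne_zero (_root_.sub_ne_zero.mpr hx) (Npos x).ne' h1.symm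
    exact mul_ne_zero h2 (Real.exp_pos _).ne'
  · simp only [hφ, hX, hS.periodic₁, hS.periodic₂, hS.periodic₃, Gper, Real.exp_add]
    ring

lemma exists_exp_eta (hp : IsLameProfile ω e₁ e₂ e₃ p p') {P P' : ℝ} (hP : e₁ ≤ P)
    (hP' : P' ^ 2 = 4 * (P - e₁) * (P - e₂) * (P - e₃)) :
    ∃ (Φ : ℝ → ℝ) (μ : ℝ), (∀ x, 0 < Φ x) ∧
      (∀ x, HasDerivAt Φ (lameEta p p' P P' x * Φ x) x) ∧ ∀ x, Φ (x + 2 * ω) = μ * Φ x := by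
  have dη := hp.hasDerivAt_eta hP hP'
  obtain ⟨H, κ, -, dH, Hper⟩ := exists_primitive_of_periodic
    (continuous_iff_continuousAt.mpr fun x => (dη x).continuousAt) (T := 2 * ω) fun x => by
      simp only [lameEta, hp.periodic, hp.periodic']
  refine ⟨fun x => Real.exp (H x), Real.exp κ, fun x => Real.exp_pos _,
    fun x => (dH x).exp.congr_deriv (by ring), fun x => ?_⟩
  simp only [Hper, Real.exp_add]
  ring

lemma eq_const_mul_of_hasDerivAt {Φ η f : ℝ → ℝ} (hpos : ∀ x, 0 < Φ x)
    (hΦ : ∀ x, HasDerivAt Φ (η x * Φ x) x) (hf : ∀ x, HasDerivAt f (η x * f x) x) :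
    ∃ K, ∀ x, f x = K * Φ x := by
  refine ⟨f 0 / Φ 0, fun x => ?_⟩
  have hd (x : ℝ) : HasDerivAt (fun x => f x / Φ x) 0 x := by
    refine ((hf x).div (hΦ x) (hpos x).ne').congr_deriv ?_
    ring
  have := is_const_of_deriv_eq_zero (fun x => (hd x).differentiableAt) (fun x => (hd x).deriv) x 0
  rw [← this]
  have := (hpos x).ne'
  field_simp

/-- The logarithmic derivative of KΦ³ is 3η, and −6η' = 6p(x + d) − 6p(x) by the Riccati equation
and the addition theorem. -/
lemma darbouxPotential_cube (hp : IsLameProfile ω e₁ e₂ e₃ p p') {d P P' : ℝ}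
    (hd : IsLameShift e₁ e₂ e₃ p p' d P P') {Φ : ℝ → ℝ} (hpos : ∀ x, 0 < Φ x)
    (hΦ : ∀ x, HasDerivAt Φ (lameEta p p' P P' x * Φ x) x) {V : ℝ → ℂ}
    (hV : ∀ x, V x = 6 * (p x : ℂ)) {K : ℝ} (hK : K ≠ 0) {W : ℝ → ℂ}
    (hW : ∀ x, W x = ((K * Φ x ^ 3 : ℝ) : ℂ)) :
    (∀ x, W x ≠ 0) ∧ ∀ x, darbouxPotential V W x = V (x + d) := by
  have W0 (x : ℝ) : W x ≠ 0 := by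
    rw [hW, ofReal_ne_zero]; exact mul_ne_zero hK (pow_pos (hpos x) 3).ne'
  have hlog : logDeriv W = fun x => ((3 * lameEta p p' P P' x : ℝ) : ℂ) := by
    ext x
    have h1 : HasDerivAt W ((K * (3 * Φ x ^ 2 * (lameEta p p' P P' x * Φ x)) : ℝ) : ℂ) x :=
      ((((hΦ x).pow 3).const_mul K).ofReal_comp.congr_of_eventuallyEq
        (.of_forall hW)).congr_deriv (by simp)
    rw [logDeriv_apply, h1.deriv, div_eq_iff (W0 x), hW, ← ofReal_mul]
    congr 1
    ring
  refine ⟨W0, fun x => ?_⟩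
  rw [darbouxPotential, hlog, (((hp.hasDerivAt_eta hd.le hd.sq x).const_mul 3).ofReal_comp).deriv,
    hV, hV, hp.add_eq hd]
  push_cast
  ring

/-- The hypotheses say that P, m₁, m₂ are the roots of 4(X − e₁)(X − e₂)(X − e₃) = P'². Hence p'² −
P'² = 4(p − P)(p − m₁)(p − m₂), which is then divided by 4(p − P). -/
lemma chord_factor (hp : IsLameProfile ω e₁ e₂ e₃ p p') {P P' m₁ m₂ : ℝ} (hP : e₁ ≤ P)
    (hP' : P' ^ 2 = 4 * (P - e₁) * (P - e₂) * (P - e₃)) (hsum : m₁ + m₂ = -P)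
    (hprod : m₁ * m₂ = P ^ 2 - (e₁ ^ 2 + e₂ ^ 2 + e₃ ^ 2) / 2) (x : ℝ) :
    (p x - m₁) * (p x - m₂) = lameEta p p' P P' x * ((p' x + P') / 2) := by
  have h1 := hp.eta_chord hP hP' x
  have h2 := hp.deriv_eq_eta P' hP x
  rw [h2]
  linear_combination -h1 / 2 + hprod - p x * hsum

/-- The same factorization at X = m₁. By symmetry P' serves as the constant c of `exists_lame_one`
for both m₁ and m₂. -/
lemma cubic_of_chord (hp : IsLameProfile ω e₁ e₂ e₃ p p') {P P' m₁ m₂ : ℝ}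
    (hP' : P' ^ 2 = 4 * (P - e₁) * (P - e₂) * (P - e₃)) (hsum : m₁ + m₂ = -P)
    (hprod : m₁ * m₂ = P ^ 2 - (e₁ ^ 2 + e₂ ^ 2 + e₃ ^ 2) / 2) :
    P' ^ 2 = 4 * (m₁ - e₁) * (m₁ - e₂) * (m₁ - e₃) := by
  have hs := hp.e₃_eq
  rw [hs] at hP' hprod ⊢
  linear_combination hP' + 4 * (m₁ - P) * (hprod - m₁ * hsum)

lemma eta_mul_deriv (hp : IsLameProfile ω e₁ e₂ e₃ p p') {P P' m₁ m₂ : ℝ} (hP : e₁ ≤ P)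
    (hP' : P' ^ 2 = 4 * (P - e₁) * (P - e₂) * (P - e₃)) (hsum : m₁ + m₂ = -P)
    (hprod : m₁ * m₂ = P ^ 2 - (e₁ ^ 2 + e₂ ^ 2 + e₃ ^ 2) / 2) {φ φ' φ'' : ℝ → ℝ}
    (dφ : ∀ x, HasDerivAt φ (φ' x) x) (dφ' : ∀ x, HasDerivAt φ' (φ'' x) x)
    (hφ : ∀ x, (p x - m₁) * φ' x = (p' x + P') / 2 * φ x) (x : ℝ) :
    lameEta p p' P P' x * φ' x = (p x - m₂) * φ x := by
  have cη : Continuous (lameEta p p' P P') :=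
    continuous_iff_continuousAt.mpr fun x => (hp.hasDerivAt_eta hP hP' x).continuousAt
  have cφ : Continuous φ := continuous_iff_continuousAt.mpr fun x => (dφ x).continuousAt
  have cφ' : Continuous φ' := continuous_iff_continuousAt.mpr fun x => (dφ' x).continuousAt
  have cp := hp.continuous
  refine hp.eq_of_forall_mul_sub (m := m₁) (f := fun x => lameEta p p' P P' x * φ' x)
    (g := fun x => (p x - m₂) * φ x) (by fun_prop) (by fun_prop) (fun x => ?_) x
  linear_combination lameEta p p' P P' x * hφ x - φ x * hp.chord_factor hP hP' hsum hprod x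

/-- Expanding (Φφ)''/Φ gives φ'' + 2ηφ' + (η' + η²)φ, which is (2p + m₁)φ + 2(p − m₂)φ + (2p + P)φ =
(6p − 3m₂)φ. The roles cross: the solution attached to m₁ produces the energy 3m₂. -/
lemma isBlochFunction_mul (hp : IsLameProfile ω e₁ e₂ e₃ p p') {P P' m₁ m₂ : ℝ} (hP : e₁ ≤ P)
    (hP' : P' ^ 2 = 4 * (P - e₁) * (P - e₂) * (P - e₃)) (hsum : m₁ + m₂ = -P)
    (hprod : m₁ * m₂ = P ^ 2 - (e₁ ^ 2 + e₂ ^ 2 + e₃ ^ 2) / 2) {V : ℝ → ℂ}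
    (hV : ∀ x, V x = 6 * (p x : ℂ)) {Φ φ φ' : ℝ → ℝ} {μ ν : ℝ} (hpos : ∀ x, 0 < Φ x)
    (hΦ : ∀ x, HasDerivAt Φ (lameEta p p' P P' x * Φ x) x)
    (dφ : ∀ x, HasDerivAt φ (φ' x) x) (dφ' : ∀ x, HasDerivAt φ' ((2 * p x + m₁) * φ x) x)
    (hφ : ∀ x, (p x - m₁) * φ' x = (p' x + P') / 2 * φ x) (h0 : ∃ x, φ x ≠ 0)
    (hμ : ∀ x, Φ (x + 2 * ω) = μ * Φ x) (hν : ∀ x, φ (x + 2 * ω) = ν * φ x) :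
    IsBlochFunction V (2 * ω) ((3 * m₂ : ℝ) : ℂ) ((μ * ν : ℝ) : ℂ) (fun x => ((Φ x * φ x : ℝ) : ℂ))
      ∧ ∀ x, HasDerivAt (fun x => ((Φ x * φ x : ℝ) : ℂ))
        ((Φ x * (lameEta p p' P P' x * φ x + φ' x) : ℝ) : ℂ) x := by
  have hmul := hp.eta_mul_deriv hP hP' hsum hprod dφ dφ' hφ
  have dη := hp.hasDerivAt_eta hP hP'
  set η := lameEta p p' P P'
  have d1 (x : ℝ) : HasDerivAt (fun x => ((Φ x * φ x : ℝ) : ℂ))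
      ((Φ x * (η x * φ x + φ' x) : ℝ) : ℂ) x :=
    (((hΦ x).mul (dφ x)).congr_deriv (by ring)).ofReal_comp
  have d2 (x : ℝ) : HasDerivAt (fun x => ((Φ x * (η x * φ x + φ' x) : ℝ) : ℂ))
      ((6 * p x - 3 * m₂) * (Φ x * φ x) : ℝ) x := by
    refine ((((hΦ x).mul (((dη x).mul (dφ x)).add (dφ' x)))).congr_deriv ?_).ofReal_comp
    simp only [Pi.add_apply, Pi.mul_apply]
    linear_combination 2 * Φ x * hmul x + Φ x * φ x * hsum
  have hVc : Continuous V := by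
    have := hp.continuous
    rw [funext hV]; fun_prop
  refine ⟨.of_hasDerivAt hVc d1 (fun x => (d2 x).congr_deriv ?_) ?_ (fun x => ?_), d1⟩
  · rw [hV]; push_cast; ring
  · obtain ⟨x, hx⟩ := h0
    exact ⟨x, ofReal_ne_zero.mpr (mul_ne_zero (hpos x).ne' hx)⟩
  · rw [hμ, hν]; push_cast; ring

lemma exists_ne_ne (hp : IsLameProfile ω e₁ e₂ e₃ p p') (m₁ m₂ : ℝ) : ∃ x, p x ≠ m₁ ∧ p x ≠ m₂ := by
  have hc := hp.continuous
  have ho : IsOpen {x | p x ≠ m₁} := isOpen_ne_fun hc continuous_const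
  exact ((hp.dense_ne m₁).inter_of_isOpen_left (hp.dense_ne m₂) ho).nonempty

theorem isDarbouxDisplacement (hp : IsLameProfile ω e₁ e₂ e₃ p p') {d P P' m₁ m₂ : ℝ}
    (hd : IsLameShift e₁ e₂ e₃ p p' d P P') (hsum : m₁ + m₂ = -P)
    (hprod : m₁ * m₂ = P ^ 2 - (e₁ ^ 2 + e₂ ^ 2 + e₃ ^ 2) / 2) (hne : m₁ ≠ m₂)
    (h₁ : m₁ ∈ Icc e₃ e₂) (h₂ : m₂ ∈ Icc e₃ e₂) {V : ℝ → ℂ} (hV : ∀ x, V x = 6 * (p x : ℂ)) :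
    IsDarbouxDisplacement V (2 * ω) ((3 * m₁ : ℝ) : ℂ) ((3 * m₂ : ℝ) : ℂ) d := by
  have hsum' : m₂ + m₁ = -P := by linarith
  have hprod' : m₂ * m₁ = P ^ 2 - (e₁ ^ 2 + e₂ ^ 2 + e₃ ^ 2) / 2 := by linarith
  obtain ⟨φ₁, φ₁', ν₁, dφ₁, dφ₁', hφ₁, h0₁, hν₁⟩ :=
    hp.exists_lame_one h₁.1 h₁.2 (hp.cubic_of_chord hd.sq hsum hprod)
  obtain ⟨φ₂, φ₂', ν₂, dφ₂, dφ₂', hφ₂, h0₂, hν₂⟩ :=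
    hp.exists_lame_one h₂.1 h₂.2 (hp.cubic_of_chord hd.sq hsum' hprod')
  obtain ⟨Φ, μ, hpos, hΦ, hμ⟩ := hp.exists_exp_eta hd.le hd.sq
  obtain ⟨x₀, hx₁, hx₂⟩ := hp.exists_ne_ne m₁ m₂
  have hm₁ := hp.eta_mul_deriv hd.le hd.sq hsum hprod dφ₁ dφ₁' hφ₁
  have hm₂ := hp.eta_mul_deriv hd.le hd.sq hsum' hprod' dφ₂ dφ₂' hφ₂
  obtain ⟨b₁, d₁⟩ := hp.isBlochFunction_mul hd.le hd.sq hsum' hprod' hV hpos hΦ dφ₂ dφ₂' hφ₂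
    ⟨x₀, h0₂ _ hx₂⟩ hμ hν₂
  obtain ⟨b₂, d₂⟩ := hp.isBlochFunction_mul hd.le hd.sq hsum hprod hV hpos hΦ dφ₁ dφ₁' hφ₁
    ⟨x₀, h0₁ _ hx₁⟩ hμ hν₁
  -- By `hm₁` and `hm₂`, the derivative of this smaller Wronskian is η times itself, so it equals
  -- KΦ, and the Wronskian of Φφ₂ and Φφ₁ is Φ² · KΦ.
  have dw (x : ℝ) : HasDerivAt (fun x => φ₂ x * φ₁' x - φ₂' x * φ₁ x)
      ((m₁ - m₂) * (φ₁ x * φ₂ x)) x :=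
    (((dφ₂ x).mul (dφ₁' x)).sub ((dφ₂' x).mul (dφ₁ x))).congr_deriv (by ring)
  obtain ⟨K, hK⟩ := eq_const_mul_of_hasDerivAt (f := fun x => φ₂ x * φ₁' x - φ₂' x * φ₁ x) hpos hΦ
    (fun x => (dw x).congr_deriv (by linear_combination φ₁ x * hm₂ x - φ₂ x * hm₁ x))
  have hK0 : K ≠ 0 := by
    rintro rfl
    have := (dw x₀).unique ((hasDerivAt_const x₀ (0 : ℝ)).congr_of_eventuallyEq
      (.of_forall fun x => (hK x).trans (zero_mul _)))
    exact mul_ne_zero (_root_.sub_ne_zero.mpr hne) (mul_ne_zero (h0₁ _ hx₁) (h0₂ _ hx₂)) this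
  obtain ⟨W0, hW⟩ := hp.darbouxPotential_cube hd hpos hΦ hV hK0 (W := wronskian
    (fun x => ((Φ x * φ₂ x : ℝ) : ℂ)) (fun x => ((Φ x * φ₁ x : ℝ) : ℂ))) (fun x => by
      rw [wronskian, (d₁ x).deriv, (d₂ x).deriv]
      norm_cast
      linear_combination Φ x ^ 2 * hK x)
  refine ⟨fun h => hne ?_, _, _, _, _, b₁, b₂, W0, hW⟩
  have : 3 * m₁ = 3 * m₂ := by exact_mod_cast h
  linarith

theorem isConfluentDarbouxDisplacement (hp : IsLameProfile ω e₁ e₂ e₃ p p') {d P P' m : ℝ}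
    (hd : IsLameShift e₁ e₂ e₃ p p' d P P') (hsum : m + m = -P)
    (hprod : m * m = P ^ 2 - (e₁ ^ 2 + e₂ ^ 2 + e₃ ^ 2) / 2)
    (hm : m ∈ Icc e₃ e₂) (hP' : P' ≠ 0) {V : ℝ → ℂ} (hV : ∀ x, V x = 6 * (p x : ℂ)) :
    IsConfluentDarbouxDisplacement V (2 * ω) ((3 * m : ℝ) : ℂ) d := by
  obtain ⟨φ, φ', ν, dφ, dφ', hφ, h0, hν⟩ :=
    hp.exists_lame_one hm.1 hm.2 (hp.cubic_of_chord hd.sq hsum hprod)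
  obtain ⟨Φ, μ, hpos, hΦ, hμ⟩ := hp.exists_exp_eta hd.le hd.sq
  obtain ⟨x₀, hx₀, -⟩ := hp.exists_ne_ne m m
  have hmul := hp.eta_mul_deriv hd.le hd.sq hsum hprod dφ dφ' hφ
  obtain ⟨b, -⟩ := hp.isBlochFunction_mul hd.le hd.sq hsum hprod hV hpos hΦ dφ dφ' hφ
    ⟨x₀, h0 _ hx₀⟩ hμ hν
  -- An explicit primitive of φ² that also satisfies φ² = ηk. Hence k = KΦ, and KΦ³/3 has derivative
  -- Φ²φ², the square of the Bloch function.
  set k : ℝ → ℝ := fun x => (φ' x ^ 2 - (p x - P) * φ x ^ 2) / P' with hk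
  have dk (x : ℝ) : HasDerivAt k (φ x ^ 2) x := by
    refine ((((dφ' x).pow 2).sub (((hp.hasDerivAt x).sub_const P).mul
      ((dφ x).pow 2))).div_const P').congr_deriv ?_
    simp only [Nat.cast_ofNat, Nat.add_one_sub_one, pow_one, Pi.pow_apply]
    field_simp
    linear_combination 2 * φ x * hφ x + 2 * φ x * φ' x * hsum
  have hkη (x : ℝ) : φ x ^ 2 = lameEta p p' P P' x * k x := by
    have h1 := hmul x
    have h2 := hφ x
    have h3 := hp.deriv_eq_eta P' hd.le x
    simp only [hk]
    field_simp
    linear_combination -φ' x * h1 - φ x * h2 - φ x ^ 2 / 2 * h3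
  obtain ⟨K, hK⟩ := eq_const_mul_of_hasDerivAt hpos hΦ fun x => (dk x).congr_deriv (hkη x)
  have hK0 : K ≠ 0 := by
    rintro rfl
    have := hkη x₀
    rw [hK, zero_mul, mul_zero] at this
    exact h0 _ hx₀ (pow_eq_zero_iff two_ne_zero |>.mp this)
  obtain ⟨W0, hW⟩ := hp.darbouxPotential_cube hd hpos hΦ hV (K := K / 3) (by simpa using hK0)
    (W := fun x => ((K / 3 * Φ x ^ 3 : ℝ) : ℂ)) (fun x => rfl)
  refine ⟨_, _, _, b, fun x => ?_, W0, hW⟩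
  refine ((((hΦ x).pow 3).const_mul (K / 3)).congr_deriv ?_).ofReal_comp.congr_deriv
    (ofReal_pow _ 2)
  simp only [Nat.cast_ofNat, Nat.add_one_sub_one]
  rw [mul_pow, hkη, hK]
  ring

end IsLameProfile

/-! ### Allowed and forbidden energies -/

/-- The product of the two Bloch solutions of `-u'' + 6 p u = a u`. -/
def lameProduct (e₁ e₂ e₃ : ℝ) (p : ℝ → ℝ) (a x : ℝ) : ℝ :=
  p x ^ 2 + a / 3 * p x + a ^ 2 / 9 - (e₁ ^ 2 + e₂ ^ 2 + e₃ ^ 2) / 2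

/-- The first derivative of `lameProduct`. -/
def lameProduct' (p p' : ℝ → ℝ) (a x : ℝ) : ℝ := (2 * p x + a / 3) * p' x

/-- The second derivative of `lameProduct`. -/
def lameProduct'' (e₁ e₂ e₃ : ℝ) (p p' : ℝ → ℝ) (a x : ℝ) : ℝ :=
  2 * p' x ^ 2 + (2 * p x + a / 3) * (6 * p x ^ 2 - (e₁ ^ 2 + e₂ ^ 2 + e₃ ^ 2))

/-- The spectral polynomial of the two-gap Lamé operator. -/
def lameSpectral (e₁ e₂ e₃ a : ℝ) : ℝ :=
  -((a ^ 2 - 6 * (e₁ ^ 2 + e₂ ^ 2 + e₃ ^ 2)) * (a - 3 * e₁) * (a - 3 * e₂) * (a - 3 * e₃)) / 81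

lemma HasDerivAt.complex_re {f : ℝ → ℂ} {f' : ℂ} {x : ℝ} (h : HasDerivAt f f' x) :
    HasDerivAt (fun x => (f x).re) f'.re x := Complex.reCLM.hasFDerivAt.comp_hasDerivAt x h

lemma HasDerivAt.complex_im {f : ℝ → ℂ} {f' : ℂ} {x : ℝ} (h : HasDerivAt f f' x) :
    HasDerivAt (fun x => (f x).im) f'.im x := Complex.imCLM.hasFDerivAt.comp_hasDerivAt x h

lemma HasDerivAt.complex_conj {f : ℝ → ℂ} {f' : ℂ} {x : ℝ} (h : HasDerivAt f f' x) :
    HasDerivAt (fun x => (starRingEnd ℂ) (f x)) ((starRingEnd ℂ) f') x :=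
  Complex.conjCLE.toContinuousLinearMap.hasFDerivAt.comp_hasDerivAt x h

/-- A boundary term of Sturm comparison vanishes at a common zero. -/
lemma tendsto_sturm_boundary {f f' S S' : ℝ → ℝ} {x₀ : ℝ} (hf : ∀ x, HasDerivAt f (f' x) x)
    (hS : ∀ x, HasDerivAt S (S' x) x) (hf' : ContinuousAt f' x₀) (hS' : ContinuousAt S' x₀)
    (f0 : f x₀ = 0) (S0 : S x₀ = 0) (hne : S' x₀ ≠ 0) :
    Tendsto (fun x => f x * (f' x - S' x * (f x / S x))) (𝓝[≠] x₀) (𝓝 0) := by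
  have h1 : Tendsto (fun x => f x / S x) (𝓝[≠] x₀) (𝓝 (f' x₀ / S' x₀)) := by
    refine ((hasDerivAt_iff_tendsto_slope.mp (hf x₀)).div
      (hasDerivAt_iff_tendsto_slope.mp (hS x₀)) hne).congr' ?_
    filter_upwards [self_mem_nhdsWithin] with x hx
    have : x - x₀ ≠ 0 := sub_ne_zero.mpr hx
    simp only [Pi.div_apply, slope_def_field, f0, S0, sub_zero]
    field_simp
  have h2 : Tendsto f (𝓝[≠] x₀) (𝓝 0) := by
    rw [← f0]; exact (hf x₀).continuousAt.tendsto.mono_left nhdsWithin_le_nhds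
  have h3 := hf'.tendsto.mono_left (nhdsWithin_le_nhds (s := {x₀}ᶜ))
  have h4 := hS'.tendsto.mono_left (nhdsWithin_le_nhds (s := {x₀}ᶜ))
  simpa using h2.mul (h3.sub (h4.mul h1))

/-- Sturm comparison: if `S'' = (V - E) S` is nonzero on `(A, B)` and vanishes at the ends, then for
`a < E` the Dirichlet problem `f'' = (V - a) f` has only the trivial solution. -/
lemma sturm_dirichlet {f f' S S' V : ℝ → ℝ} {A B a E : ℝ} (hAB : A < B) (haE : a < E)
    (hV : Continuous V)
    (hf : ∀ x, HasDerivAt f (f' x) x) (hf' : ∀ x, HasDerivAt f' ((V x - a) * f x) x)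
    (hS : ∀ x, HasDerivAt S (S' x) x) (hS' : ∀ x, HasDerivAt S' ((V x - E) * S x) x)
    (hne : ∀ x ∈ Ioo A B, S x ≠ 0) (SA : S A = 0) (SB : S B = 0) (SA' : S' A ≠ 0) (SB' : S' B ≠ 0)
    (fA : f A = 0) (fB : f B = 0) (x : ℝ) : f x = 0 := by
  -- Picone's identity: Ψ' is a square plus (E − a)f², while Ψ tends to 0 at both ends. So Ψ, and
  -- with it f, vanishes.
  set Ψ : ℝ → ℝ := fun x => f x * (f' x - S' x * (f x / S x)) with hΨ
  have dΨ (x : ℝ) (hx : x ∈ Ioo A B) :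
      HasDerivAt Ψ ((f' x - S' x * (f x / S x)) ^ 2 + (E - a) * f x ^ 2) x := by
    have hs := hne x hx
    refine ((hf x).mul ((hf' x).sub ((hS' x).mul ((hf x).div (hS x) hs)))).congr_deriv ?_
    simp only [Pi.sub_apply, Pi.mul_apply, Pi.div_apply]
    field_simp
    ring
  have hmono : MonotoneOn Ψ (Ioo A B) := by
    refine monotoneOn_of_deriv_nonneg (convex_Ioo A B)
      (fun x hx => (dΨ x hx).continuousAt.continuousWithinAt) (fun x hx => ?_) fun x hx => ?_
    · rw [interior_Ioo] at hx; exact (dΨ x hx).differentiableAt.differentiableWithinAt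
    · rw [interior_Ioo] at hx
      rw [(dΨ x hx).deriv]
      have := sub_pos.mpr haE
      positivity
  have tA : Tendsto Ψ (𝓝[>] A) (𝓝 0) :=
    (tendsto_sturm_boundary hf hS (hf' A).continuousAt (hS' A).continuousAt fA SA SA').mono_left
      (nhdsWithin_mono A fun y hy => ne_of_gt hy)
  have tB : Tendsto Ψ (𝓝[<] B) (𝓝 0) :=
    (tendsto_sturm_boundary hf hS (hf' B).continuousAt (hS' B).continuousAt fB SB SB').mono_left
      (nhdsWithin_mono B fun y hy => ne_of_lt hy)
  have h0 (x : ℝ) (hx : x ∈ Ioo A B) : Ψ x = 0 := by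
    refine le_antisymm (ge_of_tendsto tB ?_) (le_of_tendsto tA ?_)
    · filter_upwards [Ioo_mem_nhdsLT hx.2] with y hy
      exact hmono hx ⟨hx.1.trans hy.1, hy.2⟩ hy.1.le
    · filter_upwards [Ioo_mem_nhdsGT hx.1] with y hy
      exact hmono ⟨hy.1, hy.2.trans hx.2⟩ hx hy.2.le
  have hfz (x : ℝ) (hx : x ∈ Ioo A B) : f x = 0 := by
    have h1 := (dΨ x hx).unique ((hasDerivAt_const x (0 : ℝ)).congr_of_eventuallyEq (by
      filter_upwards [Ioo_mem_nhds hx.1 hx.2] with y hy using h0 y hy))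
    by_contra hne0
    have := sub_pos.mpr haE
    have : 0 < (E - a) * f x ^ 2 := by positivity
    linarith [sq_nonneg (f' x - S' x * (f x / S x))]
  obtain ⟨x₀, hx₀⟩ := nonempty_Ioo.mpr hAB
  refine eq_zero_of_hasDerivAt_linear hf hf' (by fun_prop) (hfz x₀ hx₀) ?_ x
  exact (hf x₀).unique ((hasDerivAt_const x₀ (0 : ℝ)).congr_of_eventuallyEq (by
      filter_upwards [Ioo_mem_nhds hx₀.1 hx₀.2] with y hy using hfz y hy))

namespace IsLameRoots

variable {ω e₁ e₂ e₃ : ℝ} {p p' : ℝ → ℝ} {S₁ S₂ S₃ : ℝ → ℝ} {ε : ℝ}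

lemma deriv_eq (hS : IsLameRoots ω e₁ e₂ e₃ p S₁ S₂ S₃ ε) (hp : IsLameProfile ω e₁ e₂ e₃ p p')
    (x : ℝ) : p' x = 2 * (S₁ x * S₂ x * S₃ x) := by
  have h1 := ((hS.hasDerivAt₃ x).pow 2).congr_of_eventuallyEq (f₁ := fun x => p x - e₃)
    (.of_forall fun x => (hS.sq₃ x).symm)
  rw [((hp.hasDerivAt x).sub_const e₃).unique h1]
  simp; ring

/-- S₁S₂ and S₁S₃ are the eigenfunctions at the gap edges 3e₃ and 3e₂. -/
lemma hasDerivAt₁₂ (hS : IsLameRoots ω e₁ e₂ e₃ p S₁ S₂ S₃ ε) (x : ℝ) :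
    HasDerivAt (fun x => S₁ x * S₂ x) (-(S₃ x * (e₁ + e₂ - 2 * p x))) x :=
  ((hS.hasDerivAt₁ x).mul (hS.hasDerivAt₂ x)).congr_deriv (by
    linear_combination -S₃ x * (hS.sq₁ x + hS.sq₂ x))

lemma hasDerivAt₁₂' (hS : IsLameRoots ω e₁ e₂ e₃ p S₁ S₂ S₃ ε)
    (hp : IsLameProfile ω e₁ e₂ e₃ p p') (x : ℝ) :
    HasDerivAt (fun x => -(S₃ x * (e₁ + e₂ - 2 * p x)))
      ((6 * p x - 3 * e₃) * (S₁ x * S₂ x)) x :=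
  ((hS.hasDerivAt₃ x).mul (((hp.hasDerivAt x).const_mul 2).const_sub (e₁ + e₂))).neg.congr_deriv (by
    rw [hS.deriv_eq hp]
    linear_combination 4 * (S₁ x * S₂ x) * hS.sq₃ x - S₁ x * S₂ x * hp.sum)

lemma hasDerivAt₁₃ (hS : IsLameRoots ω e₁ e₂ e₃ p S₁ S₂ S₃ ε) (x : ℝ) :
    HasDerivAt (fun x => S₁ x * S₃ x) (S₂ x * (e₁ + e₃ - 2 * p x)) x :=
  ((hS.hasDerivAt₁ x).mul (hS.hasDerivAt₃ x)).congr_deriv (by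
    linear_combination S₂ x * (hS.sq₁ x - hS.sq₃ x))

lemma hasDerivAt₁₃' (hS : IsLameRoots ω e₁ e₂ e₃ p S₁ S₂ S₃ ε)
    (hp : IsLameProfile ω e₁ e₂ e₃ p p') (x : ℝ) :
    HasDerivAt (fun x => S₂ x * (e₁ + e₃ - 2 * p x)) ((6 * p x - 3 * e₂) * (S₁ x * S₃ x)) x :=
  ((hS.hasDerivAt₂ x).mul (((hp.hasDerivAt x).const_mul 2).const_sub (e₁ + e₃))).congr_deriv (by
    rw [hS.deriv_eq hp]
    linear_combination -4 * (S₁ x * S₃ x) * hS.sq₂ x - S₁ x * S₃ x * hp.sum)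

end IsLameRoots

namespace IsLameProfile

variable {ω e₁ e₂ e₃ : ℝ} {p p' : ℝ → ℝ}

lemma hasDerivAt_product (hp : IsLameProfile ω e₁ e₂ e₃ p p') (a x : ℝ) :
    HasDerivAt (lameProduct e₁ e₂ e₃ p a) (lameProduct' p p' a x) x :=
  (((((hp.hasDerivAt x).pow 2).add ((hp.hasDerivAt x).const_mul (a / 3))).add_const
    (a ^ 2 / 9)).sub_const _).congr_deriv (by simp [lameProduct']; ring)

lemma hasDerivAt_product' (hp : IsLameProfile ω e₁ e₂ e₃ p p') (a x : ℝ) :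
    HasDerivAt (lameProduct' p p' a) (lameProduct'' e₁ e₂ e₃ p p' a x) x :=
  ((((hp.hasDerivAt x).const_mul 2).add_const (a / 3)).mul (hp.hasDerivAt' x)).congr_deriv (by
    simp [lameProduct'']; ring)

lemma hasDerivAt_product'' (hp : IsLameProfile ω e₁ e₂ e₃ p p') (a x : ℝ) :
    HasDerivAt (lameProduct'' e₁ e₂ e₃ p p' a) (4 * (6 * p x - a) * lameProduct' p p' a x +
      12 * p' x * lameProduct e₁ e₂ e₃ p a x) x :=
  ((((hp.hasDerivAt' x).pow 2).const_mul 2).add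
    ((((hp.hasDerivAt x).const_mul 2).add_const (a / 3)).mul
      ((((hp.hasDerivAt x).pow 2).const_mul 6).sub_const _))).congr_deriv (by
    simp [lameProduct', lameProduct]; ring)

/-- For a product F of two solutions the left side is a quarter of their squared Wronskian, hence
constant; here the constancy is read off from the cubic. -/
lemma spectral_eq (hp : IsLameProfile ω e₁ e₂ e₃ p p') (a x : ℝ) :
    lameProduct' p p' a x ^ 2 / 4 -
      lameProduct e₁ e₂ e₃ p a x * lameProduct'' e₁ e₂ e₃ p p' a x / 2 +
      (6 * p x - a) * lameProduct e₁ e₂ e₃ p a x ^ 2 = lameSpectral e₁ e₂ e₃ a := by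
  have h := hp.sq x
  rw [lameProduct, lameProduct', lameProduct'', lameSpectral, mul_pow, h, hp.e₃_eq]
  ring

lemma deriv_neg (hp : IsLameProfile ω e₁ e₂ e₃ p p') (x : ℝ) : p' (-x) = -p' x := by
  have h1 := (HasDerivAt.scomp x (hp.hasDerivAt (-x)) (hasDerivAt_neg x)).congr_of_eventuallyEq
    (f₁ := p) (.of_forall fun y => (hp.even y).symm)
  have := (hp.hasDerivAt x).unique h1
  simp at this
  linarith

section Bands

variable {V : ℝ → ℂ}

lemma continuous_potential (hp : IsLameProfile ω e₁ e₂ e₃ p p') (hV : ∀ x, V x = 6 * (p x : ℂ)) :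
    Continuous V := by
  have := hp.continuous
  rw [funext hV]; fun_prop

/-- At a zero of F the first integral would be F'²/4 ≥ 0, so F has no zeros and exp ∫ (F'/2 + iκ)/F
is a smooth solution. Its squared modulus is proportional to |F|, which is periodic, so the
multiplier is unimodular. -/
theorem isAllowedEnergy_of_neg (hp : IsLameProfile ω e₁ e₂ e₃ p p') (hV : ∀ x, V x = 6 * (p x : ℂ))
    {a : ℝ} (ha : lameSpectral e₁ e₂ e₃ a < 0) : IsAllowedEnergy V (2 * ω) a := by
  have hF0 (x : ℝ) : lameProduct e₁ e₂ e₃ p a x ≠ 0 := by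
    intro h0
    have := hp.spectral_eq a x
    rw [h0] at this
    nlinarith [sq_nonneg (lameProduct' p p' a x)]
  set κ := √(-lameSpectral e₁ e₂ e₃ a) with hκ
  have hκ2 : κ ^ 2 = -lameSpectral e₁ e₂ e₃ a := Real.sq_sqrt (by linarith)
  have hspec := hp.spectral_eq a
  have dF := hp.hasDerivAt_product a
  have dF' := hp.hasDerivAt_product' a
  have Fper (x : ℝ) : lameProduct e₁ e₂ e₃ p a (x + 2 * ω) = lameProduct e₁ e₂ e₃ p a x := by
    simp only [lameProduct, hp.periodic]
  have Fper' (x : ℝ) : lameProduct' p p' a (x + 2 * ω) = lameProduct' p p' a x := by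
    simp only [lameProduct', hp.periodic, hp.periodic']
  set F := lameProduct e₁ e₂ e₃ p a
  set F' := lameProduct' p p' a
  set F'' := lameProduct'' e₁ e₂ e₃ p p' a
  have hFc (x : ℝ) : (F x : ℂ) ≠ 0 := ofReal_ne_zero.mpr (hF0 x)
  set v : ℝ → ℂ := fun x => ((F' x : ℂ) / 2 + κ * I) / F x with hv
  have dv (x : ℝ) : HasDerivAt v (6 * p x - a - v x ^ 2) x := by
    refine ((((dF' x).ofReal_comp.div_const 2).add_const (κ * I)).div (dF x).ofReal_comp
      (hFc x)).congr_deriv ?_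
    have h1 : (F' x : ℂ) ^ 2 / 4 - F x * F'' x / 2 + (6 * p x - a) * F x ^ 2 = -κ ^ 2 := by
      have := hspec x
      rw [← neg_neg (lameSpectral e₁ e₂ e₃ a), ← hκ2] at this
      exact_mod_cast this
    have hne := hFc x
    simp only [hv]
    field_simp
    have hI : I ^ 2 = -1 := I_sq
    linear_combination (-4 : ℂ) * h1 + 4 * (κ : ℂ) ^ 2 * hI
  have cv : Continuous v := continuous_iff_continuousAt.mpr fun x => (dv x).continuousAt
  obtain ⟨G, c, G0, dG, Gper⟩ := exists_primitive_of_periodic cv (T := 2 * ω) fun x => by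
    simp only [hv, Fper, Fper']
  have hc : c.re = 0 := by
    have hd (x : ℝ) : HasDerivAt (fun x => (G x).re - Real.log (F x) / 2) 0 x := by
      refine ((dG x).complex_re.sub (((dF x).log (hF0 x)).div_const 2)).congr_deriv ?_
      have : v x = (((F' x / 2 / F x : ℝ) : ℂ)) + ((κ / F x : ℝ) : ℂ) * I := by
        have := hFc x
        simp only [hv]; push_cast; field_simp
      rw [this]
      simp
      ring
    have := is_const_of_deriv_eq_zero (fun x => (hd x).differentiableAt) (fun x => (hd x).deriv)
      (0 + 2 * ω) 0
    rw [Gper, Fper, G0] at this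
    simp at this
    linarith
  refine ⟨exp c, fun x => exp (G x), by rw [Complex.norm_exp, hc, Real.exp_zero],
    .of_hasDerivAt (hp.continuous_potential hV) (fun x => (dG x).cexp)
      (fun x => ((dG x).cexp.mul (dv x)).congr_deriv ?_) ⟨0, exp_ne_zero _⟩ fun x => ?_⟩
  · rw [hV]; ring
  · rw [Gper, Complex.exp_add, mul_comm]

/-- A real solution which is multiplied by `±1` under translation by the period yields an allowed
energy. -/
lemma isAllowedEnergy_of_real (hp : IsLameProfile ω e₁ e₂ e₃ p p') (hV : ∀ x, V x = 6 * (p x : ℂ))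
    {a ε : ℝ} {u u' : ℝ → ℝ} (hε : ε ^ 2 = 1) (hu : ∀ x, HasDerivAt u (u' x) x)
    (hu' : ∀ x, HasDerivAt u' ((6 * p x - a) * u x) x) (h0 : ∃ x, u x ≠ 0)
    (hT : ∀ x, u (x + 2 * ω) = ε * u x) : IsAllowedEnergy V (2 * ω) a := by
  refine ⟨ε, fun x => u x, ?_, .of_hasDerivAt (hp.continuous_potential hV)
    (fun x => (hu x).ofReal_comp) (fun x => (hu' x).ofReal_comp.congr_deriv ?_) ?_ fun x => ?_⟩
  · rw [norm_real, Real.norm_eq_abs]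
    exact (pow_eq_one_iff_of_nonneg (abs_nonneg ε) two_ne_zero).mp (by rw [sq_abs, hε])
  · rw [hV]; push_cast; ring
  · obtain ⟨x, hx⟩ := h0
    exact ⟨x, ofReal_ne_zero.mpr hx⟩
  · rw [hT, ofReal_mul]

/-- The Dirichlet problem on a period has no eigenvalue below `3 e₂`. -/
lemma dirichlet_eq_zero (hp : IsLameProfile ω e₁ e₂ e₃ p p') {a : ℝ} (ha : a < 3 * e₂)
    {f f' : ℝ → ℝ} (hf : ∀ x, HasDerivAt f (f' x) x)
    (hf' : ∀ x, HasDerivAt f' ((6 * p x - a) * f x) x) (f0 : f 0 = 0) (fT : f (2 * ω) = 0) (x : ℝ) :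
    f x = 0 := by
  obtain ⟨S₁, S₂, S₃, ε, hS⟩ := hp.exists_roots
  have hpT : p (2 * ω) = e₃ := by rw [← zero_add (2 * ω), hp.periodic, hp.zero]
  have hz (x : ℝ) (hx : p x = e₃) : S₁ x * S₃ x = 0 ∧ S₂ x * (e₁ + e₃ - 2 * p x) ≠ 0 := by
    have h2 := hS.sq₂ x
    have h3 := hS.sq₃ x
    rw [hx] at h2 h3 ⊢
    constructor
    · rw [sub_self] at h3
      rw [pow_eq_zero_iff two_ne_zero |>.mp h3, mul_zero]
    · refine mul_ne_zero (fun h => ?_) ?_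
      · rw [h] at h2; linarith [hp.lt₃₂]
      · linarith [hp.lt₃₂, hp.lt₂₁]
  have hpc := hp.continuous
  refine sturm_dirichlet (V := fun x => 6 * p x) (A := 0) (B := 2 * ω) (by linarith [hp.pos]) ha
    (by fun_prop) hf hf' hS.hasDerivAt₁₃ (hS.hasDerivAt₁₃' hp) (fun x hx => ?_) (hz 0 hp.zero).1
    (hz _ hpT).1 (hz 0 hp.zero).2 (hz _ hpT).2 f0 fT x
  refine mul_ne_zero (hS.pos x).ne' fun h => ?_
  have h3 := hS.sq₃ x
  rw [h] at h3
  linarith [hp.e₃_lt x hx]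

lemma dirichlet_eq_zero_complex (hp : IsLameProfile ω e₁ e₂ e₃ p p') {a : ℝ} (ha : a < 3 * e₂)
    {f f' : ℝ → ℂ} (hf : ∀ x, HasDerivAt f (f' x) x)
    (hf' : ∀ x, HasDerivAt f' ((6 * p x - a) * f x) x) (f0 : f 0 = 0) (fT : f (2 * ω) = 0) (x : ℝ) :
    f x = 0 := by
  have e (x : ℝ) : (6 * p x - a) * f x = ((6 * p x - a : ℝ) : ℂ) * f x := by push_cast; ring
  apply Complex.ext
  · refine hp.dirichlet_eq_zero ha (fun x => (hf x).complex_re)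
      (fun x => (hf' x).complex_re.congr_deriv ?_) (by simp [f0]) (by simp [fT]) x
    rw [e, re_ofReal_mul]
  · refine hp.dirichlet_eq_zero ha (fun x => (hf x).complex_im)
      (fun x => (hf' x).complex_im.congr_deriv ?_) (by simp [f0]) (by simp [fT]) x
    rw [e, im_ofReal_mul]

/-- Every Bloch function in a gap can be replaced by an eigenfunction of the commuting operator
`F ∂ - F' / 2`. -/
lemma exists_bloch_first_order (hp : IsLameProfile ω e₁ e₂ e₃ p p') (hV : ∀ x, V x = 6 * (p x : ℂ))
    {a : ℝ} (ha : 0 < lameSpectral e₁ e₂ e₃ a) {β : ℂ} {u : ℝ → ℂ}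
    (hu : IsBlochFunction V (2 * ω) a β u) :
    ∃ (s : ℝ) (v v' : ℝ → ℂ), s ≠ 0 ∧ (∃ x, v x ≠ 0) ∧ (∀ x, HasDerivAt v (v' x) x) ∧
      (∀ x, HasDerivAt v' ((6 * p x - a) * v x) x) ∧ (∀ x, v (x + 2 * ω) = β * v x) ∧
      ∀ x, lameProduct e₁ e₂ e₃ p a x * v' x = (lameProduct' p p' a x / 2 + s) * v x := by
  have hspec := hp.spectral_eq a
  have dF := hp.hasDerivAt_product a
  have dF' := hp.hasDerivAt_product' a
  have dF'' := hp.hasDerivAt_product'' a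
  have Fper (x : ℝ) : lameProduct e₁ e₂ e₃ p a (x + 2 * ω) = lameProduct e₁ e₂ e₃ p a x := by
    simp only [lameProduct, hp.periodic]
  have Fper' (x : ℝ) : lameProduct' p p' a (x + 2 * ω) = lameProduct' p p' a x := by
    simp only [lameProduct', hp.periodic, hp.periodic']
  set F := lameProduct e₁ e₂ e₃ p a
  set F' := lameProduct' p p' a
  set F'' := lameProduct'' e₁ e₂ e₃ p p' a
  have du := hu.hasDerivAt
  have du' := hu.hasDerivAt_deriv
  have uper' (x : ℝ) : deriv u (x + 2 * ω) = β * deriv u x :=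
    ((du (x + 2 * ω)).comp_add_const x _).unique (((du x).const_mul β).congr_of_eventuallyEq
      (.of_forall hu.2.2.2))
  set u' := deriv u
  -- A = F∂ − F'/2 preserves solutions and squares to s² on them, so Au + su satisfies Av = sv. The
  -- choices s and −s cannot both give zero, since the results differ by 2su.
  have key (s : ℝ) (hs : s ^ 2 = lameSpectral e₁ e₂ e₃ a) : ∃ (v v' : ℝ → ℂ),
      (∀ x, v x = F x * u' x - F' x / 2 * u x + s * u x) ∧ (∀ x, HasDerivAt v (v' x) x) ∧
      (∀ x, HasDerivAt v' ((6 * p x - a) * v x) x) ∧ (∀ x, v (x + 2 * ω) = β * v x) ∧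
      ∀ x, F x * v' x = (F' x / 2 + s) * v x := by
    refine ⟨fun x => F x * u' x - F' x / 2 * u x + s * u x,
      fun x => F' x / 2 * u' x + (F x * (6 * p x - a) - F'' x / 2) * u x + s * u' x,
      fun x => rfl, fun x => ?_, fun x => ?_, fun x => ?_, fun x => ?_⟩
    · refine ((((dF x).ofReal_comp.mul (du' x)).sub
        (((dF' x).ofReal_comp.div_const 2).mul (du x))).add ((du x).const_mul (s : ℂ))).congr_deriv ?_
      rw [hV]; ring
    · have d1 : HasDerivAt (fun x => (6 * p x - a : ℂ)) (6 * p' x) x :=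
        ((hp.hasDerivAt x).ofReal_comp.const_mul 6).sub_const _
      refine (((((dF' x).ofReal_comp.div_const 2).mul (du' x)).add
        ((((dF x).ofReal_comp.mul d1).sub ((dF'' x).ofReal_comp.div_const 2)).mul (du x))).add
        ((du' x).const_mul (s : ℂ))).congr_deriv ?_
      simp only [Pi.sub_apply, Pi.mul_apply]
      rw [hV]; push_cast; ring
    · simp only [Fper, Fper', uper', hu.2.2.2]; ring
    · have h1 : (F' x : ℂ) ^ 2 / 4 - F x * F'' x / 2 + (6 * p x - a) * F x ^ 2 = s ^ 2 := by
        have := hspec x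
        rw [← hs] at this
        exact_mod_cast this
      linear_combination u x * h1
  have hs2 := Real.sq_sqrt ha.le
  have hs0 := (Real.sqrt_pos.mpr ha).ne'
  set s := √(lameSpectral e₁ e₂ e₃ a)
  obtain ⟨v, v', hv, dv, dv', vper, hvF⟩ := key s hs2
  obtain ⟨w, w', hw, dw, dw', wper, hwF⟩ := key (-s) (by rw [neg_sq, hs2])
  by_cases h : ∃ x, v x ≠ 0
  · exact ⟨s, v, v', hs0, h, dv, dv', vper, hvF⟩
  · refine ⟨-s, w, w', neg_ne_zero.mpr hs0, ?_, dw, dw', wper, hwF⟩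
    by_contra h'
    push Not at h h'
    obtain ⟨x, hx⟩ := hu.2.1
    have h1 := hv x
    have h2 := hw x
    rw [h] at h1
    rw [h'] at h2
    push_cast at h2
    have : (2 * s : ℂ) * u x = 0 := by linear_combination h2 - h1
    have hs0' : (s : ℂ) ≠ 0 := ofReal_ne_zero.mpr hs0
    simp [hs0', hx] at this

/-- If |β| = 1, the conjugate of v(−x) is a solution with the same multiplier. Subtracting a
multiple of it from v to get a zero at 0 gives a zero at 2ω too, so the difference vanishes by
`dirichlet_eq_zero_complex`. But the reflection turns s into −s in the first-order equation, which
forces v = 0. -/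
theorem not_isAllowedEnergy (hp : IsLameProfile ω e₁ e₂ e₃ p p') (hV : ∀ x, V x = 6 * (p x : ℂ))
    {a : ℝ} (ha : 0 < lameSpectral e₁ e₂ e₃ a) (ha2 : a < 3 * e₂) :
    ¬ IsAllowedEnergy V (2 * ω) a := by
  rintro ⟨β, u, hβ, hu⟩
  obtain ⟨s, v, v', hs, ⟨x₀, hx₀⟩, dv, dv', vper, hvF⟩ := hp.exists_bloch_first_order hV ha hu
  have hT : v (2 * ω) = β * v 0 := by rw [← vper, zero_add]
  by_cases h0 : v 0 = 0
  · exact hx₀ (hp.dirichlet_eq_zero_complex ha2 dv dv' h0 (by rw [hT, h0, mul_zero]) x₀)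
  have hββ : (starRingEnd ℂ) β * β = 1 := by
    rw [mul_comm, Complex.mul_conj, Complex.normSq_eq_norm_sq, hβ]; simp
  have hc0 : (starRingEnd ℂ) (v 0) ≠ 0 := (map_ne_zero _).mpr h0
  set k := v 0 / (starRingEnd ℂ) (v 0) with hk
  have dn (f f' : ℝ → ℂ) (hf : ∀ x, HasDerivAt f (f' x) x) (x : ℝ) :
      HasDerivAt (fun x => (starRingEnd ℂ) (f (-x))) (-(starRingEnd ℂ) (f' (-x))) x := by
    have := (HasDerivAt.scomp x (hf (-x)) (hasDerivAt_neg x)).complex_conj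
    simpa using! this
  have hzero := hp.dirichlet_eq_zero_complex ha2
    (f := fun x => v x - k * (starRingEnd ℂ) (v (-x)))
    (f' := fun x => v' x - k * -(starRingEnd ℂ) (v' (-x)))
    (fun x => (dv x).sub ((dn v v' dv x).const_mul k))
    (fun x => ((dv' x).sub ((dn v' _ dv' x).neg.const_mul k)).congr_deriv (by
      simp [hp.even, map_ofNat]; ring))
    (by simp only [neg_zero, hk]; field_simp; ring) (by
      have h1 := vper (-(2 * ω))
      rw [neg_add_cancel] at h1
      have h2 : (starRingEnd ℂ) (v (-(2 * ω))) = β * (starRingEnd ℂ) (v 0) := by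
        rw [h1, map_mul]
        linear_combination -(starRingEnd ℂ) (v (-(2 * ω))) * hββ
      simp only [hT, h2, hk]
      field_simp
      ring)
  have hv (x : ℝ) : v x = k * (starRingEnd ℂ) (v (-x)) := sub_eq_zero.mp (hzero x)
  have hv' (x : ℝ) : v' x = k * -(starRingEnd ℂ) (v' (-x)) :=
    (dv x).unique (((dn v v' dv x).const_mul k).congr_of_eventuallyEq (.of_forall hv))
  have h1 := hvF x₀
  have h2 := congrArg (starRingEnd ℂ) (hvF (-x₀))
  simp only [map_mul, map_add, map_div₀, conj_ofReal, map_ofNat] at h2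
  have e1 : lameProduct e₁ e₂ e₃ p a (-x₀) = lameProduct e₁ e₂ e₃ p a x₀ := by
    simp only [lameProduct, hp.even]
  have e2 : lameProduct' p p' a (-x₀) = -lameProduct' p p' a x₀ := by
    simp only [lameProduct', hp.even, hp.deriv_neg]; ring
  rw [e1, e2] at h2
  have h3 := hv x₀
  have h4 := hv' x₀
  have h5 : (2 * s : ℂ) * v x₀ = 0 := by
    push_cast at h2
    rw [h4] at h1
    linear_combination -h1 - k * h2 + (s - (lameProduct' p p' a x₀ : ℂ) / 2) * h3
  have hs' : (s : ℂ) ≠ 0 := ofReal_ne_zero.mpr hs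
  simp [hs', hx₀] at h5

/-- The spectral polynomial has the zeros −ρ < 3e₃ < 3e₂ < 3e₁ < ρ with ρ² = 6σ, and its sign
settles the open intervals. The edges −ρ, 3e₃, 3e₂ are allowed through the eigenfunctions p − ρ/6,
S₁S₂, S₁S₃. -/
theorem isFirstFiniteForbiddenBand (hp : IsLameProfile ω e₁ e₂ e₃ p p')
    (hV : ∀ x, V x = 6 * (p x : ℂ)) :
    IsFirstFiniteForbiddenBand V (2 * ω) (3 * e₃) (3 * e₂) := by
  have h21 := hp.lt₂₁
  have h32 := hp.lt₃₂
  have hs := hp.sum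
  set σ := e₁ ^ 2 + e₂ ^ 2 + e₃ ^ 2 with hσ
  have σ0 : 0 ≤ 6 * σ := by positivity
  set ρ := √(6 * σ) with hρ
  have hρ2 : ρ ^ 2 = 6 * σ := Real.sq_sqrt σ0
  have hρ1 : 3 * e₁ < ρ := by
    refine Real.lt_sqrt_of_sq_lt ?_
    have := hp.e₃_eq
    have := mul_pos (sub_pos.mpr h32) (sub_pos.mpr h32)
    rw [hσ]; subst e₃
    nlinarith
  have hρ3 : -ρ < 3 * e₃ := by
    rw [neg_lt, ← mul_neg]
    refine Real.lt_sqrt_of_sq_lt ?_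
    have := hp.e₃_eq
    have := mul_pos (sub_pos.mpr h21) (sub_pos.mpr h21)
    rw [hσ]; subst e₃
    nlinarith
  obtain ⟨S₁, S₂, S₃, ε, hS⟩ := hp.exists_roots
  have hneg {a : ℝ} (h1 : -ρ < a) (h2 : a < ρ)
      (h3 : 0 < (3 * e₁ - a) * ((a - 3 * e₂) * (a - 3 * e₃))) : lameSpectral e₁ e₂ e₃ a < 0 := by
    have : 0 < 6 * σ - a ^ 2 := by rw [← hρ2]; nlinarith
    rw [lameSpectral]
    have := mul_pos this h3
    linarith
  have h23 : ∃ x, p x ≠ e₃ ∧ p x ≠ e₂ := hp.exists_ne_ne _ _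
  refine ⟨by linarith, ⟨-ρ, hρ3, fun E hE => ?_, fun E hE => ?_⟩, fun E hE => ?_,
    3 * (e₁ + e₂) / 2, by linarith, fun E hE => ?_⟩
  · refine hp.not_isAllowedEnergy hV ?_ (by linarith)
    have h1 : 0 < E ^ 2 - 6 * σ := by
      rw [← hρ2]; nlinarith [Real.sqrt_nonneg (6 * σ)]
    have h2 : 0 < (3 * e₁ - E) * (3 * e₂ - E) * (3 * e₃ - E) :=
      mul_pos (mul_pos (by linarith) (by linarith)) (by linarith)
    rw [lameSpectral]
    linarith [mul_pos h1 h2]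
  · rcases hE.1.eq_or_lt with h | h
    · rw [← h]
      refine hp.isAllowedEnergy_of_real hV (ε := 1) (u := fun x => p x - ρ / 6) (u' := p')
        (by norm_num) (fun x => (hp.hasDerivAt x).sub_const _)
        (fun x => (hp.hasDerivAt' x).congr_deriv ?_) ?_ fun x => by rw [hp.periodic, one_mul]
      · linear_combination hρ2 / 6
      · obtain ⟨x, hx, -⟩ := hp.exists_ne_ne (ρ / 6) (ρ / 6)
        exact ⟨x, _root_.sub_ne_zero.mpr hx⟩
    rcases hE.2.eq_or_lt with h' | h'
    · rw [h']
      refine hp.isAllowedEnergy_of_real hV hS.sign hS.hasDerivAt₁₂ (hS.hasDerivAt₁₂' hp) ?_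
        fun x => by rw [hS.periodic₁, hS.periodic₂]; ring
      obtain ⟨x, -, hx⟩ := h23
      refine ⟨x, mul_ne_zero (hS.pos x).ne' fun h0 => hx ?_⟩
      have := hS.sq₂ x
      rw [h0] at this
      linarith
    · refine hp.isAllowedEnergy_of_neg hV (hneg h (by linarith) ?_)
      exact mul_pos (by linarith) (mul_pos_of_neg_of_neg (by linarith) (by linarith))
  · refine hp.not_isAllowedEnergy hV ?_ hE.2
    have h1 : 0 < 6 * σ - E ^ 2 := by
      rw [← hρ2]; nlinarith [hE.1, hE.2]
    have h2 : 0 < (3 * e₁ - E) * (3 * e₂ - E) * (E - 3 * e₃) :=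
      mul_pos (mul_pos (by linarith [hE.2]) (by linarith [hE.2])) (by linarith [hE.1])
    rw [lameSpectral]
    linarith [mul_pos h1 h2]
  · rcases hE.1.eq_or_lt with h | h
    · rw [← h]
      refine hp.isAllowedEnergy_of_real hV hS.sign hS.hasDerivAt₁₃ (hS.hasDerivAt₁₃' hp) ?_
        fun x => by rw [hS.periodic₁, hS.periodic₃]; ring
      obtain ⟨x, hx, -⟩ := h23
      refine ⟨x, mul_ne_zero (hS.pos x).ne' fun h0 => hx ?_⟩
      have := hS.sq₃ x
      rw [h0] at this
      linarith
    · have := hE.2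
      refine hp.isAllowedEnergy_of_neg hV (hneg (by linarith) (by linarith) ?_)
      exact mul_pos (by linarith) (mul_pos (by linarith) (by linarith))

end Bands

end IsLameProfile

/-! ### Real factorization constants and the gap -/

namespace IsLameProfile

variable {ω e₁ e₂ e₃ : ℝ} {p p' : ℝ → ℝ}

lemma e₁_pos (hp : IsLameProfile ω e₁ e₂ e₃ p p') : 0 < e₁ := by
  linarith [hp.sum, hp.lt₂₁, hp.lt₃₂]

/-- The factorization constants attached to a point `P ≥ e₁` lie in the first finite gap. -/
lemma mem_gap (hp : IsLameProfile ω e₁ e₂ e₃ p p') {P a₁ a₂ : ℝ} (hP : e₁ ≤ P)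
    (hsum : a₁ + a₂ = -3 * P)
    (hdiff : (a₁ - a₂) ^ 2 = 9 * (2 * (e₁ ^ 2 + e₂ ^ 2 + e₃ ^ 2) - 3 * P ^ 2)) :
    a₁ ∈ Icc (3 * e₃) (3 * e₂) := by
  have h21 := hp.lt₂₁
  have h32 := hp.lt₃₂
  have h0 := hp.e₁_pos
  have he := hp.e₃_eq
  have hq : a₁ ^ 2 + 3 * P * a₁ + 9 * P ^ 2 - 9 / 2 * (e₁ ^ 2 + e₂ ^ 2 + e₃ ^ 2) = 0 := by
    linear_combination a₁ * hsum + (-(a₁ + a₂ - 3 * P) * hsum + hdiff) / 4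
  have hf : (a₁ - 3 * e₂) * (a₁ - 3 * e₃) = 3 * (e₁ - P) * (a₁ + 3 * e₁ + 3 * P) := by
    rw [he] at hq ⊢
    linear_combination hq
  -- In t = a₁ + 3e₁ + 3P the quadratic `hq` reads t² − (6e₁ + 3P)t + 9(e₁P + P² + e₂e₃) = 0, whose
  -- left side is positive for t < 0.
  have hpos : 0 ≤ a₁ + 3 * e₁ + 3 * P := by
    by_contra hc
    push Not at hc
    have h2 : 0 < e₁ * P + P ^ 2 + e₂ * e₃ := by
      have i1 : e₁ * e₁ ≤ e₁ * P := mul_le_mul_of_nonneg_left hP h0.le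
      have i2 : e₁ ^ 2 ≤ P ^ 2 := pow_le_pow_left₀ h0.le hP 2
      have i3 : 0 < (e₁ - e₂) * (2 * e₁ + e₂) := mul_pos (by linarith) (by linarith)
      rw [he]
      nlinarith
    have h3 : 0 < (-(a₁ + 3 * e₁ + 3 * P)) * (6 * e₁ + 3 * P) := mul_pos (by linarith) (by linarith)
    rw [he] at hq h2
    nlinarith [sq_nonneg (a₁ + 3 * e₁ + 3 * P)]
  have hle : (a₁ - 3 * e₂) * (a₁ - 3 * e₃) ≤ 0 := by
    rw [hf]
    exact mul_nonpos_of_nonpos_of_nonneg (by linarith) hpos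
  constructor <;> by_contra hc <;> push Not at hc
  · linarith [mul_pos_of_neg_of_neg (show a₁ - 3 * e₂ < 0 by linarith)
      (show a₁ - 3 * e₃ < 0 by linarith)]
  · linarith [mul_pos (show 0 < a₁ - 3 * e₂ by linarith) (show 0 < a₁ - 3 * e₃ by linarith)]

/-- A pair of constants with the sum and difference attached to `d` realizes the displacement `d`. -/
theorem isDarbouxDisplacement_of_sum_of_diff (hp : IsLameProfile ω e₁ e₂ e₃ p p') {d P P' a₁ a₂ : ℝ}
    (hd : IsLameShift e₁ e₂ e₃ p p' d P P') (hne : a₁ ≠ a₂) (hsum : a₁ + a₂ = -3 * P)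
    (hdiff : (a₁ - a₂) ^ 2 = 9 * (2 * (e₁ ^ 2 + e₂ ^ 2 + e₃ ^ 2) - 3 * P ^ 2)) {V : ℝ → ℂ}
    (hV : ∀ x, V x = 6 * (p x : ℂ)) : IsDarbouxDisplacement V (2 * ω) a₁ a₂ d := by
  have h₁ := hp.mem_gap hd.le hsum hdiff
  have h₂ := hp.mem_gap (a₁ := a₂) (a₂ := a₁) hd.le (by linarith) (by linarith)
  have := hp.isDarbouxDisplacement (m₁ := a₁ / 3) (m₂ := a₂ / 3) hd (by linarith)
    (by linear_combination ((a₁ + a₂ - 3 * P) * hsum - hdiff) / 36) (fun h => hne (by linarith))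
    ⟨by linarith [h₁.1], by linarith [h₁.2]⟩ ⟨by linarith [h₂.1], by linarith [h₂.2]⟩ hV
  rwa [mul_div_cancel₀ _ (three_ne_zero), mul_div_cancel₀ _ (three_ne_zero)] at this

end IsLameProfile

namespace PeriodPair.IsRectangular

variable {L : PeriodPair} {ω τ : ℝ}

lemma lamePotential_eq (h : L.IsRectangular ω τ) (x : ℝ) :
    lamePotential L τ x = 6 * (L.shiftP τ x : ℂ) := by
  rw [lamePotential, h.ofReal_shiftP]

lemma isLameShift (h : L.IsRectangular ω τ) {d : ℝ} (hd : (d : ℂ) ∉ L.lattice) :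
    IsLameShift (L.realP ω) (L.shiftP τ ω) (L.shiftP τ 0) (L.shiftP τ) (L.shiftP' τ) d
      (L.realP d) (L.realP' d) where
  le := h.realP_ω_le hd
  sq := h.realP'_sq hd
  val := h.shiftP_sub_mul hd
  deriv := h.shiftP'_mul hd

lemma shiftP_add_of_mem {d : ℝ} (hd : (d : ℂ) ∈ L.lattice) (x : ℝ) :
    L.shiftP τ (x + d) = L.shiftP τ x := by
  rw [shiftP, shiftP, ← L.weierstrassP_add_of_mem (x + τ * I) hd]
  push_cast
  ring_nf

/-- Real factorization constants giving a real displacement `d`. -/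
theorem isDarbouxDisplacement_iff (h : L.IsRectangular ω τ) (a₁ a₂ d : ℝ) :
    IsDarbouxDisplacement (lamePotential L τ) (2 * ω) a₁ a₂ d ↔
      (d : ℂ) ∉ L.lattice ∧ a₁ ≠ a₂ ∧ a₁ + a₂ = -3 * L.realP d ∧ (a₁ - a₂) ^ 2 =
        9 * (2 * (L.realP ω ^ 2 + L.shiftP τ ω ^ 2 + L.shiftP τ 0 ^ 2) - 3 * L.realP d ^ 2) := by
  have hp := h.isLameProfile
  constructor
  · intro hD
    have hd : (d : ℂ) ∉ L.lattice := fun hd =>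
      hD.not_period hp h.lamePotential_eq (shiftP_add_of_mem hd)
    obtain ⟨h1, h2⟩ := hD.sum_and_diff hp h.lamePotential_eq (h.isLameShift hd)
    exact ⟨hd, fun e => hD.1 (by rw [e]), by exact_mod_cast h1, by exact_mod_cast h2⟩
  · rintro ⟨hd, hne, h1, h2⟩
    exact hp.isDarbouxDisplacement_of_sum_of_diff (h.isLameShift hd) hne h1 h2 h.lamePotential_eq

lemma exists_realP_eq (h : L.IsRectangular ω τ) {Q : ℝ} (hQ : L.realP ω < Q) :
    ∃ d ∈ Ioo 0 ω, L.realP d = Q := by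
  obtain ⟨y, hy1, hy2⟩ := ((L.tendsto_realP.eventually_gt_atTop Q).and
    (Ioo_mem_nhdsGT h.hω)).exists
  have hsub : Icc y ω ⊆ Ioo 0 (2 * ω) := fun x hx =>
    ⟨hy2.1.trans_le hx.1, by linarith [hx.2, h.hω]⟩
  obtain ⟨d, hd, hdQ⟩ := intermediate_value_Icc' hy2.2.le (h.continuousOn_realP.mono hsub)
    ⟨hQ.le, hy1.le⟩
  refine ⟨d, ⟨hy2.1.trans_le hd.1, lt_of_le_of_ne hd.2 ?_⟩, hdQ⟩
  rintro rfl
  exact hQ.ne hdQ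

end PeriodPair.IsRectangular

end

/-! ### Translation of the conditions on ℘(d) into statements about d -/

theorem corollary3 (L : PeriodPair) (ω τ : ℝ) (hω : 0 < ω) (hτ : 0 < τ)
    (h₁ : L.ω₁ = 2 * (ω : ℂ)) (h₂ : L.ω₂ = 2 * ((τ : ℂ) * I)) :
    ∃ g₂ e₂ e₃ dmin : ℝ,
      -- the invariant and the values of `℘` at the half-periods `ω + ω'` and `ω'`
      (g₂ : ℂ) = L.g₂ ∧ 0 < g₂ ∧
      (e₂ : ℂ) = L.weierstrassP (ω + τ * I) ∧ (e₃ : ℂ) = L.weierstrassP (τ * I) ∧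
      -- `dmin = ℘⁻¹(√(g₂ / 3))` on the sheet `(0, ω]`
      dmin ∈ Ioo 0 ω ∧ L.weierstrassP dmin = (√(g₂ / 3) : ℝ) ∧
      (∀ t ∈ Ioc 0 ω, L.weierstrassP t = (√(g₂ / 3) : ℝ) → t = dmin) ∧
      -- the first finite forbidden band is `[E₁, E₁'] = [3 e₃, 3 e₂]`
      IsFirstFiniteForbiddenBand (lamePotential L τ) (2 * ω) (3 * e₃) (3 * e₂) ∧
      -- real factorization constants giving a real displacement lie in that band
      (∀ a₁ a₂ d : ℝ, IsDarbouxDisplacement (lamePotential L τ) (2 * ω) a₁ a₂ d →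
        a₁ ∈ Icc (3 * e₃) (3 * e₂) ∧ a₂ ∈ Icc (3 * e₃) (3 * e₂)) ∧
      -- the real displacements, up to sign and the period `2 ω`, fill `(dmin, ω]`
      {d : ℝ | ∃ a₁ a₂ : ℝ, IsDarbouxDisplacement (lamePotential L τ) (2 * ω) a₁ a₂ d} =
        {d : ℝ | ∃ n : ℤ, |d - 2 * n * ω| ∈ Ioc dmin ω} ∧
      -- `dmax = ω` is realized for `a₁ = E₁'`, `a₂ = E₁`, and for no other pair `a₂ ≤ a₁`
      IsDarbouxDisplacement (lamePotential L τ) (2 * ω) (3 * e₂ : ℝ) (3 * e₃ : ℝ) ω ∧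
      (∀ a₁ a₂ d : ℝ, a₂ ≤ a₁ →
        IsDarbouxDisplacement (lamePotential L τ) (2 * ω) a₁ a₂ d →
        ((∃ n : ℤ, d = ω + 2 * n * ω) ↔ a₁ = 3 * e₂ ∧ a₂ = 3 * e₃)) ∧
      -- `dmin` is the limiting case: as `d → dmin`, both constants tend to `-√(3 g₂) / 2`,
      (∀ ε > 0, ∃ δ > 0, ∀ a₁ a₂ d : ℝ,
        IsDarbouxDisplacement (lamePotential L τ) (2 * ω) a₁ a₂ d → |d - dmin| < δ →
        |a₁ - -√(3 * g₂) / 2| < ε ∧ |a₂ - -√(3 * g₂) / 2| < ε) ∧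
      -- and it is realized by the confluent transformation with `a₁ = a₂ = -√(3 g₂) / 2`,
      -- a value inside the band, and (up to sign and period) by no other
      -√(3 * g₂) / 2 ∈ Ioo (3 * e₃) (3 * e₂) ∧
      (∀ a d : ℝ, IsConfluentDarbouxDisplacement (lamePotential L τ) (2 * ω) a d ↔
        a = -√(3 * g₂) / 2 ∧ ∃ n : ℤ, |d - 2 * n * ω| = dmin) := by
  have h : L.IsRectangular ω τ := ⟨hω, hτ, h₁, h₂⟩
  have hp := h.isLameProfile
  have hiff := h.isDarbouxDisplacement_iff
  have he := hp.e₃_eq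
  have h21 := hp.lt₂₁
  have h32 := hp.lt₃₂
  have h0 := hp.e₁_pos
  have hgap := @hp.mem_gap
  have hanti := h.strictAntiOn_realP
  have hωmem : ω ∈ Ioc 0 ω := ⟨hω, le_rfl⟩
  obtain ⟨-, hg₂, -⟩ := h.vieta
  set e₁ := L.realP ω with he₁
  set e₂ := L.shiftP τ ω with he₂
  set e₃ := L.shiftP τ 0 with he₃
  set σ := e₁ ^ 2 + e₂ ^ 2 + e₃ ^ 2 with hσ
  -- The value of D/9 at P = e₁, the case d = ω: the constants then differ by the full gap length
  -- 3(e₂ − e₃).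
  have hσe : 2 * σ - 3 * e₁ ^ 2 = (e₂ - e₃) ^ 2 := by rw [hσ, he]; ring
  have hσ0 : 0 < σ := by positivity
  -- This is √(g₂/3), the value of P at which the difference of the constants vanishes.
  set Q := √(2 * σ / 3) with hQ
  have hQ2 : Q ^ 2 = 2 * σ / 3 := Real.sq_sqrt (by positivity)
  have hQ0 : 0 < Q := Real.sqrt_pos.mpr (by positivity)
  have hQ3 : √(3 * (2 * σ)) = 3 * Q := by
    rw [show 3 * (2 * σ) = 3 ^ 2 * (2 * σ / 3) by ring, Real.sqrt_mul (by positivity),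
      Real.sqrt_sq (by norm_num)]
  have hQe : e₁ < Q := by
    refine Real.lt_sqrt_of_sq_lt ?_
    have := pow_pos (sub_pos.mpr h32) 2
    linarith
  obtain ⟨dmin, hdmin, hdQ⟩ := h.exists_realP_eq hQe
  have hdmin' : dmin ∈ Ioc 0 ω := Ioo_subset_Ioc_self hdmin
  have hbelow {P a₁ a₂ : ℝ} (hne : a₁ ≠ a₂) (hd : (a₁ - a₂) ^ 2 = 9 * (2 * σ - 3 * P ^ 2)) :
      P < Q := by
    refine Real.lt_sqrt_of_sq_lt ?_
    have : 0 < (a₁ - a₂) ^ 2 := (sq_pos_iff.mpr (sub_ne_zero.mpr hne))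
    linarith
  refine ⟨2 * σ, e₂, e₃, dmin, hg₂.symm, by positivity, h.ofReal_shiftP ω, ?_, hdmin, ?_,
    fun t ht hPt => ?_, hp.isFirstFiniteForbiddenBand h.lamePotential_eq,
    fun a₁ a₂ d hD => ?_, ?_, ?_, fun a₁ a₂ d hle hD => ?_, fun ε hε => ?_, ?_, fun a d => ?_⟩
  · rw [h.ofReal_shiftP]; simp
  · rw [← hQ, ← hdQ, h.ofReal_realP]
  · rw [← hQ, ← hdQ, ← h.ofReal_realP] at hPt
    exact hanti.injOn ht hdmin' (ofReal_injective hPt)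
  · obtain ⟨hd, hne, h1, h2⟩ := (hiff a₁ a₂ d).mp hD
    exact ⟨hgap (h.realP_ω_le hd) h1 h2,
      hgap (a₂ := a₁) (h.realP_ω_le hd) (by linarith) (by linarith)⟩
  · ext d
    simp only [mem_ofPred_eq, hiff]
    constructor
    · rintro ⟨a₁, a₂, hd, hne, h1, h2⟩
      obtain ⟨n, hn⟩ := h.exists_abs_sub_mem_Ioc hd
      refine ⟨n, ?_, hn.2⟩
      by_contra hc
      push Not at hc
      have := hanti.antitoneOn hn hdmin' hc
      rw [hdQ, h.realP_abs_sub] at this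
      exact this.not_gt (hbelow hne h2)
    · rintro ⟨n, hn⟩
      have hn' : |d - 2 * n * ω| ∈ Ioc 0 ω := ⟨hdmin.1.trans hn.1, hn.2⟩
      have hd := h.notMem_of_abs_sub_mem_Ioc hn'
      have hPQ := hanti hdmin' hn' hn.1
      rw [hdQ, h.realP_abs_sub] at hPQ
      have hP0 : 0 ≤ L.realP d := h0.le.trans (h.realP_ω_le hd)
      have hD : 0 < 9 * (2 * σ - 3 * L.realP d ^ 2) := by
        have := pow_lt_pow_left₀ hPQ hP0 two_ne_zero
        linarith
      have hs := Real.sq_sqrt hD.le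
      have hs0 := Real.sqrt_pos.mpr hD
      set s := √(9 * (2 * σ - 3 * L.realP d ^ 2))
      -- The pair with sum −3P and difference s.
      exact ⟨(-3 * L.realP d + s) / 2, (-3 * L.realP d - s) / 2, hd, fun e => by linarith,
        by ring, by rw [← hs]; ring⟩
  · exact (hiff _ _ _).mpr ⟨h.ω_notMem, fun e => by linarith, by rw [he]; ring,
      by linear_combination -9 * hσe⟩
  · obtain ⟨hd, hne, h1, h2⟩ := (hiff a₁ a₂ d).mp hD
    constructor
    · rintro ⟨n, rfl⟩
      have e : L.realP (ω + 2 * n * ω) = e₁ := by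
        rw [← h.realP_abs_sub _ n, add_sub_cancel_right, abs_of_pos hω]
      rw [e] at h1 h2
      have h3 : a₁ - a₂ = 3 * (e₂ - e₃) := by
        refine (sq_eq_sq₀ (by linarith) (by linarith)).mp ?_
        linear_combination h2 + 9 * hσe
      constructor <;> linarith
    · rintro ⟨rfl, rfl⟩
      have e : L.realP d = L.realP ω := by linarith
      obtain ⟨n, hn⟩ := h.exists_abs_sub_mem_Ioc hd
      rw [← h.realP_abs_sub d n] at e
      have e' := hanti.injOn hn hωmem e
      rcases (abs_eq hω.le).mp e' with e' | e'
      · exact ⟨n, by linarith⟩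
      · exact ⟨n - 1, by push_cast; linarith⟩
  · have hcont : ContinuousAt L.realP dmin :=
      (PeriodPair.IsRectangular.hasDerivAt_realP (h.notMem_of_re_Ioo
        (by simpa using ⟨hdmin.1, by linarith [hdmin.2]⟩))).continuousAt
    -- This function of d bounds both |aᵢ + 3Q/2|, because its second term is |a₁ − a₂|; it is 0 at
    -- `dmin`.
    have hψ : ContinuousAt
        (fun d => (3 * |L.realP d - Q| + √(27 * (Q ^ 2 - L.realP d ^ 2))) / 2) dmin := by
      fun_prop
    have hψ0 : (3 * |L.realP dmin - Q| + √(27 * (Q ^ 2 - L.realP dmin ^ 2))) / 2 < ε := by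
      simpa [hdQ] using hε
    obtain ⟨δ, hδ, hball⟩ := Metric.eventually_nhds_iff.mp (hψ.eventually_lt_const hψ0)
    refine ⟨δ, hδ, fun a₁ a₂ d hD hdist => ?_⟩
    obtain ⟨hd, hne, h1, h2⟩ := (hiff a₁ a₂ d).mp hD
    have hlt := hball (y := d) (by rwa [Real.dist_eq])
    have hdiff : |a₁ - a₂| = √(27 * (Q ^ 2 - L.realP d ^ 2)) := by
      rw [← Real.sqrt_sq_eq_abs, h2, hQ2]; ring_nf
    rw [← hdiff] at hlt
    rw [hQ3]
    have c1 := abs_add_le (-3 * (L.realP d - Q)) (a₁ - a₂)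
    have c2 := abs_sub (-3 * (L.realP d - Q)) (a₁ - a₂)
    rw [abs_mul, abs_neg, abs_of_pos (three_pos : (0 : ℝ) < 3)] at c1 c2
    have f1 : a₁ - -(3 * Q) / 2 = (-3 * (L.realP d - Q) + (a₁ - a₂)) / 2 := by linarith
    have f2 : a₂ - -(3 * Q) / 2 = (-3 * (L.realP d - Q) - (a₁ - a₂)) / 2 := by linarith
    rw [f1, f2, abs_div, abs_div, abs_two]
    constructor <;> linarith
  · rw [hQ3]
    have hsQ := hgap (P := Q) (a₁ := -(3 * Q) / 2) (a₂ := -(3 * Q) / 2) hQe.le (by ring)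
      (by rw [hQ2]; ring)
    -- `mem_gap` yields only the closed gap; Q > e₁ makes this product strictly negative and
    -- excludes the edges.
    have hne : (-(3 * Q) / 2 - 3 * e₂) * (-(3 * Q) / 2 - 3 * e₃) < 0 := by
      have e : (-(3 * Q) / 2 - 3 * e₂) * (-(3 * Q) / 2 - 3 * e₃) =
          -(3 * ((Q - e₁) * (3 * e₁ + 3 / 2 * Q))) := by
        rw [hσ, he] at hQ2
        rw [he]
        linear_combination (27 / 4 : ℝ) * hQ2
      rw [e]
      have := mul_pos (sub_pos.mpr hQe) (show 0 < 3 * e₁ + 3 / 2 * Q by linarith)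
      linarith
    refine ⟨lt_of_le_of_ne hsQ.1 fun e => ?_, lt_of_le_of_ne hsQ.2 fun e => ?_⟩
    · rw [← e, sub_self, mul_zero] at hne
      exact hne.false
    · rw [e, sub_self, zero_mul] at hne
      exact hne.false
  · rw [hQ3]
    constructor
    · intro hD
      have hd : (d : ℂ) ∉ L.lattice := fun hd =>
        hD.not_period hp h.lamePotential_eq (PeriodPair.IsRectangular.shiftP_add_of_mem hd)
      obtain ⟨k1, k2⟩ := hD.sum_and_diff hp h.lamePotential_eq (h.isLameShift hd)
      have k1' : 2 * a = -3 * L.realP d := by exact_mod_cast k1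
      have k2' : 0 = 9 * (2 * σ - 3 * L.realP d ^ 2) := by exact_mod_cast k2
      have hP0 : 0 ≤ L.realP d := h0.le.trans (h.realP_ω_le hd)
      have hPQ : L.realP d = Q := (sq_eq_sq₀ hP0 hQ0.le).mp (by linarith)
      obtain ⟨n, hn⟩ := h.exists_abs_sub_mem_Ioc hd
      refine ⟨by linarith, n, hanti.injOn hn hdmin' ?_⟩
      rw [h.realP_abs_sub, hPQ, hdQ]
    · rintro ⟨rfl, n, hn⟩
      have hd := h.notMem_of_abs_sub_mem_Ioc (hn ▸ hdmin')
      have hPQ : L.realP d = Q := by rw [← h.realP_abs_sub d n, hn, hdQ]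
      have hshift := h.isLameShift hd
      have hsQ := hgap (P := Q) (a₁ := -(3 * Q) / 2) (a₂ := -(3 * Q) / 2) hQe.le (by ring)
        (by rw [hQ2]; ring)
      have := hp.isConfluentDarbouxDisplacement (m := -Q / 2) hshift (by rw [hPQ]; ring)
        (by rw [hPQ]; linear_combination -(3 / 4 : ℝ) * hQ2) ⟨by linarith [hsQ.1], by linarith [hsQ.2]⟩
        (fun hz => ?_) h.lamePotential_eq
      · rwa [show 3 * (-Q / 2) = -(3 * Q) / 2 by ring] at this
      -- P' ≠ 0 because P = Q exceeds all three roots of the cubic.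
      · have hs := hshift.sq
        rw [hz, hPQ] at hs
        have := mul_pos (mul_pos (sub_pos.mpr hQe) (sub_pos.mpr (h21.trans hQe)))
          (sub_pos.mpr (h32.trans (h21.trans hQe)))
        linarith
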